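/- **Notation.** A non-empty polydisc of $\mathbb C^n$ is a product of $n$ open discs with radii in $(0,\infty]$. For a non-empty polydisc $U\subset\mathbb C^n$ let $\mathcal M_U$ be the field of meromorphic functions of $t\in U$, let $\hat K_U=\mathcal M_U[[z]][z^{-1}]$, and let $\mathbf E_U=\bigcup_{\nu\ge 1} z^{-1/\nu}\mathcal M_U[z^{-1/\nu}]$. Let $R_U=\hat K_U[\log,(z^{a})_{a\in\mathcal M_U},(e(q))_{q\in\mathbf E_U}]$ be the ring generated over $\hat K_U$ by symbols subject only to the relations $z^{a+b}=z^az^b$, $z^{k}=z^k\in\hat K_U$ for $k\in\mathbb Z$, $e(q_1+q_2)=e(q_1)e(q_2)$, $e(0)=1$. Let $\widehat{\mathbf K}_U$ be its field of fractions, with the derivation $\partial_z$ that extends the usual one of $\hat K_U$ and satisfies $\partial_z\log=z^{-1}$, $\partial_z z^{a}=\frac{a}{z}z^{a}$, $\partial_z e(q)=\partial_z(q)\,e(q)$. If $L=P(D+N)P^{-1}\in \mathrm M_m(\mathcal M_U)$ with $P\in\mathrm{GL}_m(\mathcal M_U)$, $D=\mathrm{Diag}(d_i)$, $N$ nilpotent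 and $DN=ND$, put $z^{L}=P\,\mathrm{Diag}(z^{d_i})\,e^{N\log}P^{-1}$. Let $\mathcal O_U(\{z\})$ be the set of $f=\sum f_i(t)z^i\in\hat K_U$ whose coefficients $f_i$ are analytic on $U$ and such that for every $t\in U$ the series $\sum f_i(t)z^i$ is a germ of a meromorphic function at $z=0$. **Proposition 1.3 (parameterized Hukuhara–Turrittin theorem).** Let $U$ be a non-empty polydisc of $\mathbb C^n$ and let $A(z,t)\in\mathrm M_m(\hat K_U)$. There exists a non-empty polydisc $U'\subset U$ such that the system $\partial_zY(z,t)=A(z,t)Y(z,t)$ has a fundamental solution $F(z,t)\in\mathrm{GL}_m(\widehat{\mathbf K}_{U'})$ of the form $$F(z,t)=\hat H(z,t)\,z^{L(t)}\,e(Q(z,t)),$$ where - $\hat H(z,t)\in\mathrm{GL}_m(\hat K_{U'}[z^{1/\nu}])$ for some integer $\nu\ge 1$; - $L(t)\in\mathrm M_m(\mathcal M_{U'})$, and $z^{L(t)}$ is defined over $U'$ (that is, $L(t)$ has a decomposition as above over $\mathcal M_{U'}$); - $e(Q(z,t))=\mathrm{Diag}(e(q_i(z,t)))$ with $q_i(z,t)\in\mathbf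 E_{U'}$; - $e(Q(z,t))\,z^{L(t)}=z^{L(t)}\,e(Q(z,t))$. Furthermore, if $A(z,t)\in\mathrm M_m(\mathcal O_U(\{z\}))$, then $U'$ and the solution can be chosen so that there is a non-empty polydisc $U''\subset U'$ on which all the $z$-coefficients of $\hat H(z,t)$ are analytic. -/

import Mathlib

open scoped Topology

noncomputable section

namespace ParamHT

/-! ### Generic points, polydiscs and meromorphic functions of several variables -/

/-- The filter of sets containing an open set that is dense in `V`. -/
def generic {X : Type*} [TopologicalSpace X] (V : TopologicalSpace.Opens X) : Filter X where
  sets := {S | ∃ D : Set X, IsOpen D ∧ (V : Set X) ⊆ closure (V ∩ D) ∧ D ⊆ S}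
  univ_sets := ⟨Set.univ, isOpen_univ, by simpa using subset_closure, subset_rfl⟩
  sets_of_superset := by
    rintro S T ⟨D, hD, hV, hS⟩ hST
    exact ⟨D, hD, hV, hS.trans hST⟩
  inter_sets := by
    rintro S T ⟨D, hD, hVD, hDS⟩ ⟨E, hE, hVE, hET⟩
    refine ⟨D ∩ E, hD.inter hE, ?_, Set.inter_subset_inter hDS hET⟩
    intro p hp
    rw [mem_closure_iff]
    intro N hN hpN
    obtain ⟨x, hxN, hxV, hxD⟩ := mem_closure_iff.1 (hVD hp) N hN hpN
    obtain ⟨y, ⟨hyN, hyD⟩, hyV, hyE⟩ :=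
      mem_closure_iff.1 (hVE hxV) (N ∩ D) (hN.inter hD) ⟨hxN, hxD⟩
    exact ⟨y, hyN, hyV, hyD, hyE⟩

theorem generic_mono {X : Type*} [TopologicalSpace X] {V W : TopologicalSpace.Opens X}
    (h : V ≤ W) : generic V ≤ generic W := by
  rintro S ⟨D, hD, hW, hS⟩
  refine ⟨D, hD, ?_, hS⟩
  intro p hp
  rw [mem_closure_iff]
  intro N hN hpN
  obtain ⟨x, ⟨hxN, hxV⟩, _, hxD⟩ :=
    mem_closure_iff.1 (hW (h hp)) (N ∩ V) (hN.inter V.isOpen) ⟨hpN, hp⟩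
  exact ⟨x, hxN, hxV, hxD⟩

/-- The points of `ℂⁿ`; only its topology and its analytic structure are used. -/
abbrev Param (n : ℕ) := Fin n → ℂ

/-- Non-empty open polydiscs: products of open discs with radii in `(0, ∞]`. -/
def IsPolydisc {n : ℕ} (U : TopologicalSpace.Opens (Param n)) : Prop :=
  ∃ (c : Param n) (r : Fin n → ENNReal), (∀ i, 0 < r i) ∧
    (U : Set (Param n)) = Set.univ.pi fun i => Metric.eball (c i) (r i)

/-- Near every point of `U`, the function `f` is generically a quotient `g / h` of two analytic
functions, where `h` vanishes on no non-empty open set. -/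
def LocallyQuotient {n : ℕ} (U : TopologicalSpace.Opens (Param n)) (f : Param n → ℂ) : Prop :=
  ∀ p ∈ U, ∃ W : TopologicalSpace.Opens (Param n), p ∈ W ∧ W ≤ U ∧
    ∃ g h : Param n → ℂ, AnalyticOnNhd ℂ g W ∧ AnalyticOnNhd ℂ h W ∧
      ∀ᶠ t in generic W, h t ≠ 0 ∧ f t = g t / h t

theorem LocallyQuotient.of_analytic {n : ℕ} {U : TopologicalSpace.Opens (Param n)}
    {f : Param n → ℂ} (hf : AnalyticOnNhd ℂ f U) : LocallyQuotient U f := fun p hp =>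
  ⟨U, hp, le_rfl, f, fun _ => 1, hf, analyticOnNhd_const, by simp⟩

theorem LocallyQuotient.mono {n : ℕ} {U V : TopologicalSpace.Opens (Param n)} (hVU : V ≤ U)
    {f : Param n → ℂ} (hf : LocallyQuotient U f) : LocallyQuotient V f := by
  intro p hp
  obtain ⟨W, hpW, -, g, h, hg, hh, e⟩ := hf p (hVU hp)
  exact ⟨W ⊓ V, ⟨hpW, hp⟩, inf_le_right, g, h, hg.mono fun _ hx => hx.1,
    hh.mono fun _ hx => hx.1, generic_mono inf_le_left e⟩

theorem LocallyQuotient.add {n : ℕ} {U : TopologicalSpace.Opens (Param n)}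
    {f₁ f₂ : Param n → ℂ} (h₁ : LocallyQuotient U f₁) (h₂ : LocallyQuotient U f₂) :
    LocallyQuotient U (f₁ + f₂) := by
  intro p hp
  obtain ⟨W₁, hp₁, hW₁, a, b, ha, hb, e₁⟩ := h₁ p hp
  obtain ⟨W₂, hp₂, hW₂, c, d, hc, hd, e₂⟩ := h₂ p hp
  have l₁ : W₁ ⊓ W₂ ≤ W₁ := inf_le_left
  have l₂ : W₁ ⊓ W₂ ≤ W₂ := inf_le_right
  refine ⟨W₁ ⊓ W₂, ⟨hp₁, hp₂⟩, l₁.trans hW₁, a * d + b * c, b * d,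
    ((ha.mono l₁).mul (hd.mono l₂)).add ((hb.mono l₁).mul (hc.mono l₂)),
    (hb.mono l₁).mul (hd.mono l₂), ?_⟩
  filter_upwards [generic_mono l₁ e₁, generic_mono l₂ e₂] with t ⟨x₁, y₁⟩ ⟨x₂, y₂⟩
  refine ⟨mul_ne_zero x₁ x₂, ?_⟩
  simp only [Pi.add_apply, Pi.mul_apply, y₁, y₂]
  rw [div_add_div _ _ x₁ x₂]

theorem LocallyQuotient.mul {n : ℕ} {U : TopologicalSpace.Opens (Param n)}
    {f₁ f₂ : Param n → ℂ} (h₁ : LocallyQuotient U f₁) (h₂ : LocallyQuotient U f₂) :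
    LocallyQuotient U (f₁ * f₂) := by
  intro p hp
  obtain ⟨W₁, hp₁, hW₁, a, b, ha, hb, e₁⟩ := h₁ p hp
  obtain ⟨W₂, hp₂, hW₂, c, d, hc, hd, e₂⟩ := h₂ p hp
  have l₁ : W₁ ⊓ W₂ ≤ W₁ := inf_le_left
  have l₂ : W₁ ⊓ W₂ ≤ W₂ := inf_le_right
  refine ⟨W₁ ⊓ W₂, ⟨hp₁, hp₂⟩, l₁.trans hW₁, a * c, b * d,
    (ha.mono l₁).mul (hc.mono l₂), (hb.mono l₁).mul (hd.mono l₂), ?_⟩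
  filter_upwards [generic_mono l₁ e₁, generic_mono l₂ e₂] with t ⟨x₁, y₁⟩ ⟨x₂, y₂⟩
  refine ⟨mul_ne_zero x₁ x₂, ?_⟩
  simp only [Pi.mul_apply, y₁, y₂]
  rw [div_mul_div_comm]

/-- Meromorphic functions on `U`: functions that are locally quotients of analytic functions,
where two functions are identified if they agree on an open dense subset of `U`. -/
def meromorphicSubring {n : ℕ} (U : TopologicalSpace.Opens (Param n)) :
    Subring (Filter.Germ (generic U) ℂ) where
  carrier := {c | ∃ f : Param n → ℂ, (f : Filter.Germ (generic U) ℂ) = c ∧ LocallyQuotient U f}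
  mul_mem' := by
    rintro _ _ ⟨f, rfl, hf⟩ ⟨g, rfl, hg⟩
    exact ⟨f * g, rfl, hf.mul hg⟩
  one_mem' := ⟨fun _ => 1, rfl, .of_analytic analyticOnNhd_const⟩
  add_mem' := by
    rintro _ _ ⟨f, rfl, hf⟩ ⟨g, rfl, hg⟩
    exact ⟨f + g, rfl, hf.add hg⟩
  zero_mem' := ⟨fun _ => 0, rfl, .of_analytic analyticOnNhd_const⟩
  neg_mem' := by
    rintro _ ⟨f, rfl, hf⟩
    refine ⟨(fun _ => -1) * f, ?_, (LocallyQuotient.of_analytic analyticOnNhd_const).mul hf⟩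
    rw [← Filter.Germ.coe_neg]
    congr 1
    ext t
    simp

/-- The ring `𝓜_U` of meromorphic functions on `U` (a field when `U` is a polydisc). -/
def Mer {n : ℕ} (U : TopologicalSpace.Opens (Param n)) : Type := ↥(meromorphicSubring U)

instance {n : ℕ} (U : TopologicalSpace.Opens (Param n)) : CommRing (Mer U) :=
  inferInstanceAs (CommRing ↥(meromorphicSubring U))

/-- The constant functions. -/
def Mer.const {n : ℕ} (U : TopologicalSpace.Opens (Param n)) : ℂ →+* Mer U where
  toFun a := ⟨((fun _ => a : Param n → ℂ) : Filter.Germ (generic U) ℂ), _, rfl,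
    .of_analytic analyticOnNhd_const⟩
  map_one' := rfl
  map_mul' _ _ := rfl
  map_zero' := rfl
  map_add' _ _ := rfl

/-- Restriction of meromorphic functions to a smaller open set. -/
def Mer.restrict {n : ℕ} {U V : TopologicalSpace.Opens (Param n)} (hVU : V ≤ U) :
    Mer U →+* Mer V where
  toFun c := ⟨c.1.compTendsto id (generic_mono hVU), by
    obtain ⟨_, f, rfl, hf⟩ := c
    exact ⟨f, rfl, hf.mono hVU⟩⟩
  map_one' := rfl
  map_mul' := by
    rintro ⟨_, f, rfl, hf⟩ ⟨_, g, rfl, hg⟩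
    rfl
  map_zero' := rfl
  map_add' := by
    rintro ⟨_, f, rfl, hf⟩ ⟨_, g, rfl, hg⟩
    rfl

/-- The meromorphic function `c` on `U` is, on `V ⊆ U`, given by the function `g`, analytic
on `V`. -/
def Mer.IsAnalyticRep {n : ℕ} {U : TopologicalSpace.Opens (Param n)} (c : Mer U)
    {V : TopologicalSpace.Opens (Param n)} (hVU : V ≤ U) (g : Param n → ℂ) : Prop :=
  AnalyticOnNhd ℂ g V ∧ (Mer.restrict hVU c).1 = (g : Filter.Germ (generic V) ℂ)

/-- The meromorphic function `c` on `U` is analytic on `V ⊆ U`. -/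
def Mer.IsAnalyticOn {n : ℕ} {U : TopologicalSpace.Opens (Param n)} (c : Mer U)
    {V : TopologicalSpace.Opens (Param n)} (hVU : V ≤ U) : Prop :=
  ∃ g : Param n → ℂ, Mer.IsAnalyticRep c hVU g

/-! ### Formal Laurent series in `z` -/

/-- `K̂_U = 𝓜_U[[z]][z⁻¹]`; its derivation `∂_z` is `LaurentSeries.derivative`. -/
abbrev KHat {n : ℕ} (U : TopologicalSpace.Opens (Param n)) := LaurentSeries (Mer U)

/-- Coefficientwise restriction `K̂_U → K̂_V`. -/
def KHat.restrict {n : ℕ} {U V : TopologicalSpace.Opens (Param n)} (hVU : V ≤ U)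
    (f : KHat U) : KHat V :=
  HahnSeries.map f (Mer.restrict hVU)

/-- The subset `𝓞_U({z})` of `K̂_U`: the coefficients are analytic functions `φ i` on `U`, and for
every `t ∈ U` the series `∑ φ i (t) zⁱ` is a germ of a meromorphic function at `z = 0`. -/
def IsConvergent {n : ℕ} {U : TopologicalSpace.Opens (Param n)} (f : KHat U) : Prop :=
  ∃ φ : ℤ → Param n → ℂ, (∀ i, Mer.IsAnalyticRep (f.coeff i) le_rfl (φ i)) ∧
    ∀ t ∈ U, ∃ g : ℂ → ℂ, MeromorphicAt g 0 ∧
      ∀ᶠ z in 𝓝[≠] (0 : ℂ), HasSum (fun i : ℤ => φ i t * z ^ i) (g z)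

/-- The Euler operator `z ∂_z` on formal Laurent series. -/
def euler {S : Type*} [CommRing S] (f : LaurentSeries S) : LaurentSeries S where
  coeff i := (i : S) * f.coeff i
  isPWO_support' := f.isPWO_support.mono fun i hi h0 => hi (by simp [h0])

theorem support_euler {S : Type*} [CommRing S] (f : LaurentSeries S) :
    (euler f).support ⊆ f.support := fun i hi h0 => hi (by simp [euler, h0])

theorem euler_mul {S : Type*} [CommRing S] (f g : LaurentSeries S) :
    euler (f * g) = f * euler g + g * euler f := by
  ext i
  rw [HahnSeries.coeff_add, mul_comm g,
    HahnSeries.coeff_mul_right' g.isPWO_support (support_euler g),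
    HahnSeries.coeff_mul_left' f.isPWO_support (support_euler f), ← Finset.sum_add_distrib]
  simp only [euler, HahnSeries.coeff_mul, Finset.mul_sum]
  refine Finset.sum_congr rfl fun p hp => ?_
  rw [← (Finset.mem_antidiagonal.1 hp).2.2]
  push_cast
  ring

theorem derivative_eq_euler {S : Type*} [CommRing S] (f : LaurentSeries S) :
    LaurentSeries.derivative S f = HahnSeries.single (-1) 1 * euler f := by
  ext i
  simp [LaurentSeries.derivative_apply, LaurentSeries.hasseDeriv_coeff,
    HahnSeries.coeff_single_mul, euler]

/-- The product rule for the derivative of formal Laurent series. -/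
theorem derivative_mul {S : Type*} [CommRing S] (f g : LaurentSeries S) :
    LaurentSeries.derivative S (f * g) =
      f * LaurentSeries.derivative S g + g * LaurentSeries.derivative S f := by
  simp only [derivative_eq_euler, euler_mul]
  ring

theorem derivative_one {S : Type*} [CommRing S] :
    LaurentSeries.derivative S (1 : LaurentSeries S) = 0 := by
  have h := derivative_mul (1 : LaurentSeries S) 1
  simp only [one_mul] at h
  simpa using h

/-! ### The field `K̂_U(log, z^a, e(q))` -/

/-- `𝐄_U = ⋃_ν z^(-1/ν) 𝓜_U[z^(-1/ν)]`: the finitely supported `q` stands for `∑ r, q r z^(-r)`,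
the exponents `r` being positive rational numbers. -/
abbrev ExpPart {n : ℕ} (U : TopologicalSpace.Opens (Param n)) : Type :=
  {r : ℚ // 0 < r} →₀ Mer U

/-- The symbols `log`, `z^a` with `a ∈ 𝓜_U`, and `e(q)` with `q ∈ 𝐄_U`. -/
inductive Symb {n : ℕ} (U : TopologicalSpace.Opens (Param n)) : Type
  | log : Symb U
  | pow (a : Mer U) : Symb U
  | exp (q : ExpPart U) : Symb U

/-- The relations between the symbols: `z^(a+b) = z^a z^b`, `z^k = z^k ∈ K̂_U` for `k ∈ ℤ`,
`e(q₁+q₂) = e(q₁) e(q₂)` and `e(0) = 1`. -/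
inductive Rel {n : ℕ} (U : TopologicalSpace.Opens (Param n)) :
    MvPolynomial (Symb U) (KHat U) → Prop
  | pow_add (a b : Mer U) : Rel U (MvPolynomial.X (Symb.pow (a + b)) -
      MvPolynomial.X (Symb.pow a) * MvPolynomial.X (Symb.pow b))
  | pow_int (k : ℤ) : Rel U (MvPolynomial.X (Symb.pow (k : Mer U)) -
      MvPolynomial.C (HahnSeries.single k 1))
  | exp_add (p q : ExpPart U) : Rel U (MvPolynomial.X (Symb.exp (p + q)) -
      MvPolynomial.X (Symb.exp p) * MvPolynomial.X (Symb.exp q))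
  | exp_zero : Rel U (MvPolynomial.X (Symb.exp 0) - 1)

/-- The ring `R_U = K̂_U[log, (z^a), (e(q))]`. -/
def SymRing {n : ℕ} (U : TopologicalSpace.Opens (Param n)) : Type :=
  MvPolynomial (Symb U) (KHat U) ⧸ Ideal.span {p | Rel U p}

instance {n : ℕ} (U : TopologicalSpace.Opens (Param n)) : CommRing (SymRing U) :=
  inferInstanceAs (CommRing (MvPolynomial (Symb U) (KHat U) ⧸ Ideal.span {p | Rel U p}))

/-- The class of a polynomial in the symbols. -/
def SymRing.mk {n : ℕ} (U : TopologicalSpace.Opens (Param n)) :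
    MvPolynomial (Symb U) (KHat U) →+* SymRing U :=
  Ideal.Quotient.mk (Ideal.span {p | Rel U p})

theorem SymRing.mk_rel {n : ℕ} {U : TopologicalSpace.Opens (Param n)}
    {p : MvPolynomial (Symb U) (KHat U)} (hp : Rel U p) : SymRing.mk U p = 0 :=
  Ideal.Quotient.eq_zero_iff_mem.2 (Ideal.subset_span hp)

/-- Homomorphisms out of `R_U` are homomorphisms of polynomials respecting the relations. -/
def SymRing.lift {n : ℕ} {U : TopologicalSpace.Opens (Param n)} {B : Type*} [CommRing B]
    (φ : MvPolynomial (Symb U) (KHat U) →+* B) (hφ : ∀ p, Rel U p → φ p = 0) : SymRing U →+* B :=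
  Ideal.Quotient.lift (Ideal.span {p | Rel U p}) φ fun _ hp =>
    (Ideal.span_le (I := RingHom.ker φ)).2 (fun q hq => hφ q hq) hp

theorem SymRing.lift_mk {n : ℕ} {U : TopologicalSpace.Opens (Param n)} {B : Type*} [CommRing B]
    (φ : MvPolynomial (Symb U) (KHat U) →+* B) (hφ : ∀ p, Rel U p → φ p = 0)
    (p : MvPolynomial (Symb U) (KHat U)) : SymRing.lift φ hφ (SymRing.mk U p) = φ p :=
  Ideal.Quotient.lift_mk _ _ _

theorem SymRing.mk_surjective {n : ℕ} {U : TopologicalSpace.Opens (Param n)} :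
    Function.Surjective (SymRing.mk U) :=
  Ideal.Quotient.mk_surjective

/-- `𝐊̂_U = K̂_U(log, (z^a), (e(q)))`, the ring of fractions of `R_U` with respect to its
non-zero-divisors. This is the fraction field when `U` is a polydisc, `R_U` being then an integral
domain. -/
def KBold {n : ℕ} (U : TopologicalSpace.Opens (Param n)) : Type :=
  FractionRing (SymRing U)

instance {n : ℕ} (U : TopologicalSpace.Opens (Param n)) : CommRing (KBold U) :=
  inferInstanceAs (CommRing (FractionRing (SymRing U)))

instance {n : ℕ} (U : TopologicalSpace.Opens (Param n)) : Algebra (SymRing U) (KBold U) :=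
  inferInstanceAs (Algebra (SymRing U) (FractionRing (SymRing U)))

instance {n : ℕ} (U : TopologicalSpace.Opens (Param n)) :
    IsLocalization (nonZeroDivisors (SymRing U)) (KBold U) :=
  inferInstanceAs (IsLocalization (nonZeroDivisors (SymRing U)) (FractionRing (SymRing U)))

/-- The element of `𝐊̂_U` given by a polynomial in the symbols. -/
def ofPoly {n : ℕ} (U : TopologicalSpace.Opens (Param n)) :
    MvPolynomial (Symb U) (KHat U) →+* KBold U :=
  (algebraMap (SymRing U) (KBold U)).comp (SymRing.mk U)

theorem ofPoly_rel {n : ℕ} {U : TopologicalSpace.Opens (Param n)}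
    {p : MvPolynomial (Symb U) (KHat U)} (hp : Rel U p) : ofPoly U p = 0 := by
  rw [ofPoly, RingHom.comp_apply, SymRing.mk_rel hp, map_zero]

/-- The inclusion `K̂_U → 𝐊̂_U`. -/
def ofKHat {n : ℕ} (U : TopologicalSpace.Opens (Param n)) : KHat U →+* KBold U :=
  (ofPoly U).comp MvPolynomial.C

/-- The inclusion `𝓜_U → 𝐊̂_U`. -/
def ofMer {n : ℕ} (U : TopologicalSpace.Opens (Param n)) : Mer U →+* KBold U :=
  (ofKHat U).comp HahnSeries.C

/-- The symbol `log` in `𝐊̂_U`. -/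
def zlog {n : ℕ} (U : TopologicalSpace.Opens (Param n)) : KBold U :=
  ofPoly U (MvPolynomial.X Symb.log)

/-- The symbol `z^a` in `𝐊̂_U`. -/
def zpow {n : ℕ} {U : TopologicalSpace.Opens (Param n)} (a : Mer U) : KBold U :=
  ofPoly U (MvPolynomial.X (Symb.pow a))

/-- The symbol `e(q)` in `𝐊̂_U`. -/
def zexp {n : ℕ} {U : TopologicalSpace.Opens (Param n)} (q : ExpPart U) : KBold U :=
  ofPoly U (MvPolynomial.X (Symb.exp q))

/-- The power `z^r` with a rational exponent `r`. -/
def zrat {n : ℕ} (U : TopologicalSpace.Opens (Param n)) (r : ℚ) : KBold U :=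
  zpow (Mer.const U (r : ℂ))

theorem zpow_add {n : ℕ} {U : TopologicalSpace.Opens (Param n)} (a b : Mer U) :
    zpow (a + b) = zpow a * zpow b := by
  rw [zpow, zpow, zpow, ← map_mul, ← sub_eq_zero, ← map_sub,
    ofPoly_rel (Rel.pow_add a b)]

theorem zpow_int {n : ℕ} {U : TopologicalSpace.Opens (Param n)} (k : ℤ) :
    zpow (k : Mer U) = ofKHat U (HahnSeries.single k 1) := by
  rw [zpow, ofKHat, RingHom.comp_apply, ← sub_eq_zero, ← map_sub,
    ofPoly_rel (Rel.pow_int k)]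

theorem zexp_add {n : ℕ} {U : TopologicalSpace.Opens (Param n)} (p q : ExpPart U) :
    zexp (p + q) = zexp p * zexp q := by
  rw [zexp, zexp, zexp, ← map_mul, ← sub_eq_zero, ← map_sub,
    ofPoly_rel (Rel.exp_add p q)]

theorem zexp_zero {n : ℕ} {U : TopologicalSpace.Opens (Param n)} :
    zexp (0 : ExpPart U) = 1 := by
  rw [zexp, ← map_one (ofPoly U), ← sub_eq_zero, ← map_sub,
    ofPoly_rel Rel.exp_zero]

/-- The derivative `∂_z q = ∑ r, -r q_r z^(-r-1)` of `q = ∑ r, q_r z^(-r) ∈ 𝐄_U`. -/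
def expDeriv {n : ℕ} {U : TopologicalSpace.Opens (Param n)} (q : ExpPart U) : KBold U :=
  q.sum fun r c => ofMer U (Mer.const U (-(r.1 : ℂ)) * c) * zrat U (-r.1 - 1)

theorem expDeriv_add {n : ℕ} {U : TopologicalSpace.Opens (Param n)} (p q : ExpPart U) :
    expDeriv (p + q) = expDeriv p + expDeriv q :=
  Finsupp.sum_add_index' (by simp) (by intros; simp only [mul_add, map_add, add_mul])

/-- The derivatives of the symbols: `∂_z log = z⁻¹`, `∂_z z^a = (a/z) z^a` and
`∂_z e(q) = ∂_z(q) e(q)`. -/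
def symbDeriv {n : ℕ} {U : TopologicalSpace.Opens (Param n)} : Symb U → KBold U
  | .log => ofKHat U (HahnSeries.single (-1) 1)
  | .pow a => ofKHat U (HahnSeries.single (-1) a) * zpow a
  | .exp q => expDeriv q * zexp q

/-- If `i : A → B` is a ring homomorphism and `d : A → B` is additive and satisfies the product
rule, then `f ↦ i f + ε d f` is a ring homomorphism to the dual numbers. -/
def dualHom {A B : Type*} [CommRing A] [CommRing B] (i : A →+* B) (d : A →+ B) (h₁ : d 1 = 0)
    (hd : ∀ f g, d (f * g) = i f * d g + i g * d f) : A →+* DualNumber B where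
  toFun f := TrivSqZeroExt.inl (i f) + TrivSqZeroExt.inr (d f)
  map_one' := by simp [h₁]
  map_mul' f g := by
    ext
    · simp
    · simp only [TrivSqZeroExt.snd_add, TrivSqZeroExt.snd_inl, TrivSqZeroExt.snd_inr, zero_add, hd,
        DualNumber.snd_mul, TrivSqZeroExt.fst_add, TrivSqZeroExt.fst_inl, TrivSqZeroExt.fst_inr,
        add_zero]
      ring
  map_zero' := by simp
  map_add' f g := by
    ext <;> simp

/-- The ring homomorphism `f ↦ f + ε ∂_z f` on `K̂_U`. -/
def dualKHat {n : ℕ} (U : TopologicalSpace.Opens (Param n)) :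
    KHat U →+* DualNumber (KBold U) :=
  dualHom (ofKHat U)
    ((ofKHat U).toAddMonoidHom.comp (LaurentSeries.derivative (Mer U)).toAddMonoidHom)
    (by
      change ofKHat U (LaurentSeries.derivative (Mer U) 1) = 0
      rw [derivative_one, map_zero])
    (fun f g => by
      change ofKHat U (LaurentSeries.derivative (Mer U) (f * g)) =
        ofKHat U f * ofKHat U (LaurentSeries.derivative (Mer U) g) +
          ofKHat U g * ofKHat U (LaurentSeries.derivative (Mer U) f)
      rw [derivative_mul, map_add, map_mul, map_mul])

/-- The ring homomorphism `f ↦ f + ε ∂_z f` on polynomials in the symbols. -/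
def dualPoly {n : ℕ} (U : TopologicalSpace.Opens (Param n)) :
    MvPolynomial (Symb U) (KHat U) →+* DualNumber (KBold U) :=
  MvPolynomial.eval₂Hom (dualKHat U) fun s =>
    TrivSqZeroExt.inl (ofPoly U (MvPolynomial.X s)) + TrivSqZeroExt.inr (symbDeriv s)

theorem fst_dualPoly {n : ℕ} {U : TopologicalSpace.Opens (Param n)}
    (p : MvPolynomial (Symb U) (KHat U)) : (dualPoly U p).fst = ofPoly U p := by
  have h : (TrivSqZeroExt.fstHom (KBold U) (KBold U) (KBold U)).toRingHom.comp (dualPoly U) =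
      ofPoly U := by
    refine MvPolynomial.ringHom_ext (fun f => ?_) fun s => ?_
    · simp [dualPoly, dualKHat, dualHom, ofKHat]
    · simp [dualPoly]
  exact congrArg (fun φ : _ →+* KBold U => φ p) h

theorem snd_dualPoly_X {n : ℕ} {U : TopologicalSpace.Opens (Param n)} (s : Symb U) :
    (dualPoly U (MvPolynomial.X s)).snd = symbDeriv s := by
  simp [dualPoly]

theorem snd_dualPoly_C {n : ℕ} {U : TopologicalSpace.Opens (Param n)} (f : KHat U) :
    (dualPoly U (MvPolynomial.C f)).snd = ofKHat U (LaurentSeries.derivative (Mer U) f) := by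
  simp [dualPoly, dualKHat, dualHom]

theorem dualPoly_rel {n : ℕ} {U : TopologicalSpace.Opens (Param n)}
    {p : MvPolynomial (Symb U) (KHat U)} (hp : Rel U p) : dualPoly U p = 0 := by
  refine TrivSqZeroExt.ext (by rw [fst_dualPoly, ofPoly_rel hp, TrivSqZeroExt.fst_zero]) ?_
  cases hp with
  | pow_add a b =>
    rw [map_sub, map_mul, TrivSqZeroExt.snd_sub, DualNumber.snd_mul, fst_dualPoly, fst_dualPoly,
      snd_dualPoly_X, snd_dualPoly_X, snd_dualPoly_X, TrivSqZeroExt.snd_zero]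
    change ofKHat U _ * zpow (a + b) -
      (zpow a * (ofKHat U _ * zpow b) + ofKHat U _ * zpow a * zpow b) = 0
    rw [zpow_add, HahnSeries.single_add, map_add]
    ring
  | pow_int k =>
    rw [map_sub, TrivSqZeroExt.snd_sub, snd_dualPoly_X, snd_dualPoly_C, TrivSqZeroExt.snd_zero]
    change ofKHat U _ * zpow (k : Mer U) - _ = 0
    rw [zpow_int, ← map_mul, ← map_sub, HahnSeries.single_mul_single,
      LaurentSeries.derivative_apply, LaurentSeries.hasseDeriv_single]
    simp [add_comm, sub_eq_add_neg]
  | exp_add p q =>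
    rw [map_sub, map_mul, TrivSqZeroExt.snd_sub, DualNumber.snd_mul, fst_dualPoly, fst_dualPoly,
      snd_dualPoly_X, snd_dualPoly_X, snd_dualPoly_X, TrivSqZeroExt.snd_zero]
    change expDeriv (p + q) * zexp (p + q) -
      (zexp p * (expDeriv q * zexp q) + expDeriv p * zexp p * zexp q) = 0
    rw [zexp_add, expDeriv_add]
    ring
  | exp_zero =>
    rw [map_sub, map_one, TrivSqZeroExt.snd_sub, snd_dualPoly_X, TrivSqZeroExt.snd_zero]
    simp [symbDeriv, expDeriv]

theorem fst_lift_dualPoly {n : ℕ} {U : TopologicalSpace.Opens (Param n)} (x : SymRing U) :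
    (SymRing.lift (dualPoly U) (fun _ => dualPoly_rel) x).fst =
      algebraMap (SymRing U) (KBold U) x := by
  obtain ⟨p, rfl⟩ := SymRing.mk_surjective x
  rw [SymRing.lift_mk, fst_dualPoly]
  rfl

/-- The ring homomorphism `x ↦ x + ε ∂_z x` on `𝐊̂_U`. -/
def dualKBold {n : ℕ} (U : TopologicalSpace.Opens (Param n)) :
    KBold U →+* DualNumber (KBold U) :=
  IsLocalization.lift (M := nonZeroDivisors (SymRing U))
    (g := SymRing.lift (dualPoly U) fun _ => dualPoly_rel) fun y => by
      rw [TrivSqZeroExt.isUnit_iff_isUnit_fst, fst_lift_dualPoly]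
      exact IsLocalization.map_units (KBold U) y

theorem dualKBold_algebraMap {n : ℕ} {U : TopologicalSpace.Opens (Param n)} (x : SymRing U) :
    dualKBold U (algebraMap (SymRing U) (KBold U) x) =
      SymRing.lift (dualPoly U) (fun _ => dualPoly_rel) x :=
  IsLocalization.lift_eq _ _

theorem fst_dualKBold {n : ℕ} {U : TopologicalSpace.Opens (Param n)} (x : KBold U) :
    (dualKBold U x).fst = x := by
  have h : (TrivSqZeroExt.fstHom (KBold U) (KBold U) (KBold U)).toRingHom.comp (dualKBold U) =
      RingHom.id (KBold U) := by
    refine IsLocalization.ringHom_ext (nonZeroDivisors (SymRing U)) (RingHom.ext fun x => ?_)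
    change (dualKBold U (algebraMap (SymRing U) (KBold U) x)).fst = _
    rw [dualKBold_algebraMap, fst_lift_dualPoly]
    rfl
  exact congrArg (fun φ : _ →+* KBold U => φ x) h

/-- The derivation `∂_z` of `𝐊̂_U`. -/
def dz {n : ℕ} (U : TopologicalSpace.Opens (Param n)) : Derivation ℤ (KBold U) (KBold U) :=
  Derivation.mk'
    { toFun x := (dualKBold U x).snd
      map_add' x y := by simp
      map_smul' k x := by simp } fun x y => by
    simp [fst_dualKBold, mul_comm]

theorem dz_ofPoly {n : ℕ} {U : TopologicalSpace.Opens (Param n)}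
    (p : MvPolynomial (Symb U) (KHat U)) : dz U (ofPoly U p) = (dualPoly U p).snd := by
  change (dualKBold U (algebraMap (SymRing U) (KBold U) (SymRing.mk U p))).snd = _
  rw [dualKBold_algebraMap, SymRing.lift_mk]

/-- `∂_z` extends the derivative of formal Laurent series. -/
theorem dz_ofKHat {n : ℕ} {U : TopologicalSpace.Opens (Param n)} (f : KHat U) :
    dz U (ofKHat U f) = ofKHat U (LaurentSeries.derivative (Mer U) f) := by
  rw [← snd_dualPoly_C, ← dz_ofPoly]
  rfl

/-- `∂_z log = z⁻¹`. -/
theorem dz_zlog {n : ℕ} {U : TopologicalSpace.Opens (Param n)} :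
    dz U (zlog U) = ofKHat U (HahnSeries.single (-1) 1) := by
  rw [zlog, dz_ofPoly, snd_dualPoly_X, symbDeriv]

/-- `∂_z z^a = (a/z) z^a`. -/
theorem dz_zpow {n : ℕ} {U : TopologicalSpace.Opens (Param n)} (a : Mer U) :
    dz U (zpow a) = ofKHat U (HahnSeries.single (-1) a) * zpow a := by
  rw [zpow, dz_ofPoly, snd_dualPoly_X, symbDeriv, zpow]

/-- `∂_z e(q) = ∂_z(q) e(q)`. -/
theorem dz_zexp {n : ℕ} {U : TopologicalSpace.Opens (Param n)} (q : ExpPart U) :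
    dz U (zexp q) = expDeriv q * zexp q := by
  rw [zexp, dz_ofPoly, snd_dualPoly_X, symbDeriv, zexp]

/-! ### Ramified Laurent series and the matrices `z^L`, `e(Q)` -/

instance {n : ℕ} (U : TopologicalSpace.Opens (Param n)) : Algebra (KHat U) (KBold U) :=
  (ofKHat U).toAlgebra

/-- The subring `K̂_U[z^(1/ν)]` of `𝐊̂_U`. -/
abbrev Ramified {n : ℕ} (U : TopologicalSpace.Opens (Param n)) (ν : ℕ) :
    Subalgebra (KHat U) (KBold U) :=
  Algebra.adjoin (KHat U) {zrat U (1 / ν)}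

/-- Writing `x = ∑_{j < ν} h_j z^(j/ν)` with `h_j ∈ K̂_U`, the `z`-coefficients of `x` (that is, the
coefficients of all the `h_j`) are analytic on `V ⊆ U`. -/
def HasAnalyticCoeffs {n : ℕ} {U V : TopologicalSpace.Opens (Param n)} (hVU : V ≤ U) (ν : ℕ)
    (x : KBold U) : Prop :=
  ∃ h : Fin ν → KHat U, x = ∑ j, ofKHat U (h j) * zrat U ((j : ℕ) / ν) ∧
    ∀ j i, Mer.IsAnalyticOn ((h j).coeff i) hVU

/-- `Z = z^L`: if `L = P (D + N) P⁻¹` is a Jordan decomposition over `𝓜_U`, with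
`D = Diag(d_i)`, `N` nilpotent and `D N = N D`, then
`z^L = P Diag(z^(d_i)) e^(N log) P⁻¹`; this does not depend on the decomposition. -/
def IsMatrixZPow {n m : ℕ} {U : TopologicalSpace.Opens (Param n)}
    (L : Matrix (Fin m) (Fin m) (Mer U)) (Z : Matrix (Fin m) (Fin m) (KBold U)) : Prop :=
  ∃ (P : GL (Fin m) (Mer U)) (d : Fin m → Mer U) (N : Matrix (Fin m) (Fin m) (Mer U)),
    N ^ m = 0 ∧ Matrix.diagonal d * N = N * Matrix.diagonal d ∧
    L = P.1 * (Matrix.diagonal d + N) * P⁻¹.1 ∧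
    Z = P.1.map (ofMer U) * Matrix.diagonal (fun i => zpow (d i)) *
      (∑ k ∈ Finset.range m,
        (ofMer U (Mer.const U ((k.factorial : ℂ)⁻¹)) * zlog U ^ k) • (N ^ k).map (ofMer U)) *
      P⁻¹.1.map (ofMer U)

/-- `e(Q) = Diag(e(q_i))` for `Q = Diag(q_i)`. -/
def expDiag {n m : ℕ} {U : TopologicalSpace.Opens (Param n)} (q : Fin m → ExpPart U) :
    Matrix (Fin m) (Fin m) (KBold U) :=
  Matrix.diagonal fun i => zexp (q i)

end ParamHT

end

/-!
The system `∂_z Y = A Y` is first solved formally over the algebraic closure `K` of the field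
`𝓜_U`, and the finitely many algebraic functions that occur are then specialized to meromorphic
functions on a smaller polydisc. The specialization maps only a finitely generated extension of
`𝓜_U` to meromorphic functions, and analyticity of infinitely many coefficients on one polydisc has
to be kept, so the formal solution is carried out in a subfield of `K((w))`: a Laurent series is
*tame* (`Tame`) if, apart from the coefficients of `A`, its coefficients involve only finitely many
elements `s` of `K` and the inverses `(s + n)⁻¹`, `n ∈ ℤ`. The inverses with integer shifts are
those that the recursions at a regular singularity require; their number is infinite, but
all the functions `s + n`, `n ∈ ℤ`, become zero-free or identically zero on a common polydisc,
since the integers are closed and discrete in `ℂ` (`exists_polydisc_shift`).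

With `θ = w ∂_w`, the formal part shows that every connection `θ + M` over the tame series becomes,
after a ramification `w ↦ w ^ μ`, equivalent to `θ + Diag(d) + N` with `d i ∈ K[w⁻¹]` and a
constant strictly upper triangular `N` commuting with `Diag(d)` (`exists_normal_form`). This follows
by induction from the existence of a subconnection of rank one (`rankOne`). For the latter one
passes to a cyclic subconnection, twisted such that its companion matrix has trace zero
(`exists_hasSub_companion`). If its coefficients have no poles, then the singularity is
regular, and the recursion for the coefficients of a solution can be solved starting from a minimal
eigenvalue (`exists_regular_solution`). Otherwise, a ramification and the shearing transformation
given by the steepest slope of the Newton polygon produce a leading matrix that is a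
traceless companion matrix different from the nilpotent one; such a matrix has two different
eigenvalues, and the splitting lemma gives a proper subconnection (`exists_hasSub_of_pole`,
`exists_hasSub_of_split`). The series solutions in these steps are fixed points of contractive
maps that preserve the series over a suitable ring of coefficients, which makes them tame
(`exists_fixed_point`).

On the analytic side, the identity theorem makes `𝓜_U` a field (`Mer.isField`), and by the theorem
of the primitive element and the implicit function theorem a finite extension of `𝓜_U` maps to
`𝓜_V` for some smaller polydisc `V` (`exists_algebraic_specialization`). The specialized normal form
is integrated in `𝐊̂_V`: a series in `w` becomes an element of `K̂_V[z^(1/ν)]` under `w = z^(1/ν)`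
(`toRamified`), the polar terms of `d i` integrate to `e(q_i)`, and the constant terms together with
`N` to `z^L` (`exists_solution_normal_form`).
-/

open scoped Topology

noncomputable section

namespace ParamHT

/-! ### Laurent series: change of coefficients, Euler derivation, ramification -/

/-- Derivations of a commutative ring, as additive maps satisfying the product rule. -/
structure AddDer (F : Type*) [CommRing F] extends F →+ F where
  /-- The product rule. -/
  leibniz' : ∀ x y, toFun (x * y) = x * toFun y + y * toFun x

instance (F : Type*) [CommRing F] : FunLike (AddDer F) F F where
  coe θ := θ.toFun
  coe_injective := by
    rintro ⟨f, hf⟩ ⟨g, hg⟩ h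
    congr
    exact DFunLike.coe_injective h

instance (F : Type*) [CommRing F] : AddMonoidHomClass (AddDer F) F F where
  map_add θ := θ.map_add'
  map_zero θ := θ.map_zero'

section Laurent

variable {R S : Type*} [CommRing R] [CommRing S]

/-- Coefficientwise application of a ring homomorphism to Laurent series. -/
def mapLaurent (f : R →+* S) : LaurentSeries R →+* LaurentSeries S where
  toFun x := HahnSeries.map x f
  map_one' := by
    ext i
    by_cases h : i = 0 <;> simp [HahnSeries.coeff_one, h]
  map_mul' x y := HahnSeries.map_mul (f : R →ₙ+* S)
  map_zero' := by ext; simp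
  map_add' x y := by ext; simp

@[simp]
theorem coeff_mapLaurent (f : R →+* S) (x : LaurentSeries R) (i : ℤ) :
    (mapLaurent f x).coeff i = f (x.coeff i) := rfl

theorem mapLaurent_single (f : R →+* S) (i : ℤ) (a : R) :
    mapLaurent f (HahnSeries.single i a) = HahnSeries.single i (f a) := by
  ext j
  by_cases h : j = i <;> simp [h]

theorem coeff_euler (f : LaurentSeries R) (i : ℤ) : (euler f).coeff i = (i : R) * f.coeff i := rfl

theorem euler_add (f g : LaurentSeries R) : euler (f + g) = euler f + euler g := by
  ext i
  simp [coeff_euler, mul_add]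

theorem euler_single (i : ℤ) (a : R) :
    euler (HahnSeries.single i a) = HahnSeries.single i ((i : R) * a) := by
  ext j
  rw [coeff_euler]
  by_cases h : j = i
  · subst h; simp
  · simp [HahnSeries.coeff_single_of_ne h]

theorem mapLaurent_euler (f : R →+* S) (x : LaurentSeries R) :
    mapLaurent f (euler x) = euler (mapLaurent f x) := by
  ext i
  simp [coeff_euler]

/-- The substitution `w ↦ w ^ μ`. -/
def ramify (R : Type*) [CommRing R] (μ : ℕ+) : LaurentSeries R →+* LaurentSeries R :=
  HahnSeries.embDomainRingHom (AddMonoidHom.mulLeft ((μ : ℕ) : ℤ))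
    (fun a b h => by simpa using h) fun a b => by simp

theorem ramify_coeff_mul (μ : ℕ+) (f : LaurentSeries R) (i : ℤ) :
    (ramify R μ f).coeff ((μ : ℕ) * i) = f.coeff i :=
  HahnSeries.embDomain_coeff

theorem ramify_coeff_of_not_dvd (μ : ℕ+) (f : LaurentSeries R) {i : ℤ}
    (h : ¬ (((μ : ℕ) : ℤ) ∣ i)) : (ramify R μ f).coeff i = 0 :=
  HahnSeries.embDomain_of_notMem_range fun ⟨j, hj⟩ => h ⟨j, hj.symm⟩

theorem ramify_single (μ : ℕ+) (i : ℤ) (a : R) :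
    ramify R μ (HahnSeries.single i a) = HahnSeries.single ((μ : ℕ) * i) a :=
  HahnSeries.embDomain_single

theorem ramify_ext {f g : LaurentSeries R} (μ : ℕ+)
    (h : ∀ i : ℤ, f.coeff ((μ : ℕ) * i) = g.coeff ((μ : ℕ) * i))
    (h' : ∀ i : ℤ, ¬ (((μ : ℕ) : ℤ) ∣ i) → f.coeff i = g.coeff i) : f = g := by
  ext i
  by_cases hi : ((μ : ℕ) : ℤ) ∣ i
  · obtain ⟨j, rfl⟩ := hi
    exact h j
  · exact h' i hi

theorem ramify_ramify (μ μ' : ℕ+) (f : LaurentSeries R) :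
    ramify R μ' (ramify R μ f) = ramify R (μ' * μ) f := by
  ext i
  by_cases hi : ((μ' : ℕ) : ℤ) ∣ i
  · obtain ⟨j, rfl⟩ := hi
    rw [ramify_coeff_mul]
    by_cases hj : ((μ : ℕ) : ℤ) ∣ j
    · obtain ⟨k, rfl⟩ := hj
      rw [ramify_coeff_mul]
      have := ramify_coeff_mul (μ' * μ) f k
      rw [← this]
      push_cast
      rw [mul_assoc]
    · rw [ramify_coeff_of_not_dvd _ _ hj, ramify_coeff_of_not_dvd]
      rintro ⟨k, hk⟩
      apply hj
      refine ⟨k, ?_⟩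
      have h0 : ((μ' : ℕ) : ℤ) ≠ 0 := by exact_mod_cast μ'.ne_zero
      apply mul_left_cancel₀ h0
      rw [hk]; push_cast; ring
  · rw [ramify_coeff_of_not_dvd _ _ hi, ramify_coeff_of_not_dvd]
    rintro ⟨k, hk⟩
    exact hi ⟨(μ : ℕ) * k, by rw [hk]; push_cast; ring⟩

theorem euler_ramify (μ : ℕ+) (f : LaurentSeries R) :
    euler (ramify R μ f) = ((μ : ℕ) : LaurentSeries R) * ramify R μ (euler f) := by
  have key (x : LaurentSeries R) (i : ℤ) :
      (((μ : ℕ) : LaurentSeries R) * x).coeff i = ((μ : ℕ) : R) * x.coeff i := by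
    rw [← nsmul_eq_mul, HahnSeries.coeff_smul, nsmul_eq_mul]
  refine ramify_ext μ (fun i => ?_) fun i hi => ?_
  · rw [coeff_euler, key, ramify_coeff_mul, ramify_coeff_mul, coeff_euler]
    push_cast
    ring
  · rw [coeff_euler, key, ramify_coeff_of_not_dvd _ _ hi, ramify_coeff_of_not_dvd _ _ hi]
    simp

theorem mapLaurent_ramify (f : R →+* S) (μ : ℕ+) (x : LaurentSeries R) :
    mapLaurent f (ramify R μ x) = ramify S μ (mapLaurent f x) := by
  refine ramify_ext μ (fun i => ?_) fun i hi => ?_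
  · simp [ramify_coeff_mul]
  · simp [ramify_coeff_of_not_dvd _ _ hi]

end Laurent

/-! ### Tame Laurent series -/

section Tame

variable {K : Type*} [Field K]

/-- The subring `R` contains every `s ∈ S` and every inverse `(s + n)⁻¹`, `n ∈ ℤ`
(the inverse of zero being zero). -/
def ShiftClosed (S : Set K) (R : Subring K) : Prop :=
  ∀ s ∈ S, s ∈ R ∧ ∀ n : ℤ, (s + n)⁻¹ ∈ R

theorem ShiftClosed.mono {S S' : Set K} {R : Subring K} (h : ShiftClosed S R) (hS : S' ⊆ S) :
    ShiftClosed S' R := fun s hs => h s (hS hs)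

/-- All coefficients of `f` lie in the subring `R`. -/
def CoeffsIn (R : Subring K) (f : LaurentSeries K) : Prop := ∀ i, f.coeff i ∈ R

theorem coeffsIn_iff {R : Subring K} {f : LaurentSeries K} :
    CoeffsIn R f ↔ ∃ g : LaurentSeries R, mapLaurent R.subtype g = f := by
  constructor
  · intro h
    refine ⟨⟨fun i => ⟨f.coeff i, h i⟩, f.isPWO_support.mono fun i hi => ?_⟩, ?_⟩
    · intro h0
      apply hi
      exact Subtype.ext h0
    · ext i
      rfl
  · rintro ⟨g, rfl⟩ i
    exact (g.coeff i).2

/-- The inversion of a Laurent series only requires the inversion of its leading coefficient. -/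
theorem CoeffsIn.inv {R : Subring K} {f : LaurentSeries K} (hf : CoeffsIn R f)
    (h : f.leadingCoeff⁻¹ ∈ R) : CoeffsIn R f⁻¹ := by
  by_cases hf0 : f = 0
  · intro i
    simp [hf0, R.zero_mem]
  obtain ⟨g, rfl⟩ := coeffsIn_iff.1 hf
  have hg0 : g ≠ 0 := by rintro rfl; simp at hf0
  have hord : (mapLaurent R.subtype g).order = g.order := by
    have hne : (mapLaurent R.subtype g).coeff g.order ≠ 0 := by
      simpa using (mt HahnSeries.coeff_order_eq_zero.1 hg0)
    refine le_antisymm (HahnSeries.order_le_of_coeff_ne_zero hne) ?_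
    refine HahnSeries.order_le_of_coeff_ne_zero fun h0 =>
      (mt HahnSeries.coeff_order_eq_zero.1 hf0) ?_
    rw [coeff_mapLaurent, h0, map_zero]
  have hu : IsUnit g := by
    rw [HahnSeries.isUnit_iff]
    rw [HahnSeries.leadingCoeff_eq, hord, coeff_mapLaurent] at h
    refine IsUnit.of_mul_eq_one ⟨_, h⟩ (Subtype.ext ?_)
    rw [HahnSeries.leadingCoeff_eq]
    refine mul_inv_cancel₀ fun h0 => (mt HahnSeries.coeff_order_eq_zero.1 hg0) ?_
    exact Subtype.ext h0
  obtain ⟨g', hg'⟩ := hu.exists_right_inv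
  refine coeffsIn_iff.2 ⟨g', ?_⟩
  rw [eq_comm, inv_eq_iff_eq_inv, eq_comm]
  refine inv_eq_of_mul_eq_one_left ?_
  rw [← map_mul, hg', map_one]

/-- The filter of sets of subrings of `K` that contain, for some finite set `S`, all the subrings
containing `R₀`, every `s ∈ S` and every `(s + n)⁻¹` with `s ∈ S`, `n ∈ ℤ`. -/
def tameFilter (R₀ : Set K) : Filter (Subring K) where
  sets := {T | ∃ S : Set K, S.Finite ∧ ∀ R : Subring K, R₀ ⊆ R → ShiftClosed S R → R ∈ T}
  univ_sets := ⟨∅, Set.finite_empty, fun _ _ _ => Set.mem_univ _⟩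
  sets_of_superset := by
    rintro T T' ⟨S, hS, h⟩ hT
    exact ⟨S, hS, fun R h₀ hR => hT (h R h₀ hR)⟩
  inter_sets := by
    rintro T T' ⟨S, hS, h⟩ ⟨S', hS', h'⟩
    exact ⟨S ∪ S', hS.union hS', fun R h₀ hR => ⟨h R h₀ (hR.mono Set.subset_union_left),
      h' R h₀ (hR.mono Set.subset_union_right)⟩⟩

theorem eventually_tameFilter {R₀ : Set K} {p : Subring K → Prop} :
    (∀ᶠ R in tameFilter R₀, p R) ↔
      ∃ S : Set K, S.Finite ∧ ∀ R : Subring K, R₀ ⊆ R → ShiftClosed S R → p R := Iff.rfl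

theorem eventually_shift_mem (R₀ : Set K) (s : K) :
    ∀ᶠ R in tameFilter R₀, s ∈ R ∧ ∀ n : ℤ, (s + n)⁻¹ ∈ R :=
  ⟨{s}, Set.finite_singleton s, fun _ _ hR => hR s rfl⟩

theorem eventually_mem (R₀ : Set K) (s : K) : ∀ᶠ R in tameFilter R₀, s ∈ R :=
  (eventually_shift_mem R₀ s).mono fun _ h => h.1

theorem eventually_inv_mem (R₀ : Set K) (s : K) : ∀ᶠ R in tameFilter R₀, s⁻¹ ∈ R :=
  (eventually_shift_mem R₀ s).mono fun _ h => by simpa using h.2 0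

/-- The field of tame Laurent series over a set `R₀` of scalars: those whose coefficients are
obtained from `R₀` by the ring operations together with the elements `s` and `(s + n)⁻¹` for
finitely many `s` and all integers `n`. The inverse of a tame series is tame since only its leading
coefficient has to be inverted. -/
def Tame (R₀ : Set K) : Subfield (LaurentSeries K) where
  carrier := {f | ∀ᶠ R in tameFilter R₀, CoeffsIn R f}
  mul_mem' := by
    intro f g hf hg
    rw [Set.mem_ofPred_eq] at *
    filter_upwards [hf, hg] with R hf hg
    obtain ⟨f', rfl⟩ := coeffsIn_iff.1 hf
    obtain ⟨g', rfl⟩ := coeffsIn_iff.1 hg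
    exact coeffsIn_iff.2 ⟨f' * g', map_mul _ _ _⟩
  one_mem' := by
    rw [Set.mem_ofPred_eq]
    exact Filter.Eventually.of_forall fun R => coeffsIn_iff.2 ⟨1, map_one _⟩
  add_mem' := by
    intro f g hf hg
    rw [Set.mem_ofPred_eq] at *
    filter_upwards [hf, hg] with R hf hg i
    exact R.add_mem (hf i) (hg i)
  zero_mem' := by
    rw [Set.mem_ofPred_eq]
    exact Filter.Eventually.of_forall fun R => coeffsIn_iff.2 ⟨0, map_zero _⟩
  neg_mem' := by
    intro f hf
    rw [Set.mem_ofPred_eq] at *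
    filter_upwards [hf] with R hf i
    exact R.neg_mem (hf i)
  inv_mem' := by
    intro f hf
    rw [Set.mem_ofPred_eq] at *
    filter_upwards [hf, eventually_inv_mem R₀ f.leadingCoeff] with R hf h
    exact hf.inv h

variable {R₀ : Set K}

theorem mem_tame {f : LaurentSeries K} :
    f ∈ Tame R₀ ↔ ∀ᶠ R in tameFilter R₀, CoeffsIn R f := Iff.rfl

theorem single_mem_tame (i : ℤ) (a : K) : HahnSeries.single i a ∈ Tame R₀ := by
  rw [mem_tame]
  filter_upwards [eventually_mem R₀ a] with R ha j
  by_cases h : j = i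
  · subst h
    simpa using ha
  · simp [HahnSeries.coeff_single_of_ne h, R.zero_mem]

theorem mem_tame_of_coeff_mem {f : LaurentSeries K} (h : ∀ i, f.coeff i ∈ R₀) : f ∈ Tame R₀ :=
  ⟨∅, Set.finite_empty, fun _ h₀ _ i => h₀ (h i)⟩

theorem euler_mem_tame {f : LaurentSeries K} (hf : f ∈ Tame R₀) : euler f ∈ Tame R₀ := by
  rw [mem_tame] at *
  filter_upwards [hf] with R h i
  exact R.mul_mem (intCast_mem R i) (h i)

theorem ramify_mem_tame (μ : ℕ+) {f : LaurentSeries K} (hf : f ∈ Tame R₀) :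
    ramify K μ f ∈ Tame R₀ := by
  rw [mem_tame] at *
  filter_upwards [hf] with R h i
  by_cases hi : ((μ : ℕ) : ℤ) ∣ i
  · obtain ⟨j, rfl⟩ := hi
    rw [ramify_coeff_mul]
    exact h j
  · rw [ramify_coeff_of_not_dvd _ _ hi]
    exact R.zero_mem

/-- The Euler derivation of the field of tame series. -/
def tameEuler (R₀ : Set K) : AddDer (Tame R₀) where
  toFun f := ⟨euler f.1, euler_mem_tame f.2⟩
  map_zero' := Subtype.ext (by ext i; simp [coeff_euler])
  map_add' x y := Subtype.ext (euler_add x.1 y.1)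
  leibniz' x y := Subtype.ext (euler_mul x.1 y.1)

@[simp]
theorem coe_tameEuler (f : Tame R₀) : (tameEuler R₀ f : LaurentSeries K) = euler f.1 := rfl

/-- Ramification on the field of tame series. -/
def tameRamify (R₀ : Set K) (μ : ℕ+) : Tame R₀ →+* Tame R₀ :=
  (ramify K μ).restrict (Tame R₀) (Tame R₀) fun _ h => ramify_mem_tame μ h

@[simp]
theorem coe_tameRamify (μ : ℕ+) (f : Tame R₀) :
    (tameRamify R₀ μ f : LaurentSeries K) = ramify K μ f.1 := rfl

/-- The monomial `a wⁱ` as a tame series. -/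
def tameSingle (R₀ : Set K) (i : ℤ) (a : K) : Tame R₀ := ⟨HahnSeries.single i a, single_mem_tame i a⟩

@[simp]
theorem coe_tameSingle (i : ℤ) (a : K) :
    (tameSingle R₀ i a : LaurentSeries K) = HahnSeries.single i a := rfl

/-- The constants as tame series. -/
def tameC (R₀ : Set K) : K →+* Tame R₀ where
  toFun := tameSingle R₀ 0
  map_one' := rfl
  map_mul' a b := Subtype.ext (HahnSeries.C.map_mul a b)
  map_zero' := Subtype.ext HahnSeries.C.map_zero
  map_add' a b := Subtype.ext (HahnSeries.C.map_add a b)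

@[simp]
theorem coe_tameC (a : K) : (tameC R₀ a : LaurentSeries K) = HahnSeries.C a := rfl

theorem tameSingle_zero_exp (a : K) : tameSingle R₀ 0 a = tameC R₀ a := rfl

theorem tameSingle_mul (i j : ℤ) (a b : K) :
    tameSingle R₀ i a * tameSingle R₀ j b = tameSingle R₀ (i + j) (a * b) :=
  Subtype.ext HahnSeries.single_mul_single

theorem tameEuler_single (i : ℤ) (a : K) :
    tameEuler R₀ (tameSingle R₀ i a) = tameSingle R₀ i ((i : K) * a) :=
  Subtype.ext (euler_single i a)

theorem tameRamify_tameRamify (μ μ' : ℕ+) (f : Tame R₀) :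
    tameRamify R₀ μ' (tameRamify R₀ μ f) = tameRamify R₀ (μ' * μ) f :=
  Subtype.ext (ramify_ramify μ μ' f.1)

theorem tameEuler_ramify (μ : ℕ+) (f : Tame R₀) :
    tameEuler R₀ (tameRamify R₀ μ f) = ((μ : ℕ) : Tame R₀) * tameRamify R₀ μ (tameEuler R₀ f) :=
  Subtype.ext (by simpa using euler_ramify μ f.1)

end Tame

/-! ### Connections and gauge transformations -/

section Gauge

variable {F : Type*} [CommRing F]

theorem AddDer.leibniz (θ : AddDer F) (x y : F) : θ (x * y) = x * θ y + y * θ x := θ.leibniz' x y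

theorem AddDer.map_one (θ : AddDer F) : θ 1 = 0 := by
  have h := θ.leibniz 1 1
  simp only [mul_one, one_mul] at h
  simpa using h

theorem AddDer.map_matrix_mul (θ : AddDer F) {ι κ l : Type*} [Fintype κ] (A : Matrix ι κ F)
    (B : Matrix κ l F) : (A * B).map θ = A.map θ * B + A * B.map θ := by
  ext i j
  simp only [Matrix.map_apply, Matrix.mul_apply, Matrix.add_apply, map_sum, θ.leibniz,
    ← Finset.sum_add_distrib]
  exact Finset.sum_congr rfl fun k _ => by ring

theorem AddDer.map_matrix_one (θ : AddDer F) {ι : Type*} [DecidableEq ι] :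
    (1 : Matrix ι ι F).map θ = 0 := by
  ext i j
  by_cases h : i = j <;> simp [h, θ.map_one]

/-- `G` intertwines the connections `θ + M` and `θ + M'`: `(θ + M) (G v) = G ((θ + M') v)`. -/
def IsGauge (θ : AddDer F) {ι κ : Type*} [Fintype ι] [Fintype κ] (M : Matrix ι ι F)
    (G : Matrix ι κ F) (M' : Matrix κ κ F) : Prop :=
  G.map θ + M * G = G * M'

variable {θ : AddDer F} {ι κ l : Type*} [Fintype ι] [Fintype κ] [Fintype l]
  [DecidableEq ι] [DecidableEq κ] [DecidableEq l]

omit [DecidableEq ι] [DecidableEq κ] [DecidableEq l] in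
theorem IsGauge.mul {M : Matrix ι ι F} {G : Matrix ι κ F} {M' : Matrix κ κ F} {G' : Matrix κ l F}
    {M'' : Matrix l l F} (h : IsGauge θ M G M') (h' : IsGauge θ M' G' M'') :
    IsGauge θ M (G * G') M'' := by
  unfold IsGauge at *
  rw [θ.map_matrix_mul, ← Matrix.mul_assoc, add_right_comm, ← Matrix.add_mul, h, Matrix.mul_assoc,
    Matrix.mul_assoc, ← h', Matrix.mul_add, add_comm]

theorem IsGauge.twist {M : Matrix ι ι F} {G : Matrix ι κ F} {M' : Matrix κ κ F}
    (h : IsGauge θ M G M') (a : F) : IsGauge θ (M + a • 1) G (M' + a • 1) := by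
  unfold IsGauge at *
  rw [Matrix.add_mul, Matrix.mul_add, ← h, add_assoc]
  simp

/-- The connection `θ + M` has a subconnection isomorphic to `θ + M'`. -/
def HasSub (θ : AddDer F) (M : Matrix ι ι F) (M' : Matrix κ κ F) : Prop :=
  ∃ (G : Matrix ι κ F) (G' : Matrix κ ι F), G' * G = 1 ∧ IsGauge θ M G M'

omit [DecidableEq ι] in
theorem HasSub.trans {M : Matrix ι ι F} {M' : Matrix κ κ F} {M'' : Matrix l l F}
    (h : HasSub θ M M') (h' : HasSub θ M' M'') : HasSub θ M M'' := by
  obtain ⟨G, G', e, hG⟩ := h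
  obtain ⟨H, H', e', hH⟩ := h'
  refine ⟨G * H, H' * G', ?_, hG.mul hH⟩
  rw [Matrix.mul_assoc, ← Matrix.mul_assoc G', e, Matrix.one_mul, e']

theorem HasSub.twist {M : Matrix ι ι F} {M' : Matrix κ κ F} (h : HasSub θ M M') (a : F) :
    HasSub θ (M + a • 1) (M' + a • 1) := by
  obtain ⟨G, G', e, hG⟩ := h
  exact ⟨G, G', e, hG.twist a⟩

/-- The companion matrix with last column `c`. -/
def companion {t : ℕ} (c : Fin (t + 1) → F) : Matrix (Fin (t + 1)) (Fin (t + 1)) F :=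
  Matrix.of fun i j => if j = Fin.last t then c i else if (i : ℕ) = j + 1 then 1 else 0

end Gauge

/-! ### Cyclic vectors with vanishing trace -/

section Cyclic

variable {F V : Type*} [Field F] [AddCommGroup V] [Module F V]

theorem range_fin_eq_image_Iio {α : Type*} (e : ℕ → α) (j : ℕ) :
    Set.range (fun i : Fin j => e i) = e '' Set.Iio j := by
  ext x
  constructor
  · rintro ⟨i, rfl⟩
    exact ⟨i, i.2, rfl⟩
  · rintro ⟨i, hi, rfl⟩
    exact ⟨⟨i, hi⟩, rfl⟩

theorem span_image_Iio_succ (e : ℕ → V) (j : ℕ) :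
    Submodule.span F (e '' Set.Iio (j + 1)) =
      Submodule.span F {e j} ⊔ Submodule.span F (e '' Set.Iio j) := by
  rw [← Submodule.span_insert, ← Set.image_insert_eq]
  congr 2
  ext i
  simp only [Set.mem_Iio, Set.mem_insert_iff]
  omega

theorem linearIndependent_fin_of_notMem_span (e : ℕ → V) (j : ℕ)
    (h : ∀ i < j, e i ∉ Submodule.span F (e '' Set.Iio i)) :
    LinearIndependent F (fun i : Fin j => e i) := by
  induction j with
  | zero => exact linearIndependent_empty_type
  | succ j ih =>
    rw [linearIndependent_finSucc']
    refine ⟨ih fun i hi => h i (hi.trans (Nat.lt_succ_self j)), ?_⟩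
    have : Set.range (Fin.init fun i : Fin (j + 1) => e i) = e '' Set.Iio j :=
      range_fin_eq_image_Iio e j
    rw [this]
    exact h j (Nat.lt_succ_self j)

/-- Every connection on a nonzero finite-dimensional space has a subconnection that, after a twist,
is cyclic, the relation of the cyclic vector having no term of the second highest order. -/
theorem exists_cyclic_traceless [CharZero F] [FiniteDimensional F V] [Nontrivial V] (θ : AddDer F)
    (D : V →+ V) (hD : ∀ (a : F) (v : V), D (a • v) = θ a • v + a • D v) :
    ∃ (t : ℕ) (a : F) (f : ℕ → V) (c : Fin (t + 1) → F),
      LinearIndependent F (fun i : Fin (t + 1) => f i) ∧ (∀ j, D (f j) = f (j + 1) + a • f j) ∧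
      f (t + 1) = ∑ i : Fin (t + 1), c i • f i ∧ c (Fin.last t) = 0 := by
  obtain ⟨v, hv⟩ := exists_ne (0 : V)
  set e : ℕ → V := fun j => D^[j] v with he
  have he1 : ∀ j, D (e j) = e (j + 1) := fun j => (Function.iterate_succ_apply' D j v).symm
  set W : ℕ → Submodule F V := fun j => Submodule.span F (e '' Set.Iio j) with hW
  have hWmono : Monotone W := fun i j hij =>
    Submodule.span_mono (Set.image_mono (Set.Iio_subset_Iio hij))
  have heW : ∀ {i j}, i < j → e i ∈ W j := fun h => Submodule.subset_span ⟨_, h, rfl⟩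
  have hDW : ∀ {j w}, w ∈ W j → D w ∈ W (j + 1) := by
    intro j w hw
    induction hw using Submodule.span_induction with
    | mem x hx =>
      obtain ⟨i, hi, rfl⟩ := hx
      rw [he1]
      exact heW (Nat.succ_lt_succ hi)
    | zero => rw [map_zero]; exact zero_mem _
    | add x y _ _ hx hy => rw [map_add]; exact add_mem hx hy
    | smul a x hx' hx =>
      rw [hD]
      exact add_mem (Submodule.smul_mem _ _ (hWmono (Nat.le_succ j) hx')) (Submodule.smul_mem _ _ hx)
  -- the first linear relation between the iterates
  have hex : ∃ j, e j ∈ W j := by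
    by_contra! h
    have hli := linearIndependent_fin_of_notMem_span e (Module.finrank F V + 1) fun i _ => h i
    have := hli.fintype_card_le_finrank
    simp at this
  classical
  obtain ⟨t, ht⟩ : ∃ t, Nat.find hex = t + 1 := by
    refine Nat.exists_eq_succ_of_ne_zero fun h0 => ?_
    have := Nat.find_spec hex
    rw [h0] at this
    apply hv
    simpa [hW, he] using this
  have hspec : e (t + 1) ∈ W (t + 1) := ht ▸ Nat.find_spec hex
  have hli := linearIndependent_fin_of_notMem_span e (t + 1) fun i hi =>
    Nat.find_min hex (ht ▸ hi)
  -- the twist removing the term of second highest order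
  obtain ⟨α, w₀, hw₀, hα⟩ : ∃ (α : F), ∃ w ∈ W t, e (t + 1) = α • e t + w := by
    rw [hW] at hspec
    simp only [span_image_Iio_succ, Submodule.mem_sup, Submodule.mem_span_singleton] at hspec
    obtain ⟨_, ⟨α, rfl⟩, w, hw, h⟩ := hspec
    exact ⟨α, w, hw, h.symm⟩
  set a : F := α / (t + 1) with ha
  have hα' : α = (t + 1) * a := by
    have : (t + 1 : F) ≠ 0 := by exact_mod_cast Nat.succ_ne_zero t
    rw [ha]; field_simp
  let D' : V → V := fun x => D x - a • x
  set f : ℕ → V := fun j => D'^[j] v with hf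
  have hf1 : ∀ j, f (j + 1) = D (f j) - a • f j := fun j => Function.iterate_succ_apply' D' j v
  have hfe : ∀ j, ∃ w ∈ W j, f (j + 1) = e (j + 1) - ((j + 1 : F) * a) • e j + w := by
    intro j
    induction j with
    | zero =>
      refine ⟨0, zero_mem _, ?_⟩
      rw [hf1, show f 0 = e 0 from rfl, he1]
      simp
    | succ j ih =>
      obtain ⟨w, hw, h⟩ := ih
      refine ⟨D w - θ ((j + 1 : F) * a) • e j - a • w + (((j + 1 : F) * a) * a) • e j, ?_, ?_⟩
      · refine add_mem (sub_mem (sub_mem (hDW hw) ?_) ?_) ?_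
        · exact Submodule.smul_mem _ _ (heW (Nat.lt_succ_self j))
        · exact Submodule.smul_mem _ _ (hWmono (Nat.le_succ j) hw)
        · exact Submodule.smul_mem _ _ (heW (Nat.lt_succ_self j))
      · rw [hf1, h, map_add, map_sub, hD, he1, he1]
        push_cast
        module
  have hfW : ∀ j, ∃ w ∈ W j, f j = e j + w := by
    intro j
    cases j with
    | zero => exact ⟨0, zero_mem _, by simp [hf, he]⟩
    | succ j =>
      obtain ⟨w, hw, h⟩ := hfe j
      refine ⟨- ((j + 1 : F) * a) • e j + w, add_mem ?_ (hWmono (Nat.le_succ j) hw), ?_⟩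
      · exact Submodule.smul_mem _ _ (heW (Nat.lt_succ_self j))
      · rw [h]; module
  have hspan : ∀ j, Submodule.span F (f '' Set.Iio j) = W j := by
    intro j
    induction j with
    | zero => simp [hW]
    | succ j ih =>
      obtain ⟨w, hw, h⟩ := hfW j
      rw [hW]
      simp only [span_image_Iio_succ]
      rw [ih]
      refine le_antisymm (sup_le ?_ le_sup_right) (sup_le ?_ le_sup_right)
      · rw [Submodule.span_singleton_le_iff_mem, h]
        exact add_mem (Submodule.mem_sup_left (Submodule.mem_span_singleton_self _))
          (Submodule.mem_sup_right hw)
      · rw [Submodule.span_singleton_le_iff_mem, show e j = f j - w by rw [h]; abel]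
        exact sub_mem (Submodule.mem_sup_left (Submodule.mem_span_singleton_self _))
          (Submodule.mem_sup_right hw)
  have hfli : LinearIndependent F (fun i : Fin (t + 1) => f i) := by
    rw [linearIndependent_iff_card_eq_finrank_span] at hli ⊢
    rw [hli, Set.finrank, Set.finrank, range_fin_eq_image_Iio, range_fin_eq_image_Iio, hspan]
  have hmem : f (t + 1) ∈ Submodule.span F (Set.range fun i : Fin t => f i) := by
    rw [range_fin_eq_image_Iio, hspan]
    obtain ⟨w, hw, h⟩ := hfe t
    rw [h, hα, hα', show (((t : F) + 1) * a) • e t + w₀ - (((t : F) + 1) * a) • e t + w = w₀ + w by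
      abel]
    exact add_mem hw₀ hw
  obtain ⟨c, hc⟩ := (Submodule.mem_span_range_iff_exists_fun F).1 hmem
  refine ⟨t, a, f, Fin.snoc c 0, hfli, fun j => by rw [hf1]; abel, ?_, by simp⟩
  rw [Fin.sum_univ_castSucc]
  simp [hc]

/-- Matrices with linearly independent columns have a left inverse. -/
theorem exists_leftInverse_of_linearIndependent {ι κ : Type*} [Fintype ι] [Fintype κ]
    [DecidableEq ι] [DecidableEq κ] (G : Matrix ι κ F)
    (h : LinearIndependent F (fun j i => G i j)) : ∃ G' : Matrix κ ι F, G' * G = 1 := by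
  have hinj : Function.Injective G.mulVec := Matrix.mulVec_injective_iff.2 h
  obtain ⟨g, hg⟩ := LinearMap.exists_leftInverse_of_injective (Matrix.mulVecLin G)
    (LinearMap.ker_eq_bot.2 hinj)
  refine ⟨LinearMap.toMatrix' g, ?_⟩
  have : LinearMap.toMatrix' (g ∘ₗ Matrix.toLin' G) = 1 := by
    rw [show Matrix.toLin' G = G.mulVecLin from rfl, hg, LinearMap.toMatrix'_id]
  rwa [LinearMap.toMatrix'_comp, LinearMap.toMatrix'_toLin'] at this

/-- Matrix form of `exists_cyclic_traceless`. -/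
theorem exists_hasSub_companion [CharZero F] {ι : Type*} [Fintype ι] [DecidableEq ι] [Nonempty ι]
    (θ : AddDer F) (M : Matrix ι ι F) :
    ∃ (t : ℕ) (a : F) (c : Fin (t + 1) → F), c (Fin.last t) = 0 ∧
      HasSub θ M (companion c + a • 1) ∧ t + 1 ≤ Fintype.card ι := by
  let D : (ι → F) →+ (ι → F) :=
    { toFun := fun v => (fun i => θ (v i)) + M.mulVec v
      map_zero' := by ext; simp
      map_add' := fun v w => by ext i; simp [Matrix.mulVec_add]; abel }
  obtain ⟨t, a, f, c, hli, hf, hc, hc0⟩ := exists_cyclic_traceless θ D fun a v => by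
    ext i
    simp only [D, AddMonoidHom.coe_mk, ZeroHom.coe_mk, Pi.add_apply, Pi.smul_apply, smul_eq_mul,
      θ.leibniz, Matrix.mulVec_smul]
    ring
  obtain ⟨G', hG'⟩ := exists_leftInverse_of_linearIndependent
    (Matrix.of fun i (j : Fin (t + 1)) => f j i) hli
  refine ⟨t, a, c, hc0, ⟨_, G', hG', ?_⟩, by simpa using hli.fintype_card_le_finrank⟩
  ext i j
  have h1 := congrFun (hf j) i
  simp only [D, AddMonoidHom.coe_mk, ZeroHom.coe_mk, Pi.add_apply, Pi.smul_apply, smul_eq_mul] at h1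
  rw [Matrix.add_apply, Matrix.mul_add, Matrix.add_apply]
  refine h1.trans ?_
  congr 1
  · rw [Matrix.mul_apply]
    by_cases hj : j = Fin.last t
    · subst hj
      simp [companion, hc, mul_comm]
    · have hjt : (j : ℕ) + 1 < t + 1 := by
        have := Fin.val_lt_last hj
        omega
      rw [Finset.sum_eq_single (⟨j + 1, hjt⟩ : Fin (t + 1))]
      · simp [companion, hj]
      · intro b _ hb
        have : (b : ℕ) ≠ j + 1 := fun h => hb (Fin.ext h)
        simp [companion, hj, this]
      · simp
  · simp

end Cyclic

/-! ### Contractive equations for matrices of power series -/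

section PowerSeriesMatrix

open PowerSeries

variable {K : Type*} [Field K] {ι κ l : Type*}

/-- The Euler operator on power series. -/
def psEuler (f : K⟦X⟧) : K⟦X⟧ := PowerSeries.mk fun k => (k : K) * coeff k f

@[simp]
theorem coeff_psEuler (f : K⟦X⟧) (k : ℕ) : coeff k (psEuler f) = k * coeff k f := by
  simp [psEuler]

theorem euler_coe (f : K⟦X⟧) : euler (f : LaurentSeries K) = (psEuler f : K⟦X⟧) := by
  ext i
  rw [coeff_euler, PowerSeries.coeff_coe, PowerSeries.coeff_coe]
  split_ifs with h
  · simp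
  · obtain ⟨k, rfl⟩ := Int.eq_ofNat_of_zero_le (not_lt.1 h)
    simp

/-- The matrices `A` and `B` agree modulo `wⁿ`. -/
def Agree (n : ℕ) (A B : Matrix ι κ K⟦X⟧) : Prop :=
  ∀ i j, ∀ k < n, coeff k (A i j) = coeff k (B i j)

/-- All coefficients of the entries of `A` lie in `R`. -/
def MatIn (R : Subring K) (A : Matrix ι κ K⟦X⟧) : Prop := ∀ i j k, coeff k (A i j) ∈ R

theorem Agree.refl (n : ℕ) (A : Matrix ι κ K⟦X⟧) : Agree n A A := fun _ _ _ _ => rfl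

theorem Agree.add {n : ℕ} {A A' B B' : Matrix ι κ K⟦X⟧} (h : Agree n A A') (h' : Agree n B B') :
    Agree n (A + B) (A' + B') := fun i j k hk => by
  simp [h i j k hk, h' i j k hk]

theorem Agree.sub {n : ℕ} {A A' B B' : Matrix ι κ K⟦X⟧} (h : Agree n A A') (h' : Agree n B B') :
    Agree n (A - B) (A' - B') := fun i j k hk => by
  simp [h i j k hk, h' i j k hk]

theorem Agree.mul [Fintype κ] {n : ℕ} {A A' : Matrix ι κ K⟦X⟧} {B B' : Matrix κ l K⟦X⟧}
    (h : Agree n A A') (h' : Agree n B B') : Agree n (A * B) (A' * B') := fun i j k hk => by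
  simp only [Matrix.mul_apply, map_sum, coeff_mul]
  refine Finset.sum_congr rfl fun x _ => Finset.sum_congr rfl fun p hp => ?_
  have hp' := Finset.HasAntidiagonal.mem_antidiagonal.1 hp
  rw [h i x p.1 (by omega), h' x j p.2 (by omega)]

theorem Agree.sum {n : ℕ} {α : Type*} (s : Finset α) {A B : α → Matrix ι κ K⟦X⟧}
    (h : ∀ a ∈ s, Agree n (A a) (B a)) : Agree n (∑ a ∈ s, A a) (∑ a ∈ s, B a) :=
  fun i j k hk => by
  simp only [Matrix.sum_apply, map_sum]
  exact Finset.sum_congr rfl fun a ha => h a ha i j k hk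

theorem Agree.euler {n : ℕ} {A B : Matrix ι κ K⟦X⟧} (h : Agree n A B) :
    Agree n (A.map psEuler) (B.map psEuler) := fun i j k hk => by
  simp [h i j k hk]

theorem Agree.smul {n : ℕ} {A B : Matrix ι κ K⟦X⟧} (h : Agree n A B) (f : K⟦X⟧) :
    Agree n (f • A) (f • B) := fun i j k hk => by
  simp only [Matrix.smul_apply, smul_eq_mul, coeff_mul]
  refine Finset.sum_congr rfl fun p hp => ?_
  have hp' := Finset.HasAntidiagonal.mem_antidiagonal.1 hp
  rw [h i j p.2 (by omega)]

theorem Agree.X_smul {n : ℕ} {A B : Matrix ι κ K⟦X⟧} (h : Agree n A B) :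
    Agree (n + 1) ((X : K⟦X⟧) • A) ((X : K⟦X⟧) • B) := fun i j k hk => by
  simp only [Matrix.smul_apply, smul_eq_mul]
  cases k with
  | zero => simp
  | succ k => rw [coeff_succ_X_mul, coeff_succ_X_mul, h i j k (by omega)]

variable {R : Subring K}

theorem MatIn.add {A B : Matrix ι κ K⟦X⟧} (h : MatIn R A) (h' : MatIn R B) : MatIn R (A + B) :=
  fun i j k => by simpa using R.add_mem (h i j k) (h' i j k)

theorem MatIn.sub {A B : Matrix ι κ K⟦X⟧} (h : MatIn R A) (h' : MatIn R B) : MatIn R (A - B) :=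
  fun i j k => by simpa using R.sub_mem (h i j k) (h' i j k)

theorem MatIn.mul [Fintype κ] {A : Matrix ι κ K⟦X⟧} {B : Matrix κ l K⟦X⟧} (h : MatIn R A)
    (h' : MatIn R B) : MatIn R (A * B) := fun i j k => by
  simp only [Matrix.mul_apply, map_sum, coeff_mul]
  exact R.sum_mem fun x _ => R.sum_mem fun p _ => R.mul_mem (h _ _ _) (h' _ _ _)

theorem MatIn.sum {α : Type*} (s : Finset α) {A : α → Matrix ι κ K⟦X⟧}
    (h : ∀ a ∈ s, MatIn R (A a)) : MatIn R (∑ a ∈ s, A a) := fun i j k => by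
  simp only [Matrix.sum_apply, map_sum]
  exact R.sum_mem fun a ha => h a ha i j k

theorem MatIn.euler {A : Matrix ι κ K⟦X⟧} (h : MatIn R A) : MatIn R (A.map psEuler) :=
  fun i j k => by simpa using R.mul_mem (natCast_mem R k) (h i j k)

theorem MatIn.smul {A : Matrix ι κ K⟦X⟧} (h : MatIn R A) {f : K⟦X⟧} (hf : ∀ k, coeff k f ∈ R) :
    MatIn R (f • A) := fun i j k => by
  simp only [Matrix.smul_apply, smul_eq_mul, coeff_mul]
  exact R.sum_mem fun p _ => R.mul_mem (hf _) (h _ _ _)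

theorem coeff_X_pow_mem (R : Subring K) (n k : ℕ) : coeff k ((X : K⟦X⟧) ^ n) ∈ R := by
  rw [coeff_X_pow]
  split_ifs
  exacts [R.one_mem, R.zero_mem]

theorem coeff_X_mem (R : Subring K) (k : ℕ) : coeff k (X : K⟦X⟧) ∈ R := by
  simpa using coeff_X_pow_mem R 1 k

theorem MatIn.pow [Fintype ι] [DecidableEq ι] {A : Matrix ι ι K⟦X⟧} (h : MatIn R A) (n : ℕ) :
    MatIn R (A ^ n) := by
  induction n with
  | zero =>
    intro i j k
    rw [pow_zero, Matrix.one_apply]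
    split_ifs
    · rw [coeff_one]
      split_ifs
      exacts [R.one_mem, R.zero_mem]
    · simp
  | succ n ih => rw [pow_succ]; exact ih.mul h

/-- A matrix of scalars, as a matrix of power series. -/
def cst (A : Matrix ι κ K) : Matrix ι κ K⟦X⟧ := A.map (PowerSeries.C (R := K))

theorem cst_mul [Fintype κ] (A : Matrix ι κ K) (B : Matrix κ l K) :
    cst (A * B) = cst A * cst B := Matrix.map_mul

theorem cst_one [DecidableEq ι] : cst (1 : Matrix ι ι K) = 1 :=
  Matrix.map_one _ (map_zero _) (map_one _)

theorem cst_zero : cst (0 : Matrix ι κ K) = 0 := Matrix.map_zero _ (map_zero _)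

theorem cst_add (A B : Matrix ι κ K) : cst (A + B) = cst A + cst B :=
  Matrix.map_add _ (map_add _) A B

theorem cst_pow [Fintype ι] [DecidableEq ι] (A : Matrix ι ι K) (n : ℕ) :
    cst (A ^ n) = cst A ^ n := Matrix.map_pow A (PowerSeries.C (R := K)) n

/-- The matrix `(A - A(0)) / w`. -/
def shiftMat (A : Matrix ι κ K⟦X⟧) : Matrix ι κ K⟦X⟧ :=
  Matrix.of fun i j => PowerSeries.mk fun k => coeff (k + 1) (A i j)

theorem eq_cst_add_shiftMat (A : Matrix ι κ K⟦X⟧) :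
    A = cst (A.map (constantCoeff (R := K))) + (X : K⟦X⟧) • shiftMat A := by
  ext i j k
  cases k with
  | zero => simp [cst, shiftMat]
  | succ k => simp [cst, shiftMat, coeff_succ_X_mul, coeff_succ_C]

theorem MatIn.shiftMat {A : Matrix ι κ K⟦X⟧} (h : MatIn R A) : MatIn R (shiftMat A) :=
  fun i j k => by simpa [ParamHT.shiftMat] using h i j (k + 1)

/-- A contractive map on matrices of power series has a fixed point; its coefficients lie in every
subring `R` such that the map preserves the matrices over `R`. -/
theorem exists_fixed_point (Φ : Matrix ι κ K⟦X⟧ → Matrix ι κ K⟦X⟧)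
    (hΦ : ∀ n A B, Agree n A B → Agree (n + 1) (Φ A) (Φ B)) :
    ∃ A, Φ A = A ∧ ∀ R : Subring K, (∀ B, MatIn R B → MatIn R (Φ B)) → MatIn R A := by
  have hstep : ∀ n, Agree n (Φ^[n] 0) (Φ^[n + 1] 0) := by
    intro n
    induction n with
    | zero => intro i j k hk; exact absurd hk (Nat.not_lt_zero k)
    | succ n ih =>
      rw [Function.iterate_succ_apply', Function.iterate_succ_apply']
      exact hΦ n _ _ ih
  have hle : ∀ n d, Agree n (Φ^[n] 0) (Φ^[n + d] 0) := by
    intro n d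
    induction d with
    | zero => exact Agree.refl _ _
    | succ d ih =>
      intro i j k hk
      rw [ih i j k hk]
      exact hstep (n + d) i j k (by omega)
  set A : Matrix ι κ K⟦X⟧ := Matrix.of fun i j =>
    PowerSeries.mk fun k => coeff k ((Φ^[k + 1] 0) i j) with hA
  have hAn : ∀ n, Agree n A (Φ^[n] 0) := by
    intro n i j k hk
    rw [hA, Matrix.of_apply, coeff_mk]
    obtain ⟨d, rfl⟩ := Nat.exists_eq_add_of_le (Nat.succ_le_of_lt hk)
    exact hle (k + 1) d i j k (Nat.lt_succ_self k)
  refine ⟨A, ?_, fun R hR i j k => ?_⟩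
  · ext i j k
    have h1 := hΦ k _ _ (hAn k) i j k (Nat.lt_succ_self k)
    have h2 := hAn (k + 1) i j k (Nat.lt_succ_self k)
    rw [h1, h2, Function.iterate_succ_apply']
  · have hmem : ∀ n, MatIn R (Φ^[n] (0 : Matrix ι κ K⟦X⟧)) := by
      intro n
      induction n with
      | zero => intro i j k; simp
      | succ n ih => rw [Function.iterate_succ_apply']; exact hR _ ih
    rw [hA, Matrix.of_apply, coeff_mk]
    exact hmem _ i j k

end PowerSeriesMatrix

/-! ### The Fitting decomposition of a matrix -/

section Fitting

variable {K : Type*} [Field K] {ι : Type*} [Fintype ι] [DecidableEq ι]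

/-- A matrix that is neither invertible nor nilpotent splits into a nilpotent and an invertible
block, both of positive size. -/
theorem exists_fitting (f : Matrix ι ι K) (hu : ¬ IsUnit f) (hn : ¬ IsNilpotent f) :
    ∃ (p p' : ℕ) (G : Matrix ι (Fin p) K) (G' : Matrix ι (Fin p') K) (F : Matrix (Fin p) ι K)
      (F' : Matrix (Fin p') ι K) (A : Matrix (Fin p) (Fin p) K) (B Bi : Matrix (Fin p') (Fin p') K)
      (N : ℕ), 0 < p ∧ p < Fintype.card ι ∧ F * G = 1 ∧ F * G' = 0 ∧ G * F + G' * F' = 1 ∧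
        f * G = G * A ∧ f * G' = G' * B ∧ A ^ N = 0 ∧ B * Bi = 1 := by
  obtain ⟨n, hn1, hc⟩ : ∃ n, 1 ≤ n ∧ IsCompl (LinearMap.ker (Matrix.toLin' f ^ n))
      (LinearMap.range (Matrix.toLin' f ^ n)) := by
    obtain ⟨k, hk⟩ := Filter.eventually_atTop.1
      (LinearMap.eventually_isCompl_ker_pow_range_pow (Matrix.toLin' f))
    exact ⟨max 1 k, le_max_left _ _, hk _ (le_max_right _ _)⟩
  set φ := Matrix.toLin' f with hφ
  set U := LinearMap.ker (φ ^ n) with hU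
  set W := LinearMap.range (φ ^ n) with hW
  have hfn : Matrix.toLin' (f ^ n) = φ ^ n := Matrix.toLin'_pow f n
  have hU0 : ∀ v, v ∈ U ↔ (f ^ n).mulVec v = 0 := fun v => by
    rw [hU, LinearMap.mem_ker, ← hfn, Matrix.toLin'_apply]
  have hW0 : ∀ v, v ∈ W ↔ ∃ u, (f ^ n).mulVec u = v := fun v => by
    rw [hW, LinearMap.mem_range, ← hfn]
    simp only [Matrix.toLin'_apply]
  have hcomm : ∀ v, (f ^ n).mulVec (f.mulVec v) = f.mulVec ((f ^ n).mulVec v) := fun v => by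
    rw [Matrix.mulVec_mulVec, Matrix.mulVec_mulVec, ← pow_succ, ← pow_succ']
  have hfU : ∀ v ∈ U, f.mulVec v ∈ U := fun v hv => by
    rw [hU0] at *
    rw [hcomm, hv, Matrix.mulVec_zero]
  have hfW : ∀ v ∈ W, f.mulVec v ∈ W := fun v hv => by
    rw [hW0] at *
    obtain ⟨u, rfl⟩ := hv
    exact ⟨f.mulVec u, hcomm u⟩
  have hkerU : ∀ v, f.mulVec v = 0 → v ∈ U := fun v hv => by
    rw [hU0]
    obtain ⟨k, rfl⟩ := Nat.exists_eq_add_of_le' hn1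
    rw [pow_succ, ← Matrix.mulVec_mulVec, hv, Matrix.mulVec_zero]
  let bU := Module.finBasis K U
  let bW := Module.finBasis K W
  set p := Module.finrank K U with hp
  set p' := Module.finrank K W with hp'
  let b : Module.Basis (Fin p ⊕ Fin p') K (ι → K) :=
    (bU.prod bW).map (Submodule.prodEquivOfIsCompl U W hc)
  have hbl : ∀ j, b (Sum.inl j) = bU j := fun j => by simp [b]
  have hbr : ∀ j, b (Sum.inr j) = bW j := fun j => by simp [b]
  let e := Pi.basisFun K ι
  set P := e.toMatrix b with hP
  set Q := b.toMatrix e with hQ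
  have hPQ : P * Q = 1 := e.toMatrix_mul_toMatrix_flip b
  have hQP : Q * P = 1 := b.toMatrix_mul_toMatrix_flip e
  have hPcol : ∀ (j) (i), P i j = b j i := fun j i => by
    rw [hP, Module.Basis.toMatrix_apply, Pi.basisFun_repr]
  set G : Matrix ι (Fin p) K := P.submatrix id Sum.inl with hG
  set G' : Matrix ι (Fin p') K := P.submatrix id Sum.inr with hG'
  set F : Matrix (Fin p) ι K := Q.submatrix Sum.inl id with hF
  set F' : Matrix (Fin p') ι K := Q.submatrix Sum.inr id with hF'
  have hsum : G * F + G' * F' = 1 := by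
    rw [← hPQ]
    ext i j
    simp [Matrix.mul_apply, hG, hF, hG', hF', Fintype.sum_sum_type]
  have hFG : F * G = 1 := by
    ext i j
    have := congrFun (congrFun hQP (Sum.inl i)) (Sum.inl j)
    simpa [Matrix.mul_apply, Matrix.one_apply, hG, hF] using this
  have hFG' : F * G' = 0 := by
    ext i j
    have := congrFun (congrFun hQP (Sum.inl i)) (Sum.inr j)
    simpa [Matrix.mul_apply, Matrix.one_apply, hG', hF] using this
  have hF'G : F' * G = 0 := by
    ext i j
    have := congrFun (congrFun hQP (Sum.inr i)) (Sum.inl j)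
    simpa [Matrix.mul_apply, Matrix.one_apply, hG, hF'] using this
  have hF'G' : F' * G' = 1 := by
    ext i j
    have := congrFun (congrFun hQP (Sum.inr i)) (Sum.inr j)
    simpa [Matrix.mul_apply, Matrix.one_apply, hG', hF'] using this
  have hGU : ∀ v, G.mulVec v ∈ U := fun v => by
    have : G.mulVec v = ∑ j, v j • (bU j : ι → K) := by
      ext i
      simp [Matrix.mulVec, dotProduct, hG, hPcol, hbl, mul_comm]
    rw [this]
    exact Submodule.sum_mem _ fun j _ => Submodule.smul_mem _ _ (bU j).2
  have hGW : ∀ v, G'.mulVec v ∈ W := fun v => by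
    have : G'.mulVec v = ∑ j, v j • (bW j : ι → K) := by
      ext i
      simp [Matrix.mulVec, dotProduct, hG', hPcol, hbr, mul_comm]
    rw [this]
    exact Submodule.sum_mem _ fun j _ => Submodule.smul_mem _ _ (bW j).2
  have hU' : ∀ v ∈ U, F'.mulVec v = 0 := fun v hv => by
    have h1 : v = ∑ j, bU.repr ⟨v, hv⟩ j • (bU j : ι → K) := by
      have := congrArg (Subtype.val) (bU.sum_repr ⟨v, hv⟩)
      simpa only [AddSubmonoidClass.coe_finsetSum, Submodule.coe_smul] using this.symm
    have h2 : v = G.mulVec (fun j => bU.repr ⟨v, hv⟩ j) := by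
      refine h1.trans ?_
      ext i
      simp [Matrix.mulVec, dotProduct, hG, hPcol, hbl, mul_comm]
    rw [h2, Matrix.mulVec_mulVec, hF'G, Matrix.zero_mulVec]
  have hW' : ∀ v ∈ W, F.mulVec v = 0 := fun v hv => by
    have h1 : v = ∑ j, bW.repr ⟨v, hv⟩ j • (bW j : ι → K) := by
      have := congrArg (Subtype.val) (bW.sum_repr ⟨v, hv⟩)
      simpa only [AddSubmonoidClass.coe_finsetSum, Submodule.coe_smul] using this.symm
    have h2 : v = G'.mulVec (fun j => bW.repr ⟨v, hv⟩ j) := by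
      refine h1.trans ?_
      ext i
      simp [Matrix.mulVec, dotProduct, hG', hPcol, hbr, mul_comm]
    rw [h2, Matrix.mulVec_mulVec, hFG', Matrix.zero_mulVec]
  have hfG : f * G = G * (F * f * G) := by
    have h0 : F' * f * G = 0 := by
      refine Matrix.ext_of_mulVec_single fun j => ?_
      rw [← Matrix.mulVec_mulVec, ← Matrix.mulVec_mulVec, Matrix.zero_mulVec]
      exact hU' _ (hfU _ (hGU _))
    calc f * G = (G * F + G' * F') * (f * G) := by rw [hsum, Matrix.one_mul]
      _ = G * (F * f * G) + G' * (F' * f * G) := by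
        rw [Matrix.add_mul]; simp only [Matrix.mul_assoc]
      _ = _ := by rw [h0, Matrix.mul_zero, add_zero]
  have hfG' : f * G' = G' * (F' * f * G') := by
    have h0 : F * f * G' = 0 := by
      refine Matrix.ext_of_mulVec_single fun j => ?_
      rw [← Matrix.mulVec_mulVec, ← Matrix.mulVec_mulVec, Matrix.zero_mulVec]
      exact hW' _ (hfW _ (hGW _))
    calc f * G' = (G * F + G' * F') * (f * G') := by rw [hsum, Matrix.one_mul]
      _ = G * (F * f * G') + G' * (F' * f * G') := by
        rw [Matrix.add_mul]; simp only [Matrix.mul_assoc]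
      _ = _ := by rw [h0, Matrix.mul_zero, zero_add]
  have hAn : (F * f * G) ^ n = 0 := by
    have h1 : ∀ k, f ^ k * G = G * (F * f * G) ^ k := by
      intro k
      induction k with
      | zero => simp
      | succ k ih => rw [pow_succ, Matrix.mul_assoc, hfG, ← Matrix.mul_assoc, ih, Matrix.mul_assoc,
          ← pow_succ]
    have h2 : f ^ n * G = 0 := by
      refine Matrix.ext_of_mulVec_single fun j => ?_
      rw [← Matrix.mulVec_mulVec, Matrix.zero_mulVec]
      exact (hU0 _).1 (hGU _)
    calc (F * f * G) ^ n = F * (G * (F * f * G) ^ n) := by rw [← Matrix.mul_assoc, hFG, Matrix.one_mul]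
      _ = 0 := by rw [← h1, h2, Matrix.mul_zero]
  have hB : IsUnit (F' * f * G') := by
    rw [← Matrix.mulVec_injective_iff_isUnit]
    refine (injective_iff_map_eq_zero (F' * f * G').mulVecLin).2 fun v hv => ?_
    rw [Matrix.mulVecLin_apply] at hv
    have h1 : f.mulVec (G'.mulVec v) = 0 := by
      rw [Matrix.mulVec_mulVec, hfG', ← Matrix.mulVec_mulVec, hv, Matrix.mulVec_zero]
    have h2 : G'.mulVec v = 0 := Submodule.disjoint_def.1 hc.disjoint _ (hkerU _ h1) (hGW v)
    have h3 := congrArg F'.mulVec h2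
    rwa [Matrix.mulVec_mulVec, hF'G', Matrix.one_mulVec, Matrix.mulVec_zero] at h3
  obtain ⟨Bi, hBi⟩ := hB.exists_right_inv
  have hfin := Submodule.finrank_add_eq_of_isCompl hc
  rw [Module.finrank_fintype_fun_eq_card] at hfin
  refine ⟨p, p', G, G', F, F', F * f * G, F' * f * G', Bi, n, ?_, ?_, hFG, hFG', hsum, hfG, hfG',
    hAn, hBi⟩
  · rw [Nat.pos_iff_ne_zero]
    intro h0
    apply hu
    rw [← Matrix.mulVec_injective_iff_isUnit]
    refine (injective_iff_map_eq_zero f.mulVecLin).2 fun v hv => ?_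
    have := hkerU v hv
    rwa [Submodule.finrank_eq_zero.1 h0, Submodule.mem_bot] at this
  · have : p' ≠ 0 := by
      intro h0
      refine hn ⟨n, ?_⟩
      have h1 := Submodule.finrank_eq_zero.1 h0
      refine Matrix.ext_of_mulVec_single fun j => ?_
      have h2 : (f ^ n).mulVec (Pi.single j 1) ∈ W := (hW0 _).2 ⟨_, rfl⟩
      rw [h1, Submodule.mem_bot] at h2
      rw [h2, Matrix.zero_mulVec]
    omega

end Fitting

/-! ### The splitting lemma -/

section Split

open PowerSeries

variable {K : Type*} [Field K] {R₀ : Set K}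

theorem coeffsIn_coe {R : Subring K} {f : K⟦X⟧} :
    CoeffsIn R (f : LaurentSeries K) ↔ ∀ k, coeff k f ∈ R := by
  constructor
  · intro h k
    have := h k
    rwa [LaurentSeries.coeff_coe_powerSeries] at this
  · intro h i
    rw [PowerSeries.coeff_coe]
    split_ifs
    exacts [R.zero_mem, h _]

/-- The ring of power series that are tame as Laurent series. -/
def TamePS (R₀ : Set K) : Subring K⟦X⟧ := (Tame R₀).toSubring.comap (HahnSeries.ofPowerSeries ℤ K)

theorem mem_tamePS {f : K⟦X⟧} : f ∈ TamePS R₀ ↔ (f : LaurentSeries K) ∈ Tame R₀ := Iff.rfl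

/-- The inclusion of the tame power series in the field of tame Laurent series. -/
def TamePS.incl (R₀ : Set K) : TamePS R₀ →+* Tame R₀ where
  toFun f := ⟨(f.1 : LaurentSeries K), f.2⟩
  map_one' := Subtype.ext (map_one (HahnSeries.ofPowerSeries ℤ K))
  map_mul' f g := Subtype.ext (map_mul (HahnSeries.ofPowerSeries ℤ K) f.1 g.1)
  map_zero' := Subtype.ext (map_zero (HahnSeries.ofPowerSeries ℤ K))
  map_add' f g := Subtype.ext (map_add (HahnSeries.ofPowerSeries ℤ K) f.1 g.1)

theorem exists_matrix_over_tamePS {ι κ : Type*} {A : Matrix ι κ K⟦X⟧}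
    (h : ∀ i j, A i j ∈ TamePS R₀) : ∃ B : Matrix ι κ (TamePS R₀), B.map Subtype.val = A :=
  ⟨Matrix.of fun i j => ⟨A i j, h i j⟩, rfl⟩

theorem eventually_matIn {ι κ : Type*} [Finite ι] [Finite κ] {A : Matrix ι κ K⟦X⟧}
    (h : ∀ i j, A i j ∈ TamePS R₀) : ∀ᶠ R in tameFilter R₀, MatIn R A := by
  have : ∀ᶠ R in tameFilter R₀, ∀ i j, CoeffsIn R (A i j : LaurentSeries K) :=
    Filter.eventually_all.2 fun i => Filter.eventually_all.2 fun j => h i j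
  filter_upwards [this] with R hR i j
  exact coeffsIn_coe.1 (hR i j)

theorem cst_mem_tamePS {ι κ : Type*} (E : Matrix ι κ K) (i : ι) (j : κ) :
    cst E i j ∈ TamePS R₀ := by
  rw [mem_tamePS, cst, Matrix.map_apply, PowerSeries.coe_C]
  exact single_mem_tame 0 _

theorem cst_smul_one {ι : Type*} [DecidableEq ι] (c : K) :
    cst (c • (1 : Matrix ι ι K)) = PowerSeries.C c • (1 : Matrix ι ι K⟦X⟧) := by
  ext i j : 2
  by_cases h : i = j <;> simp [cst, h]

theorem tamePS_matrix_mul {ι κ l : Type*} [Fintype κ] {A : Matrix ι κ K⟦X⟧} {B : Matrix κ l K⟦X⟧}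
    (hA : ∀ i j, A i j ∈ TamePS R₀) (hB : ∀ i j, B i j ∈ TamePS R₀) (i : ι) (j : l) :
    (A * B) i j ∈ TamePS R₀ := by
  rw [Matrix.mul_apply]
  exact Subring.sum_mem _ fun k _ => Subring.mul_mem _ (hA i k) (hB k j)

variable {ι : Type*} [Fintype ι] [DecidableEq ι]

/-- A solution of the Sylvester equation `B Y - Y A = Q` with nilpotent `A` and invertible `B`: the
geometric series `∑ B⁻¹ ^ (k + 1) Q A ^ k` is finite. -/
theorem sylvester {R : Type*} [Ring R] {p p' : Type*} [Fintype p] [Fintype p'] [DecidableEq p]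
    [DecidableEq p'] (A : Matrix p p R) (B Bi : Matrix p' p' R) (N : ℕ) (hA : A ^ N = 0)
    (hB : B * Bi = 1) (Q : Matrix p' p R) :
    B * (∑ k ∈ Finset.range N, Bi ^ (k + 1) * Q * A ^ k) -
      (∑ k ∈ Finset.range N, Bi ^ (k + 1) * Q * A ^ k) * A = Q := by
  have h : ∀ n, B * (∑ k ∈ Finset.range n, Bi ^ (k + 1) * Q * A ^ k) -
      (∑ k ∈ Finset.range n, Bi ^ (k + 1) * Q * A ^ k) * A = Q - Bi ^ n * Q * A ^ n := by
    intro n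
    induction n with
    | zero => simp
    | succ n ih =>
      rw [Finset.sum_range_succ, Matrix.mul_add, Matrix.add_mul, add_sub_add_comm, ih]
      rw [← Matrix.mul_assoc, ← Matrix.mul_assoc, pow_succ' Bi, ← Matrix.mul_assoc, hB,
        Matrix.one_mul, pow_succ A]
      simp only [Matrix.mul_assoc]
      abel
  rw [h, hA, Matrix.mul_zero, sub_zero]

/-- The splitting lemma on the level of power series: if the leading matrix `C(0) - λ` is neither
invertible nor nilpotent, then the connection `w^(k+1) θ + C` has a proper subconnection. -/
theorem exists_split_powerSeries (C : Matrix ι ι K⟦X⟧) (hC : ∀ i j, C i j ∈ TamePS R₀) (k : ℕ) (c : K)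
    (hu : ¬ IsUnit (C.map (constantCoeff (R := K)) - c • 1))
    (hn : ¬ IsNilpotent (C.map (constantCoeff (R := K)) - c • 1)) :
    ∃ (p : ℕ) (G : Matrix ι (Fin p) K⟦X⟧) (G' : Matrix (Fin p) ι K⟦X⟧)
      (A : Matrix (Fin p) (Fin p) K⟦X⟧), 0 < p ∧ p < Fintype.card ι ∧ G' * G = 1 ∧
        (X : K⟦X⟧) ^ (k + 1) • G.map psEuler + C * G = G * A ∧
        (∀ i j, G i j ∈ TamePS R₀) ∧ (∀ i j, G' i j ∈ TamePS R₀) ∧ (∀ i j, A i j ∈ TamePS R₀) := by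
  set f := C.map (constantCoeff (R := K)) - c • (1 : Matrix ι ι K) with hf
  obtain ⟨p, p', G, G', F, F', A, B, Bi, N, hp0, hp, hFG, hFG', hsum, hfG, hfG', hA, hB⟩ :=
    exists_fitting f hu hn
  set D₁ := shiftMat C with hD₁
  have hCD : C = cst f + cst (c • (1 : Matrix ι ι K)) + (X : K⟦X⟧) • D₁ := by
    rw [← cst_add, hf, sub_add_cancel]
    exact eq_cst_add_shiftMat C
  -- the Riccati equation `B Y - Y A = w Ψ(Y)` for the graph `G + G' Y` of the subconnection
  let Ψ : Matrix (Fin p') (Fin p) K⟦X⟧ → Matrix (Fin p') (Fin p) K⟦X⟧ := fun Y =>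
    Y * (cst F * D₁ * (cst G + cst G' * Y)) - cst F' * D₁ * (cst G + cst G' * Y) -
      (X : K⟦X⟧) ^ k • Y.map psEuler
  let Φ : Matrix (Fin p') (Fin p) K⟦X⟧ → Matrix (Fin p') (Fin p) K⟦X⟧ := fun Y =>
    ∑ i ∈ Finset.range N, cst Bi ^ (i + 1) * ((X : K⟦X⟧) • Ψ Y) * cst A ^ i
  have hΨ : ∀ n Y Y', Agree n Y Y' → Agree n (Ψ Y) (Ψ Y') := fun n Y Y' h => by
    have h' : Agree n (cst G + cst G' * Y) (cst G + cst G' * Y') :=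
      (Agree.refl _ _).add ((Agree.refl _ _).mul h)
    exact ((h.mul ((Agree.refl _ _).mul h')).sub ((Agree.refl _ _).mul h')).sub (h.euler.smul _)
  obtain ⟨Y, hY, hYR⟩ := exists_fixed_point Φ fun n Y Y' h =>
    Agree.sum _ fun i _ => ((Agree.refl _ _).mul (hΨ n Y Y' h).X_smul).mul (Agree.refl _ _)
  have hsyl : cst B * Y - Y * cst A = (X : K⟦X⟧) • Ψ Y := by
    have := sylvester (cst A) (cst B) (cst Bi) N (by rw [← cst_pow, hA, cst_zero])
      (by rw [← cst_mul, hB, cst_one]) ((X : K⟦X⟧) • Ψ Y)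
    rwa [show (∑ i ∈ Finset.range N, cst Bi ^ (i + 1) * ((X : K⟦X⟧) • Ψ Y) * cst A ^ i) = Y from hY]
      at this
  obtain ⟨H, hH⟩ : ∃ H, H = cst G + cst G' * Y := ⟨_, rfl⟩
  have hΨY : Ψ Y = Y * (cst F * D₁ * H) - cst F' * D₁ * H - (X : K⟦X⟧) ^ k • Y.map psEuler := by
    rw [hH]
  have hFH : cst F * H = 1 := by
    rw [hH, Matrix.mul_add, ← Matrix.mul_assoc, ← cst_mul, ← cst_mul, hFG, hFG', cst_one, cst_zero,
      Matrix.zero_mul, add_zero]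
  set A' := cst (c • (1 : Matrix (Fin p) (Fin p) K)) + (cst A + (X : K⟦X⟧) • (cst F * D₁ * H)) with hA'
  have hYT : ∀ i j, Y i j ∈ TamePS R₀ := by
    intro i j
    rw [mem_tamePS, mem_tame]
    filter_upwards [eventually_matIn hC, eventually_matIn (cst_mem_tamePS (R₀ := R₀) G),
      eventually_matIn (cst_mem_tamePS (R₀ := R₀) G'),
      eventually_matIn (cst_mem_tamePS (R₀ := R₀) F),
      eventually_matIn (cst_mem_tamePS (R₀ := R₀) F'),
      eventually_matIn (cst_mem_tamePS (R₀ := R₀) A),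
      eventually_matIn (cst_mem_tamePS (R₀ := R₀) Bi)] with R mC mG mG' mF mF' mA mB
    refine coeffsIn_coe.2 (hYR R (fun Z hZ => MatIn.sum _ fun i _ => ?_) i j)
    have mH := mG.add (mG'.mul hZ)
    exact ((mB.pow _).mul ((((hZ.mul ((mF.mul mC.shiftMat).mul mH)).sub
      ((mF'.mul mC.shiftMat).mul mH)).sub
      (hZ.euler.smul (coeff_X_pow_mem R k))).smul (coeff_X_mem R))).mul (mA.pow _)
  have hHT : ∀ i j, H i j ∈ TamePS R₀ := fun i j => by
    rw [hH]
    exact Subring.add_mem _ (cst_mem_tamePS G i j) (tamePS_matrix_mul (cst_mem_tamePS G') hYT i j)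
  have hHeuler : H.map psEuler = cst G' * Y.map psEuler := by
    ext i j n
    simp only [hH, Matrix.map_apply, Matrix.add_apply, coeff_psEuler, Matrix.mul_apply, cst, map_add,
      map_sum, coeff_C_mul, mul_add, Finset.mul_sum]
    have : (n : K) * coeff n (PowerSeries.C (G i j)) = 0 := by
      cases n <;> simp [coeff_succ_C]
    rw [this, zero_add]
    exact Finset.sum_congr rfl fun x _ => by ring
  have hfH : cst f * H = cst G * cst A + cst G' * (cst B * Y) := by
    rw [hH, Matrix.mul_add, ← cst_mul, hfG, ← Matrix.mul_assoc, ← cst_mul, hfG', cst_mul, cst_mul,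
      Matrix.mul_assoc]
  have hsum' : cst G * cst F + cst G' * cst F' = 1 := by
    rw [← cst_mul, ← cst_mul, ← cst_add, hsum, cst_one]
  have heq : (X : K⟦X⟧) ^ (k + 1) • H.map psEuler + C * H = H * A' := by
    have h1 : C * H = cst (c • (1 : Matrix ι ι K)) * H + (cst G * cst A + cst G' * (cst B * Y)) +
        (X : K⟦X⟧) • (D₁ * H) := by
      rw [hCD, Matrix.add_mul, Matrix.add_mul, hfH, Matrix.smul_mul]
      abel
    have h2 : D₁ * H = cst G * (cst F * D₁ * H) + cst G' * (cst F' * D₁ * H) := by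
      rw [Matrix.mul_assoc, Matrix.mul_assoc, ← Matrix.mul_assoc (cst G),
        ← Matrix.mul_assoc (cst G'), ← Matrix.add_mul, hsum', Matrix.one_mul]
    have h3 : cst (c • (1 : Matrix ι ι K)) * H = H * cst (c • (1 : Matrix (Fin p) (Fin p) K)) := by
      rw [cst_smul_one, cst_smul_one, Matrix.smul_mul, Matrix.mul_smul, Matrix.one_mul,
        Matrix.mul_one]
    have h4 : cst G' * (cst B * Y) = cst G' * (Y * cst A) + (X : K⟦X⟧) • (cst G' * Ψ Y) := by
      rw [← sub_eq_iff_eq_add', ← Matrix.mul_sub, hsyl, Matrix.mul_smul]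
    have h5 : cst G' * Ψ Y = cst G' * Y * (cst F * D₁ * H) - cst G' * (cst F' * D₁ * H) -
        (X : K⟦X⟧) ^ k • (cst G' * Y.map psEuler) := by
      rw [hΨY, Matrix.mul_sub, Matrix.mul_sub, Matrix.mul_smul, Matrix.mul_assoc (cst G') Y]
    rw [h1, h3, h4, h5, h2, hHeuler, hA', Matrix.mul_add, Matrix.mul_add H, Matrix.mul_smul]
    have h6 : ∀ Z : Matrix (Fin p) (Fin p) K⟦X⟧, H * Z = cst G * Z + cst G' * Y * Z := fun Z => by
      rw [hH, Matrix.add_mul]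
    rw [h6 (cst A), h6 (cst F * D₁ * H), pow_succ', mul_smul]
    simp only [smul_add, smul_sub, Matrix.mul_assoc]
    abel
  refine ⟨p, H, cst F, A', hp0, hp, hFH, heq, hHT, cst_mem_tamePS F, fun i j => ?_⟩
  have : A' = cst F * (C * H) + (X : K⟦X⟧) ^ (k + 1) • (cst F * H.map psEuler) := by
    rw [← Matrix.mul_smul, ← Matrix.mul_add, add_comm, heq, ← Matrix.mul_assoc, hFH, Matrix.one_mul]
  have hpsE : cst F * H.map psEuler = 0 := by
    rw [hHeuler, ← Matrix.mul_assoc, ← cst_mul, hFG', cst_zero, Matrix.zero_mul]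
  rw [this, hpsE, smul_zero, add_zero]
  exact tamePS_matrix_mul (cst_mem_tamePS F) (tamePS_matrix_mul hC hHT) i j

end Split

section Split

open PowerSeries

variable {K : Type*} [Field K] {R₀ : Set K} {ι : Type*} [Fintype ι] [DecidableEq ι]

theorem tameEuler_incl (f : K⟦X⟧) (hf : f ∈ TamePS R₀) (hf' : psEuler f ∈ TamePS R₀) :
    tameEuler R₀ (TamePS.incl R₀ ⟨f, hf⟩) = TamePS.incl R₀ ⟨psEuler f, hf'⟩ :=
  Subtype.ext (euler_coe f)

theorem psEuler_mem {f : K⟦X⟧} (hf : f ∈ TamePS R₀) : psEuler f ∈ TamePS R₀ := by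
  rw [mem_tamePS, ← euler_coe]
  exact euler_mem_tame hf

theorem X_mem_tamePS : (X : K⟦X⟧) ∈ TamePS R₀ := by
  rw [mem_tamePS, PowerSeries.coe_X]
  exact single_mem_tame 1 1

theorem incl_X_pow (n : ℕ) :
    TamePS.incl R₀ (⟨X, X_mem_tamePS⟩ ^ n) = tameSingle R₀ n 1 := by
  refine Subtype.ext ?_
  rw [map_pow]
  change ((X : K⟦X⟧) : LaurentSeries K) ^ n = HahnSeries.single (n : ℤ) 1
  rw [PowerSeries.coe_X, HahnSeries.single_pow]
  simp

/-- The splitting lemma. -/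
theorem exists_hasSub_of_split (M : Matrix ι ι (Tame R₀)) (C : Matrix ι ι K⟦X⟧) (k : ℕ)
    (hC : ∀ i j, (C i j : LaurentSeries K) = (tameSingle R₀ (k + 1) 1 * M i j : Tame R₀)) (c : K)
    (hu : ¬ IsUnit (C.map (constantCoeff (R := K)) - c • 1))
    (hn : ¬ IsNilpotent (C.map (constantCoeff (R := K)) - c • 1)) :
    ∃ (p : ℕ) (M' : Matrix (Fin p) (Fin p) (Tame R₀)), 0 < p ∧ p < Fintype.card ι ∧
      HasSub (tameEuler R₀) M M' := by
  have hCT : ∀ i j, C i j ∈ TamePS R₀ := fun i j => by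
    rw [mem_tamePS, hC]
    exact Subtype.property _
  obtain ⟨p, G, G', A, hp0, hp, hG'G, hG, hGT, hG'T, hAT⟩ :=
    exists_split_powerSeries C hCT k c hu hn
  obtain ⟨G, rfl⟩ := exists_matrix_over_tamePS hGT
  obtain ⟨G', rfl⟩ := exists_matrix_over_tamePS hG'T
  obtain ⟨A, rfl⟩ := exists_matrix_over_tamePS hAT
  obtain ⟨C, rfl⟩ := exists_matrix_over_tamePS hCT
  let i₀ := TamePS.incl R₀
  have hsub : Function.Injective (Subtype.val : TamePS R₀ → K⟦X⟧) := Subtype.val_injective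
  have hG'G' : G' * G = 1 := by
    refine Matrix.map_injective hsub ?_
    refine (Matrix.map_mul (f := (TamePS R₀).subtype)).trans (hG'G.trans ?_)
    exact (Matrix.map_one (TamePS R₀).subtype (map_zero _) (map_one _)).symm
  let E : Matrix ι (Fin p) (TamePS R₀) :=
    Matrix.of fun i j => ⟨psEuler (G i j).1, psEuler_mem (G i j).2⟩
  have hG1 : (⟨X, X_mem_tamePS⟩ : TamePS R₀) ^ (k + 1) • E + C * G = G * A := by
    refine Matrix.map_injective hsub ?_
    refine Eq.trans ?_ (hG.trans (Matrix.map_mul (f := (TamePS R₀).subtype)).symm)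
    refine Eq.trans (Matrix.map_add (TamePS R₀).subtype (map_add _) _ _) ?_
    congr 1
    exact Matrix.map_mul (f := (TamePS R₀).subtype)
  have hG2 := congrArg (fun Z => Z.map i₀) hG1
  have hw : tameSingle R₀ (-(k + 1)) 1 * tameSingle R₀ (k + 1) 1 = 1 := by
    rw [tameSingle_mul]
    simp
    rfl
  have hCM : C.map i₀ = tameSingle R₀ (k + 1) 1 • M := by
    refine Matrix.ext fun i j => ?_
    exact Subtype.ext (hC i j)
  have hEG : E.map i₀ = (G.map i₀).map (tameEuler R₀) := by
    refine Matrix.ext fun i j => ?_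
    exact (tameEuler_incl _ _ _).symm
  refine ⟨p, tameSingle R₀ (-(k + 1)) 1 • A.map i₀, hp0, hp, G.map i₀, G'.map i₀, ?_, ?_⟩
  · rw [← Matrix.map_mul, hG'G', Matrix.map_one _ (map_zero _) (map_one _)]
  · unfold IsGauge
    have h1 : tameSingle R₀ (k + 1) 1 • ((G.map i₀).map (tameEuler R₀) + M * G.map i₀) =
        G.map i₀ * A.map i₀ := by
      rw [← hEG, smul_add, ← Matrix.smul_mul, ← hCM, ← Matrix.map_mul, ← Matrix.map_mul, ← hG1,
        Matrix.map_add _ (map_add _)]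
      congr 1
      refine Matrix.ext fun i j => ?_
      simp only [Matrix.smul_apply, Matrix.map_apply, smul_eq_mul, map_mul]
      refine congrArg (· * i₀ (E i j)) ?_
      have := incl_X_pow (R₀ := R₀) (k + 1)
      push_cast at this
      exact this.symm
    rw [Matrix.mul_smul, ← h1, smul_smul, hw, one_smul]

end Split

/-! ### The regular singular case -/

section Regular

open PowerSeries

variable {K : Type*} [Field K] {R₀ : Set K} {ι : Type*} [Fintype ι] [DecidableEq ι]

/-- The determinant is a product of shifted eigenvalues; by Cramer's rule, `(N + x)⁻¹` thus involves
no inverses other than those of `r + x` for the eigenvalues `r` of `N`. -/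
theorem det_add_smul_one [IsAlgClosed K] (N : Matrix ι ι K) (x : K) :
    (N + x • 1).det = (N.charpoly.roots.map fun r => r + x).prod := by
  have h1 : (N + x • 1).det = (-1) ^ Fintype.card ι * N.charpoly.eval (-x) := by
    rw [Matrix.eval_charpoly, ← Matrix.det_neg]
    congr 1
    ext i j
    by_cases h : i = j <;> simp [Matrix.scalar_apply, h, add_comm]
  have h2 := IsAlgClosed.splits N.charpoly
  have hcard : Multiset.card N.charpoly.roots = Fintype.card ι := by
    rw [← h2.natDegree_eq_card_roots, Matrix.charpoly_natDegree_eq_dim]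
  rw [h1, h2.eval_eq_prod_roots_of_monic N.charpoly_monic, ← hcard]
  generalize N.charpoly.roots = s
  induction s using Multiset.induction_on with
  | empty => simp
  | cons a s ih =>
    rw [Multiset.map_cons, Multiset.prod_cons, Multiset.map_cons, Multiset.prod_cons, ← ih,
      Multiset.card_cons]
    ring

/-- Some eigenvalue `b` of `M` is such that no `b - k` with `k ≥ 1` is an eigenvalue. -/
theorem exists_minimal_eigenvalue [IsAlgClosed K] [CharZero K] [Nonempty ι] (M : Matrix ι ι K) :
    ∃ b : K, (M - b • 1).det = 0 ∧ ∀ k : ℕ, (M - b • 1 + ((k : K) + 1) • 1).det ≠ 0 := by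
  have hdet : ∀ x : K, (M - x • 1).det = 0 ↔ x ∈ M.charpoly.roots := by
    intro x
    rw [Polynomial.mem_roots M.charpoly_monic.ne_zero, Polynomial.IsRoot, Matrix.eval_charpoly,
      ← neg_sub, Matrix.det_neg, mul_eq_zero, Matrix.smul_one_eq_diagonal]
    simp [Matrix.scalar_apply]
  have hne : ∃ x, x ∈ M.charpoly.roots := by
    have : M.charpoly.degree ≠ 0 := by
      rw [Matrix.charpoly_degree_eq_dim]
      simp
    obtain ⟨x, hx⟩ := IsAlgClosed.exists_root _ this
    exact ⟨x, (Polynomial.mem_roots M.charpoly_monic.ne_zero).2 hx⟩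
  classical
  let α := {x : K // x ∈ M.charpoly.roots.toFinset}
  let r : α → α → Prop := fun x y => ∃ k : ℕ, x.1 = y.1 - (k + 1)
  have : IsTrans α r := ⟨by
    rintro x y z ⟨k, hk⟩ ⟨l, hl⟩
    refine ⟨k + l + 1, ?_⟩
    rw [hk, hl]; push_cast; ring⟩
  have : Std.Irrefl r := ⟨by
    rintro x ⟨k, hk⟩
    have : (k + 1 : K) = 0 := by linear_combination hk
    exact Nat.cast_add_one_ne_zero k this⟩
  obtain ⟨x₀, hx₀⟩ := hne
  obtain ⟨b, -, hb⟩ := (Finite.wellFounded_of_trans_of_irrefl r).has_min Set.univ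
    ⟨⟨x₀, by simpa using hx₀⟩, trivial⟩
  refine ⟨b.1, (hdet _).2 (Multiset.mem_toFinset.1 b.2), fun k h0 => ?_⟩
  have h1 : M - b.1 • 1 + ((k : K) + 1) • 1 = M - (b.1 - (k + 1)) • (1 : Matrix ι ι K) := by
    module
  rw [h1, hdet] at h0
  exact hb ⟨_, by simpa using h0⟩ trivial ⟨k, rfl⟩

/-- A regular singular connection has a subconnection of rank one, with constant matrix. -/
theorem exists_regular_solution [IsAlgClosed K] [CharZero K] [Nonempty ι] (M : Matrix ι ι K⟦X⟧)
    (hM : ∀ i j, M i j ∈ TamePS R₀) :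
    ∃ (b : K) (h : ι → K⟦X⟧), h ≠ 0 ∧ (∀ i, h i ∈ TamePS R₀) ∧
      ∀ i, psEuler (h i) + ∑ j, M i j * h j = PowerSeries.C b * h i := by
  classical
  set M₀ := M.map (constantCoeff (R := K)) with hM₀
  obtain ⟨b, hb, hbk⟩ := exists_minimal_eigenvalue M₀
  set N := M₀ - b • (1 : Matrix ι ι K) with hN
  obtain ⟨h₀, hh₀, hNh⟩ := Matrix.exists_mulVec_eq_zero_iff.2 hb
  set M₁ := shiftMat M with hM₁
  have hMM : M = cst M₀ + (X : K⟦X⟧) • M₁ := eq_cst_add_shiftMat M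
  -- the recursion for the coefficients of a solution with constant term `h₀`
  let Φ : Matrix ι Unit K⟦X⟧ → Matrix ι Unit K⟦X⟧ := fun Y => Matrix.of fun i _ =>
    PowerSeries.mk fun k => match k with
      | 0 => h₀ i
      | k + 1 => -∑ j, (N + ((k : K) + 1) • 1)⁻¹ i j * coeff k ((M₁ * Y) j ())
  obtain ⟨Y, hY, hYR⟩ := exists_fixed_point Φ fun n Y Y' h i j k hk => by
    simp only [Φ, Matrix.of_apply, coeff_mk]
    cases k with
    | zero => rfl
    | succ k =>
      simp only
      congr 1
      refine Finset.sum_congr rfl fun l _ => ?_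
      rw [((Agree.refl n M₁).mul h) l () k (by omega)]
  have hYc : ∀ i k, coeff k (Y i ()) = coeff k (Φ Y i ()) := fun i k => by rw [hY]
  refine ⟨b, fun i => Y i (), ?_, fun i => ?_, fun i => ?_⟩
  · intro h0
    apply hh₀
    ext i
    have h1 := hYc i 0
    rw [show Y i () = 0 from congrFun h0 i] at h1
    simpa [Φ] using h1.symm
  · rw [mem_tamePS, mem_tame]
    have hr : ∀ᶠ R in tameFilter R₀, ∀ r ∈ N.charpoly.roots.toFinset, ∀ n : ℤ, (r + n)⁻¹ ∈ R :=
      (Filter.eventually_all_finset _).2 fun r _ =>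
        (eventually_shift_mem R₀ r).mono fun _ h => h.2
    have hh : ∀ᶠ R in tameFilter R₀, ∀ i, h₀ i ∈ R :=
      Filter.eventually_all.2 fun i => eventually_mem R₀ (h₀ i)
    filter_upwards [eventually_matIn hM, eventually_mem R₀ b, hr, hh] with R mM mb mr mh
    have mN : ∀ i j, N i j ∈ R := fun i j => by
      have h1 : M₀ i j ∈ R := by
        have := mM i j 0
        rwa [coeff_zero_eq_constantCoeff] at this
      rw [hN, Matrix.sub_apply, Matrix.smul_apply, smul_eq_mul, Matrix.one_apply]
      split_ifs
      · rw [mul_one]; exact R.sub_mem h1 mb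
      · rw [mul_zero, sub_zero]; exact h1
    refine coeffsIn_coe.2 (hYR R (fun Z mZ => ?_) i ())
    intro i j k
    simp only [Φ, Matrix.of_apply, coeff_mk]
    cases k with
    | zero => exact mh i
    | succ k =>
      refine R.neg_mem (R.sum_mem fun l _ => R.mul_mem ?_ ((mM.shiftMat.mul mZ) _ _ _))
      obtain ⟨N', hN'⟩ : ∃ N' : Matrix ι ι R, N'.map R.subtype = N + ((k : K) + 1) • 1 := by
        refine ⟨Matrix.of fun i j => ⟨(N + ((k : K) + 1) • 1) i j, ?_⟩, rfl⟩
        rw [Matrix.add_apply, Matrix.smul_apply, Matrix.one_apply, smul_eq_mul]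
        refine R.add_mem (mN i j) (R.mul_mem (R.add_mem (natCast_mem R k) R.one_mem) ?_)
        split_ifs
        exacts [R.one_mem, R.zero_mem]
      rw [Matrix.inv_def, Matrix.smul_apply, smul_eq_mul, Ring.inverse_eq_inv']
      refine R.mul_mem ?_ ?_
      · rw [det_add_smul_one, ← Multiset.prod_map_inv]
        refine Subring.multiset_prod_mem _ _ fun x hx => ?_
        obtain ⟨r, hr', rfl⟩ := Multiset.mem_map.1 hx
        have := mr r (by simpa using hr') (k + 1)
        push_cast at this
        exact this
      · rw [← hN']
        have := RingHom.map_adjugate R.subtype N'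
        rw [RingHom.mapMatrix_apply, RingHom.mapMatrix_apply] at this
        rw [← this]
        exact Subtype.property _
  · ext k
    have hMY : ∑ j, M i j * Y j () = (M * Y) i () := (Matrix.mul_apply).symm
    rw [hMY, hMM, Matrix.add_mul, Matrix.smul_mul, map_add, Matrix.add_apply, map_add,
      Matrix.smul_apply, smul_eq_mul, coeff_psEuler, coeff_C_mul]
    have hcstY : ∀ k, coeff k ((cst M₀ * Y) i ()) = M₀.mulVec (fun j => coeff k (Y j ())) i := by
      intro k
      simp [Matrix.mul_apply, cst, Matrix.mulVec, dotProduct]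
    rw [hcstY]
    have hM₀N : M₀ = N + b • 1 := by rw [hN]; module
    cases k with
    | zero =>
      have : (fun j => coeff 0 (Y j ())) = h₀ := by
        ext j
        rw [hYc]; simp [Φ]
      have h1 : coeff 0 (Y i ()) = h₀ i := congrFun this i
      rw [this, hM₀N, Matrix.add_mulVec, hNh, h1]
      simp [Matrix.smul_mulVec]
    | succ k =>
      rw [coeff_succ_X_mul]
      have : (fun j => coeff (k + 1) (Y j ())) =
          -(N + ((k : K) + 1) • 1)⁻¹.mulVec (fun j => coeff k ((M₁ * Y) j ())) := by
        ext j
        rw [hYc]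
        simp [Φ, Matrix.mulVec, dotProduct]
      have h2 := congrArg (fun v => (N + ((k : K) + 1) • (1 : Matrix ι ι K)).mulVec v i) this
      simp only [Matrix.mulVec_neg, Matrix.mulVec_mulVec] at h2
      rw [Matrix.mul_nonsing_inv _ (isUnit_iff_ne_zero.2 (hbk k)), Matrix.one_mulVec] at h2
      rw [hM₀N]
      simp only [Matrix.add_mulVec, Matrix.smul_mulVec, Matrix.one_mulVec, Pi.add_apply,
        Pi.smul_apply, Pi.neg_apply, smul_eq_mul] at h2 ⊢
      push_cast
      linear_combination h2

end Regular

/-! ### Scalar equations -/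

section Scalar

open PowerSeries

variable {K : Type*} [Field K] {R₀ : Set K}

/-- The series whose `i`-th coefficient is `(i + c)⁻¹` times that of `f`. -/
def divShift (c : K) (f : LaurentSeries K) : LaurentSeries K where
  coeff i := (c + (i : K))⁻¹ * f.coeff i
  isPWO_support' := f.isPWO_support.mono fun i hi h0 => hi (by simp [h0])

theorem divShift_mem_tame (c : K) {f : LaurentSeries K} (hf : f ∈ Tame R₀) :
    divShift c f ∈ Tame R₀ := by
  rw [mem_tame] at *
  filter_upwards [hf, eventually_shift_mem R₀ c] with R h hc i
  exact R.mul_mem (hc.2 i) (h i)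

theorem coeff_C_mul' (a : K) (f : LaurentSeries K) (i : ℤ) :
    (HahnSeries.C a * f).coeff i = a * f.coeff i := by
  rw [HahnSeries.C_mul_eq_smul, HahnSeries.coeff_smul, smul_eq_mul]

theorem exists_solution_const (c : K) (hc : ∀ n : ℤ, c ≠ n) (f : Tame R₀) :
    ∃ u : Tame R₀, tameEuler R₀ u + tameC R₀ c * u = f := by
  refine ⟨⟨divShift c f.1, divShift_mem_tame c f.2⟩, Subtype.ext ?_⟩
  ext i
  change (euler (divShift c f.1) + HahnSeries.C c * divShift c f.1).coeff i = _
  rw [HahnSeries.coeff_add, coeff_C_mul', coeff_euler]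
  have : c + (i : K) ≠ 0 := fun h => hc (-i) (by push_cast; linear_combination h)
  simp only [divShift]
  field_simp
  ring

theorem exists_solution_zero [CharZero K] (f : Tame R₀) :
    ∃ (u : Tame R₀) (c : K), tameEuler R₀ u = f - tameC R₀ c := by
  refine ⟨⟨divShift 0 f.1, divShift_mem_tame 0 f.2⟩, f.1.coeff 0, Subtype.ext ?_⟩
  ext i
  change (euler (divShift 0 f.1)).coeff i = (f.1 - HahnSeries.C (f.1.coeff 0)).coeff i
  rw [HahnSeries.coeff_sub, coeff_euler]
  by_cases hi : i = 0
  · subst hi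
    simp
  · have : (i : K) ≠ 0 := by exact_mod_cast hi
    simp [divShift, hi, this]

/-- If `a` has a pole, then `θ + a` is surjective on tame series. -/
theorem exists_solution_pole (a : Tame R₀) (ha : a.1.order < 0) (f : Tame R₀) :
    ∃ u : Tame R₀, tameEuler R₀ u + a * u = f := by
  obtain ⟨k, hk⟩ : ∃ k : ℕ, a.1.order = -((k : ℤ) + 1) := ⟨(-a.1.order - 1).toNat, by omega⟩
  have ha0 : a.1 ≠ 0 := by
    intro h0
    rw [h0, HahnSeries.order_zero] at ha
    exact lt_irrefl _ ha
  set e := f.1.order with he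
  set p := a.1.powerSeriesPart with hp
  set g := f.1.powerSeriesPart with hg
  have hap : a.1 = HahnSeries.single (-((k : ℤ) + 1)) 1 * (p : LaurentSeries K) := by
    rw [← hk, hp, LaurentSeries.single_order_mul_powerSeriesPart]
  have hfg : f.1 = HahnSeries.single e 1 * (g : LaurentSeries K) := by
    rw [he, hg, LaurentSeries.single_order_mul_powerSeriesPart]
  have hpT : p ∈ TamePS R₀ := by
    rw [mem_tamePS, hp, LaurentSeries.ofPowerSeries_powerSeriesPart]
    exact (Tame R₀).mul_mem (single_mem_tame _ _) a.2
  have hgT : g ∈ TamePS R₀ := by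
    rw [mem_tamePS, hg, LaurentSeries.ofPowerSeries_powerSeriesPart]
    exact (Tame R₀).mul_mem (single_mem_tame _ _) f.2
  let pm : Matrix Unit Unit K⟦X⟧ := Matrix.of fun _ _ => p
  let gm : Matrix Unit Unit K⟦X⟧ := Matrix.of fun _ _ => g
  set α := constantCoeff p with hα
  have hα0 : α ≠ 0 := by
    rw [hα, hp, ← coeff_zero_eq_constantCoeff_apply, LaurentSeries.powerSeriesPart_coeff]
    simpa using ha0
  have hpX : p = PowerSeries.C α + X * (shiftMat pm () ()) := by
    have := congrFun (congrFun (eq_cst_add_shiftMat pm) ()) ()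
    simpa [pm, cst] using this
  -- the equation for the power series part of the solution, divided by `α`
  let Φ : Matrix Unit Unit K⟦X⟧ → Matrix Unit Unit K⟦X⟧ := fun Y =>
    (PowerSeries.C α⁻¹ : K⟦X⟧) • (X : K⟦X⟧) • ((X : K⟦X⟧) ^ k • (gm - (e : K⟦X⟧) • Y - Y.map psEuler)
      - shiftMat pm * Y)
  obtain ⟨Y, hY, hYR⟩ := exists_fixed_point Φ fun n Y Y' h =>
    (((((Agree.refl _ _).sub (h.smul _)).sub h.euler).smul _).sub
      ((Agree.refl _ _).mul h)).X_smul.smul _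
  set y := Y () () with hy
  have hyT : y ∈ TamePS R₀ := by
    rw [mem_tamePS, mem_tame]
    filter_upwards [eventually_matIn (R₀ := R₀) (A := pm) fun _ _ => hpT,
      eventually_matIn (R₀ := R₀) (A := gm) fun _ _ => hgT,
      eventually_inv_mem R₀ α] with R mp mg mα
    refine coeffsIn_coe.2 (hYR R (fun Z mZ => ?_) () ())
    refine MatIn.smul (MatIn.smul (((((mg.sub (mZ.smul fun j => ?_)).sub mZ.euler).smul
      (coeff_X_pow_mem R k))).sub (mp.shiftMat.mul mZ)) (coeff_X_mem R)) fun j => ?_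
    · have : (e : K⟦X⟧) = PowerSeries.C (e : K) := (map_intCast (PowerSeries.C (R := K)) e).symm
      rw [this, coeff_C]
      split_ifs
      exacts [intCast_mem R e, R.zero_mem]
    · rw [coeff_C]
      split_ifs
      exacts [mα, R.zero_mem]
  have hyeq : X ^ (k + 1) * ((e : K⟦X⟧) * y + psEuler y) + p * y = X ^ (k + 1) * g := by
    have h1 := congrFun (congrFun hY ()) ()
    have h2 : PowerSeries.C α * PowerSeries.C α⁻¹ = (1 : K⟦X⟧) := by
      rw [← map_mul, mul_inv_cancel₀ hα0, map_one]
    simp only [Φ, Matrix.smul_apply, Matrix.sub_apply, Matrix.map_apply, smul_eq_mul,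
      Matrix.mul_apply, Finset.univ_unique, Finset.sum_singleton, ← hy] at h1
    have h5 : shiftMat pm () default = shiftMat pm () () := rfl
    have h6 : gm () () = g := rfl
    simp only [h5, h6] at h1
    rw [hpX]
    linear_combination (-PowerSeries.C α) * h1 + (X * (X ^ k * (g - e * y - psEuler y) - shiftMat pm () () * y)) * h2
  refine ⟨tameSingle R₀ e 1 * ⟨y, hyT⟩, Subtype.ext ?_⟩
  have hL := congrArg (fun z : K⟦X⟧ => (z : LaurentSeries K)) hyeq
  simp only [map_add, map_mul, map_pow, map_intCast, PowerSeries.coe_X] at hL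
  rw [← euler_coe] at hL
  change euler (HahnSeries.single e 1 * (y : LaurentSeries K)) +
    a.1 * (HahnSeries.single e 1 * (y : LaurentSeries K)) = f.1
  have hw : (HahnSeries.single (-((k : ℤ) + 1)) (1 : K)) * (HahnSeries.single (1 : ℤ) (1 : K)) ^ (k + 1) = 1 := by
    rw [HahnSeries.single_pow, HahnSeries.single_mul_single]
    simp
  have hse : HahnSeries.single e ((e : K) * 1) = (e : LaurentSeries K) * HahnSeries.single e 1 := by
    have : (e : LaurentSeries K) = HahnSeries.C (e : K) := (map_intCast (HahnSeries.C (Γ := ℤ)) e).symm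
    rw [this, HahnSeries.C_apply, HahnSeries.single_mul_single, zero_add]
  rw [euler_mul, euler_single, hfg, hap, hse]
  linear_combination (HahnSeries.single e (1 : K) * HahnSeries.single (-((k : ℤ) + 1)) (1 : K)) * hL +
    (HahnSeries.single e (1 : K) * ((g : LaurentSeries K) - e * y - euler (y : LaurentSeries K))) * hw

end Scalar

/-! ### Subconnections of rank one after ramification -/

section RankOne

open PowerSeries

variable {K : Type*} [Field K] {R₀ : Set K} {ι κ : Type*} [Fintype ι] [DecidableEq ι]
  [Fintype κ] [DecidableEq κ]

/-- The matrix of a connection after the substitution `w ↦ w ^ μ`; the factor `μ` is the logarithmic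
derivative of `w ^ μ`. -/
def ramMat (μ : ℕ+) (M : Matrix ι κ (Tame R₀)) : Matrix ι κ (Tame R₀) :=
  ((μ : ℕ) : Tame R₀) • M.map (tameRamify R₀ μ)

omit [Fintype ι] [DecidableEq ι] [Fintype κ] [DecidableEq κ] in
theorem ramMat_ramMat (μ μ' : ℕ+) (M : Matrix ι κ (Tame R₀)) :
    ramMat μ' (ramMat μ M) = ramMat (μ' * μ) M := by
  refine Matrix.ext fun i j => ?_
  simp only [ramMat, Matrix.smul_apply, Matrix.map_apply, smul_eq_mul, map_mul, map_natCast,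
    tameRamify_tameRamify]
  push_cast
  ring

omit [Fintype ι] [DecidableEq ι] [Fintype κ] [DecidableEq κ] in
theorem ramMat_one (M : Matrix ι κ (Tame R₀)) : ramMat 1 M = M := by
  refine Matrix.ext fun i j => ?_
  simp only [ramMat, Matrix.smul_apply, Matrix.map_apply, smul_eq_mul]
  rw [PNat.one_coe, Nat.cast_one, one_mul]
  refine Subtype.ext ?_
  ext k
  have := ramify_coeff_mul 1 (M i j).1 k
  simpa using this

omit [DecidableEq ι] [DecidableEq κ] in
theorem IsGauge.ramify {M : Matrix ι ι (Tame R₀)} {G : Matrix ι κ (Tame R₀)}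
    {M' : Matrix κ κ (Tame R₀)} (h : IsGauge (tameEuler R₀) M G M') (μ : ℕ+) :
    IsGauge (tameEuler R₀) (ramMat μ M) (G.map (tameRamify R₀ μ)) (ramMat μ M') := by
  unfold IsGauge at *
  have h1 : (G.map (tameRamify R₀ μ)).map (tameEuler R₀) =
      ((μ : ℕ) : Tame R₀) • (G.map (tameEuler R₀)).map (tameRamify R₀ μ) := by
    refine Matrix.ext fun i j => ?_
    exact tameEuler_ramify μ (G i j)
  rw [h1, ramMat, ramMat, Matrix.smul_mul, Matrix.mul_smul, ← smul_add, ← Matrix.map_mul,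
    ← Matrix.map_mul, ← h, Matrix.map_add _ (map_add _)]

omit [DecidableEq ι] in
theorem HasSub.ramify {M : Matrix ι ι (Tame R₀)} {M' : Matrix κ κ (Tame R₀)}
    (h : HasSub (tameEuler R₀) M M') (μ : ℕ+) :
    HasSub (tameEuler R₀) (ramMat μ M) (ramMat μ M') := by
  obtain ⟨G, G', e, hG⟩ := h
  refine ⟨G.map (tameRamify R₀ μ), G'.map (tameRamify R₀ μ), ?_, hG.ramify μ⟩
  rw [← Matrix.map_mul, e, Matrix.map_one _ (map_zero _) (map_one _)]

/-- After ramification, the connection has a subconnection of rank one. -/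
def RankOne (M : Matrix ι ι (Tame R₀)) : Prop :=
  ∃ (μ : ℕ+) (b : Tame R₀), HasSub (tameEuler R₀) (ramMat μ M) (b • (1 : Matrix Unit Unit (Tame R₀)))

omit [DecidableEq ι] in
theorem RankOne.of_hasSub {M : Matrix ι ι (Tame R₀)} {M' : Matrix κ κ (Tame R₀)}
    (h : HasSub (tameEuler R₀) M M') (h' : RankOne M') : RankOne M := by
  obtain ⟨μ, b, hb⟩ := h'
  exact ⟨μ, b, (h.ramify μ).trans hb⟩

theorem RankOne.twist {M : Matrix ι ι (Tame R₀)} (h : RankOne M) (a : Tame R₀) :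
    RankOne (M + a • 1) := by
  obtain ⟨μ, b, hb⟩ := h
  refine ⟨μ, b + ((μ : ℕ) : Tame R₀) * tameRamify R₀ μ a, ?_⟩
  have := hb.twist (((μ : ℕ) : Tame R₀) * tameRamify R₀ μ a)
  rw [← add_smul] at this
  convert this using 1
  refine Matrix.ext fun i j => ?_
  by_cases h : i = j
  · subst h
    simp [ramMat, mul_add]
  · simp [ramMat, h]

omit [DecidableEq ι] in
theorem RankOne.of_ramMat {M : Matrix ι ι (Tame R₀)} (μ : ℕ+) (h : RankOne (ramMat μ M)) :
    RankOne M := by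
  obtain ⟨μ', b, hb⟩ := h
  rw [ramMat_ramMat] at hb
  exact ⟨_, b, hb⟩

theorem exists_powerSeries_of_coeff_neg {f : LaurentSeries K} (h : ∀ k < 0, f.coeff k = 0) :
    ∃ p : K⟦X⟧, (p : LaurentSeries K) = f ∧ ∀ n : ℕ, coeff n p = f.coeff n := by
  refine ⟨PowerSeries.mk fun n => f.coeff n, ?_, fun n => coeff_mk _ _⟩
  ext i
  rw [PowerSeries.coeff_coe]
  split_ifs with hi
  · exact (h i hi).symm
  · rw [coeff_mk, Int.natAbs_of_nonneg (not_lt.1 hi)]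

/-- A nonzero vector `h` with `(θ + M) h = b h` spans a subconnection of rank one. -/
theorem hasSub_of_eigenvector {F : Type*} [Field F] {θ : AddDer F} {M : Matrix ι ι F} {h : ι → F}
    (h0 : h ≠ 0) {b : F} (hb : ∀ i, θ (h i) + ∑ j, M i j * h j = b * h i) :
    HasSub θ M (b • (1 : Matrix Unit Unit F)) := by
  obtain ⟨i₀, hi₀⟩ := Function.ne_iff.1 h0
  refine ⟨Matrix.of fun i _ => h i, Matrix.of fun _ j => if j = i₀ then (h i₀)⁻¹ else 0, ?_, ?_⟩
  · ext i j
    simp only [Matrix.mul_apply, Matrix.of_apply, ite_mul, zero_mul, Finset.sum_ite_eq',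
      Finset.mem_univ, if_true]
    rw [inv_mul_cancel₀ hi₀]
    simp
  · ext i j
    have := hb i
    simp only [Matrix.add_apply, Matrix.map_apply, Matrix.of_apply, Matrix.mul_apply,
      Matrix.smul_apply, smul_eq_mul, Finset.univ_unique, Finset.sum_singleton]
    rw [this]
    simp [mul_comm]

/-- A connection without poles has a subconnection of rank one with constant matrix. -/
theorem exists_hasSub_of_integral [IsAlgClosed K] [CharZero K] [Nonempty ι]
    {M : Matrix ι ι (Tame R₀)} (hM : ∀ i j, ∀ k < 0, (M i j).1.coeff k = 0) :
    ∃ b : K, HasSub (tameEuler R₀) M (tameC R₀ b • (1 : Matrix Unit Unit (Tame R₀))) := by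
  choose p hp _ using fun i j => exists_powerSeries_of_coeff_neg (hM i j)
  obtain ⟨b, h, h0, hT, hb⟩ := exists_regular_solution (R₀ := R₀) (Matrix.of p) fun i j => by
    rw [mem_tamePS, Matrix.of_apply, hp]
    exact (M i j).2
  refine ⟨b, hasSub_of_eigenvector (h := fun i => ⟨(h i : LaurentSeries K), hT i⟩) ?_ fun i => ?_⟩
  · intro h1
    apply h0
    ext1 i
    have := congrArg Subtype.val (congrFun h1 i)
    exact HahnSeries.ofPowerSeries_injective (this.trans (map_zero _).symm)
  · refine Subtype.ext ?_
    have := congrArg (fun z : K⟦X⟧ => (z : LaurentSeries K)) (hb i)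
    simp only [map_add, map_mul, map_sum, ← euler_coe, Matrix.of_apply, hp, PowerSeries.coe_C] at this
    refine Eq.trans ?_ this
    rw [Subfield.coe_add, AddSubmonoidClass.coe_finsetSum]
    rfl

/-- A nilpotent companion matrix has vanishing last column. -/
theorem companion_nilpotent {t : ℕ} {c : Fin (t + 1) → K} (h : IsNilpotent (companion c)) :
    c = 0 := by
  have hpow : companion c ^ (t + 1) = 0 := by
    have h1 : IsNilpotent (Matrix.toLinAlgEquiv' (companion c)) :=
      h.map (Matrix.toLinAlgEquiv' (R := K) (n := Fin (t + 1)))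
    have h2 := LinearMap.aeval_self_charpoly (Matrix.toLinAlgEquiv' (companion c))
    rw [h1.charpoly_eq_X_pow_finrank, map_pow, Polynomial.aeval_X, Module.finrank_fin_fun] at h2
    exact (Matrix.toLinAlgEquiv' (R := K) (n := Fin (t + 1))).injective
      ((map_pow _ _ _).trans (h2.trans (map_zero _).symm))
  have he : ∀ j : ℕ, ∀ hj : j < t + 1, (companion c ^ j).mulVec (Pi.single 0 1) =
      Pi.single (⟨j, hj⟩ : Fin (t + 1)) 1 := by
    intro j
    induction j with
    | zero =>
      intro hj
      rw [pow_zero, Matrix.one_mulVec]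
      rfl
    | succ j ih =>
      intro hj
      rw [pow_succ', ← Matrix.mulVec_mulVec, ih (by omega), Matrix.mulVec_single_one]
      ext i
      have hne : (⟨j, by omega⟩ : Fin (t + 1)) ≠ Fin.last t := by
        intro h0
        have := congrArg Fin.val h0
        simp at this
        omega
      rw [Matrix.col_apply, companion, Matrix.of_apply, if_neg hne, Pi.single_apply]
      simp only [Fin.ext_iff]
  have h1 : (companion c ^ (t + 1)).mulVec (Pi.single 0 1) = c := by
    rw [pow_succ', ← Matrix.mulVec_mulVec, he t (Nat.lt_succ_self t), Matrix.mulVec_single_one]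
    ext i
    rw [Matrix.col_apply, companion, Matrix.of_apply, if_pos]
    rfl
  rw [← h1, hpow, Matrix.zero_mulVec]

/-- A traceless companion matrix that is not nilpotent has two distinct eigenvalues. -/
theorem exists_proper_eigenvalue [IsAlgClosed K] [CharZero K] {t : ℕ} {c : Fin (t + 1) → K}
    (hc : c (Fin.last t) = 0) (hc0 : c ≠ 0) {r : K} (hr : r ≠ 0) :
    ∃ x : K, ¬ IsUnit (r • companion c - x • 1) ∧ ¬ IsNilpotent (r • companion c - x • 1) := by
  have hdeg : (r • companion c).charpoly.degree ≠ 0 := by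
    rw [Matrix.charpoly_degree_eq_dim]
    simp
    exact_mod_cast Nat.succ_ne_zero t
  obtain ⟨x, hx⟩ := IsAlgClosed.exists_root _ hdeg
  have htr : (companion c).trace = 0 := by
    refine Finset.sum_eq_zero fun i _ => ?_
    rw [Matrix.diag_apply, companion, Matrix.of_apply]
    split_ifs with h h'
    · rw [h, hc]
    · omega
    · rfl
  refine ⟨x, ?_, fun hn => ?_⟩
  · rw [Matrix.isUnit_iff_isUnit_det, isUnit_iff_ne_zero, not_not]
    rw [Polynomial.IsRoot, Matrix.eval_charpoly] at hx
    rw [← neg_sub, Matrix.det_neg, Matrix.smul_one_eq_diagonal]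
    rw [Matrix.scalar_apply] at hx
    rw [hx, mul_zero]
  · have h1 := (Matrix.isNilpotent_trace_of_isNilpotent hn).eq_zero
    rw [Matrix.trace_sub, Matrix.trace_smul, Matrix.trace_smul, htr, Matrix.trace_one, smul_zero,
      zero_sub, neg_eq_zero, smul_eq_mul, mul_eq_zero, Fintype.card_fin] at h1
    have hx0 : x = 0 := h1.resolve_right (by exact_mod_cast Nat.succ_ne_zero t)
    rw [hx0, zero_smul, sub_zero] at hn
    refine hc0 (companion_nilpotent ?_)
    have := hn.smul r⁻¹
    rwa [smul_smul, inv_mul_cancel₀ hr, one_smul] at this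

/-- The gauge transformation by `Diag(w^(k j))`. -/
theorem hasSub_shear {s : ℕ} (M : Matrix (Fin s) (Fin s) (Tame R₀)) (k : ℤ) :
    HasSub (tameEuler R₀) M (Matrix.of fun (i j : Fin s) =>
      tameSingle R₀ (k * ((j : ℤ) - i)) 1 * M i j +
        if i = j then tameC R₀ ((k * (j : ℤ) : ℤ) : K) else 0) := by
  have hmul : ∀ a b : ℤ, tameSingle R₀ a 1 * tameSingle R₀ b 1 = tameSingle R₀ (a + b) (1 : K) :=
    fun a b => by rw [tameSingle_mul, one_mul]
  refine ⟨Matrix.diagonal fun j => tameSingle R₀ (k * (j : ℕ)) 1,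
    Matrix.diagonal fun j => tameSingle R₀ (-(k * (j : ℕ))) 1, ?_, ?_⟩
  · rw [Matrix.diagonal_mul_diagonal, ← Matrix.diagonal_one]
    congr 1
    ext j : 1
    rw [hmul, neg_add_cancel]
    rfl
  · refine Matrix.ext fun i j => ?_
    rw [Matrix.add_apply, Matrix.map_apply, Matrix.mul_diagonal, Matrix.diagonal_mul, Matrix.of_apply,
      mul_add, ← mul_assoc, hmul, add_comm]
    congr 1
    · rw [mul_comm]
      congr 2
      ring
    · rw [Matrix.diagonal_apply]
      split_ifs with h
      · subst h
        rw [tameEuler_single, ← tameSingle_zero_exp, tameSingle_mul, add_zero, one_mul, mul_one]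
      · rw [map_zero, mul_zero]

/-- An index `i₀` for which the pole order of `c i` divided by `t + 1 - i` is maximal: this quotient is
the steepest slope of the Newton polygon of the cyclic equation with coefficients `c`. -/
theorem exists_pole_ratio {t : ℕ} (c : Fin (t + 1) → LaurentSeries K)
    (hneg : ∃ i, ∃ k < 0, (c i).coeff k ≠ 0) :
    ∃ i₀, (c i₀).order < 0 ∧ c i₀ ≠ 0 ∧ ∀ i : Fin (t + 1), ∀ n : ℤ,
      ((t : ℤ) + 1 - i₀) * n < (t + 1 - i) * (c i₀).order → (c i).coeff n = 0 := by
  classical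
  let val : Fin (t + 1) → ℚ := fun i =>
    if c i = 0 then 0 else (-(c i).order : ℤ) / ((t : ℤ) + 1 - i : ℤ)
  have hpos : ∀ i : Fin (t + 1), (0 : ℚ) < ((t : ℤ) + 1 - i : ℤ) := fun i => by
    have := i.2
    exact_mod_cast (by omega : (0 : ℤ) < (t : ℤ) + 1 - i)
  obtain ⟨i₀, -, hmax⟩ := Finset.exists_max_image Finset.univ val Finset.univ_nonempty
  have hi₀ : 0 < val i₀ := by
    obtain ⟨i, k, hk, hik⟩ := hneg
    refine lt_of_lt_of_le ?_ (hmax i (Finset.mem_univ i))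
    have h0 : c i ≠ 0 := by rintro h; simp [h] at hik
    have h1 : (c i).order ≤ k := HahnSeries.order_le_of_coeff_ne_zero hik
    simp only [val, if_neg h0]
    refine div_pos ?_ (hpos i)
    exact_mod_cast (by omega : (0 : ℤ) < -(c i).order)
  have hc0 : c i₀ ≠ 0 := fun h => by simp [val, h] at hi₀
  simp only [val, if_neg hc0] at hi₀
  have hord : (c i₀).order < 0 := by
    have := (div_pos_iff_of_pos_right (hpos i₀)).1 hi₀
    have h2 : (0 : ℤ) < -(c i₀).order := by exact_mod_cast this
    omega
  refine ⟨i₀, hord, hc0, fun i n hn => ?_⟩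
  by_contra hne
  have h0 : c i ≠ 0 := by rintro h; simp [h] at hne
  have h1 : (c i).order ≤ n := HahnSeries.order_le_of_coeff_ne_zero hne
  have h2 := hmax i (Finset.mem_univ i)
  simp only [val, if_neg h0, if_neg hc0] at h2
  rw [div_le_div_iff₀ (hpos i) (hpos i₀)] at h2
  have h3 : (-(c i).order) * ((t : ℤ) + 1 - i₀) ≤ (-(c i₀).order) * ((t : ℤ) + 1 - i) := by
    exact_mod_cast h2
  have h4 : (0 : ℤ) < (t : ℤ) + 1 - i₀ := by exact_mod_cast hpos i₀
  nlinarith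

theorem coeff_tameSingle_mul (e n : ℤ) (f : Tame R₀) :
    (tameSingle R₀ e 1 * f).1.coeff n = f.1.coeff (n - e) := by
  change (HahnSeries.single e 1 * f.1).coeff n = _
  rw [HahnSeries.coeff_single_mul, one_mul]

/-- A traceless cyclic connection with an irregular singularity has a proper subconnection after
ramification. -/
theorem exists_hasSub_of_pole [IsAlgClosed K] [CharZero K] {t : ℕ} (c : Fin (t + 1) → Tame R₀)
    (hc : c (Fin.last t) = 0) (hneg : ∃ i, ∃ k < 0, (c i).1.coeff k ≠ 0) :
    ∃ (μ : ℕ+) (p : ℕ) (M' : Matrix (Fin p) (Fin p) (Tame R₀)), 0 < p ∧ p < t + 1 ∧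
      HasSub (tameEuler R₀) (ramMat μ (companion c)) M' := by
  obtain ⟨i₀, hord, hci₀, hval⟩ := exists_pole_ratio (fun i => (c i).1) hneg
  obtain ⟨k, hk⟩ : ∃ k : ℕ, (c i₀).1.order = -((k : ℤ) + 1) :=
    ⟨(-(c i₀).1.order - 1).toNat, by omega⟩
  simp only [hk] at hval
  have hi₀t : (i₀ : ℕ) < t + 1 := i₀.2
  -- ramification making the slope an integer
  obtain ⟨μ, hμ⟩ : ∃ μ : ℕ+, (μ : ℕ) = t + 1 - i₀ := ⟨⟨t + 1 - i₀, by omega⟩, rfl⟩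
  have hμ' : ((μ : ℕ) : ℤ) = t + 1 - i₀ := by omega
  have hμ0 : ((μ : ℕ) : K) ≠ 0 := Nat.cast_ne_zero.2 μ.ne_zero
  set κ : ℤ := k + 1 with hκ
  have hram : ∀ i : Fin (t + 1), ∀ n : ℤ, n < -κ * (t + 1 - i) → (ramify K μ (c i).1).coeff n = 0 := by
    intro i n hn
    by_cases hd : ((μ : ℕ) : ℤ) ∣ n
    · obtain ⟨l, rfl⟩ := hd
      rw [ramify_coeff_mul]
      refine hval i l ?_
      rw [← hμ']
      linarith
    · exact ramify_coeff_of_not_dvd _ _ hd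
  set M₁ := ramMat μ (companion c) with hM₁
  set M₂ : Matrix (Fin (t + 1)) (Fin (t + 1)) (Tame R₀) := Matrix.of fun (i j : Fin (t + 1)) =>
      tameSingle R₀ (κ * ((j : ℤ) - i)) 1 * M₁ i j +
        if i = j then tameC R₀ ((κ * (j : ℤ) : ℤ) : K) else 0 with hM₂
  have hsub : HasSub (tameEuler R₀) M₁ M₂ := hasSub_shear M₁ κ
  have hnat : ∀ (f : LaurentSeries K) (n : ℤ), (((μ : ℕ) : LaurentSeries K) * f).coeff n =
      (μ : ℕ) * f.coeff n := fun f n => by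
    rw [← nsmul_eq_mul, HahnSeries.coeff_smul, nsmul_eq_mul]
  have hcoeff : ∀ i j : Fin (t + 1), ∀ n ≤ 0, (tameSingle R₀ κ 1 * M₂ i j).1.coeff n =
      (μ : ℕ) * (ramify K μ (companion c i j).1).coeff (n - κ * (j + 1 - i)) := by
    intro i j n hn
    rw [hM₂, Matrix.of_apply, mul_add, ← mul_assoc, tameSingle_mul, one_mul, Subfield.coe_add,
      HahnSeries.coeff_add, coeff_tameSingle_mul, hM₁]
    have h0 : (tameSingle R₀ κ (1 : K) *
        if i = j then tameC R₀ ((κ * (j : ℤ) : ℤ) : K) else 0).1.coeff n = 0 := by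
      rw [coeff_tameSingle_mul]
      split_ifs
      · exact HahnSeries.coeff_single_of_ne (by omega)
      · simp
    rw [h0, add_zero]
    refine (hnat _ _).trans ?_
    congr 2
    ring
  -- the entries of `w^κ M₂` are integral, with constant terms forming a companion matrix
  have hneg' : ∀ i j : Fin (t + 1), ∀ n < 0, (tameSingle R₀ κ 1 * M₂ i j).1.coeff n = 0 := by
    intro i j n hn
    rw [hcoeff i j n hn.le]
    by_cases hj : j = Fin.last t
    · subst hj
      rw [companion, Matrix.of_apply, if_pos rfl, hram, mul_zero]
      simp only [Fin.val_last]
      linarith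
    · rw [companion, Matrix.of_apply, if_neg hj]
      split_ifs with h
      · rw [h, show (1 : Tame R₀).1 = 1 from rfl, map_one]
        push_cast
        rw [sub_self, mul_zero, sub_zero, HahnSeries.coeff_one, if_neg hn.ne, mul_zero]
      · rw [show (0 : Tame R₀).1 = 0 from rfl, map_zero, HahnSeries.coeff_zero, mul_zero]
  choose C hC hC' using fun i j => exists_powerSeries_of_coeff_neg (hneg' i j)
  set γ : Fin (t + 1) → K := fun i => (ramify K μ (c i).1).coeff (-κ * (t + 1 - i)) with hγ
  have hC₀ : (Matrix.of C).map (constantCoeff (R := K)) = ((μ : ℕ) : K) • companion γ := by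
    ext i j
    rw [Matrix.map_apply, Matrix.of_apply, ← coeff_zero_eq_constantCoeff_apply, hC', Nat.cast_zero,
      hcoeff i j 0 le_rfl, Matrix.smul_apply, smul_eq_mul]
    congr 1
    by_cases hj : j = Fin.last t
    · subst hj
      simp only [companion, Matrix.of_apply, if_true, hγ, Fin.val_last]
      congr 1
      ring
    · simp only [companion, Matrix.of_apply, if_neg hj]
      split_ifs with h
      · rw [h, show (1 : Tame R₀).1 = 1 from rfl, map_one]
        push_cast
        rw [sub_self, mul_zero, sub_zero, HahnSeries.coeff_one, if_pos rfl]
      · rw [show (0 : Tame R₀).1 = 0 from rfl, map_zero, HahnSeries.coeff_zero]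
  have hγ0 : γ ≠ 0 := by
    intro h0
    have h1 := congrFun h0 i₀
    simp only [hγ, Pi.zero_apply] at h1
    rw [← hμ', mul_comm, ramify_coeff_mul, hκ, ← hk, HahnSeries.coeff_order_eq_zero] at h1
    exact hci₀ h1
  have hγl : γ (Fin.last t) = 0 := by
    simp only [hγ, hc]
    rw [show (0 : Tame R₀).1 = 0 from rfl, map_zero, HahnSeries.coeff_zero]
  obtain ⟨x, hx, hx'⟩ := exists_proper_eigenvalue hγl hγ0 hμ0
  rw [← hC₀] at hx hx'
  obtain ⟨p, M', hp0, hp, hM'⟩ := exists_hasSub_of_split M₂ (Matrix.of C) k hC x hx hx'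
  rw [Fintype.card_fin] at hp
  exact ⟨μ, p, M', hp0, hp, hsub.trans hM'⟩

/-- After ramification, every connection of positive rank has a subconnection of rank one. -/
theorem rankOne [IsAlgClosed K] [CharZero K] (n : ℕ) (hn : 0 < n)
    (M : Matrix (Fin n) (Fin n) (Tame R₀)) : RankOne M := by
  induction n using Nat.strong_induction_on with
  | _ n ih =>
    have : CharZero (Tame R₀) := charZero_of_injective_ringHom (tameC R₀).injective
    have : Nonempty (Fin n) := ⟨⟨0, hn⟩⟩
    obtain ⟨t, a, c, hc, hsub, ht⟩ := exists_hasSub_companion (tameEuler R₀) M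
    rw [Fintype.card_fin] at ht
    refine RankOne.of_hasSub hsub (RankOne.twist ?_ a)
    by_cases hneg : ∃ i, ∃ k < 0, (c i).1.coeff k ≠ 0
    · obtain ⟨μ, p, M', hp0, hp, hM'⟩ := exists_hasSub_of_pole c hc hneg
      exact RankOne.of_ramMat μ (RankOne.of_hasSub hM' (ih p (by omega) hp0 M'))
    · push Not at hneg
      obtain ⟨b, hb⟩ := exists_hasSub_of_integral (M := companion c) fun i j k hk => by
        rw [companion, Matrix.of_apply]
        split_ifs
        · exact hneg i k hk
        · exact HahnSeries.coeff_single_of_ne hk.ne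
        · rfl
      exact ⟨1, tameC R₀ b, by rwa [ramMat_one]⟩

end RankOne

/-! ### Block triangular matrices -/

section Block

variable {F : Type*} [CommRing F] {m : ℕ}

/-- The block triangular matrix with rows `(b, c)` and `(0, S)`. -/
def blk (b : F) (c : Fin m → F) (S : Matrix (Fin m) (Fin m) F) :
    Matrix (Fin (m + 1)) (Fin (m + 1)) F :=
  Matrix.of (Fin.cons (Fin.cons b c) fun i => Fin.cons 0 (S i))

@[simp] theorem blk_zero_zero (b : F) (c : Fin m → F) (S : Matrix (Fin m) (Fin m) F) :
    blk b c S 0 0 = b := rfl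

@[simp] theorem blk_zero_succ (b : F) (c : Fin m → F) (S : Matrix (Fin m) (Fin m) F) (j : Fin m) :
    blk b c S 0 j.succ = c j := rfl

@[simp] theorem blk_succ_zero (b : F) (c : Fin m → F) (S : Matrix (Fin m) (Fin m) F) (i : Fin m) :
    blk b c S i.succ 0 = 0 := rfl

@[simp] theorem blk_succ_succ (b : F) (c : Fin m → F) (S : Matrix (Fin m) (Fin m) F) (i j : Fin m) :
    blk b c S i.succ j.succ = S i j := rfl

theorem matrix_succ_ext {F : Type*} {A B : Matrix (Fin (m + 1)) (Fin (m + 1)) F} (h₀ : A 0 0 = B 0 0)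
    (h₁ : ∀ j : Fin m, A 0 j.succ = B 0 j.succ) (h₂ : ∀ i : Fin m, A i.succ 0 = B i.succ 0)
    (h₃ : ∀ i j : Fin m, A i.succ j.succ = B i.succ j.succ) : A = B := by
  refine Matrix.ext fun i j => ?_
  refine Fin.cases ?_ (fun i => ?_) i <;> refine Fin.cases ?_ (fun j => ?_) j
  exacts [h₀, h₁ j, h₂ i, h₃ i j]

theorem blk_mul (b b' : F) (c c' : Fin m → F) (S S' : Matrix (Fin m) (Fin m) F) :
    blk b c S * blk b' c' S' = blk (b * b') (b • c' + Matrix.vecMul c S') (S * S') := by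
  apply matrix_succ_ext <;> intros <;>
    simp [Matrix.mul_apply, Fin.sum_univ_succ, Matrix.vecMul, dotProduct]

theorem blk_add (b b' : F) (c c' : Fin m → F) (S S' : Matrix (Fin m) (Fin m) F) :
    blk b c S + blk b' c' S' = blk (b + b') (c + c') (S + S') := by
  apply matrix_succ_ext <;> intros <;> simp

theorem blk_one : blk 1 0 1 = (1 : Matrix (Fin (m + 1)) (Fin (m + 1)) F) := by
  apply matrix_succ_ext
  · simp
  · intro j; simp [Matrix.one_apply_ne (Fin.succ_ne_zero j).symm]
  · intro i; simp [Matrix.one_apply_ne (Fin.succ_ne_zero i)]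
  · intro i j; simp [Matrix.one_apply]

theorem blk_map (θ : AddDer F) (b : F) (c : Fin m → F) (S : Matrix (Fin m) (Fin m) F) :
    (blk b c S).map θ = blk (θ b) (fun j => θ (c j)) (S.map θ) := by
  apply matrix_succ_ext <;> intros <;> simp

theorem eq_blk (A : Matrix (Fin (m + 1)) (Fin (m + 1)) F) (h : ∀ i : Fin m, A i.succ 0 = 0) :
    A = blk (A 0 0) (fun j => A 0 j.succ) (A.submatrix Fin.succ Fin.succ) := by
  apply matrix_succ_ext <;> intros <;> simp [h]

/-- A gauge transformation by the block diagonal matrix with blocks `g` and `H`. -/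
theorem isGauge_blk_diag {θ : AddDer F} {b b' g g' : F} (hg : θ g + b * g = b' * g)
    (hg' : g * g' = 1) (c : Fin m → F) {S H S' : Matrix (Fin m) (Fin m) F} (hH : IsGauge θ S H S') :
    IsGauge θ (blk b c S) (blk g 0 H) (blk b' (g' • Matrix.vecMul c H) S') := by
  unfold IsGauge at *
  rw [blk_map, blk_mul, blk_mul, blk_add, hg, hH, smul_smul, hg', one_smul]
  congr 1
  · ring
  · ext j; simp

/-- A gauge transformation by a unipotent block triangular matrix. -/
theorem isGauge_blk_unipotent {θ : AddDer F} {b : F} {c c' u : Fin m → F}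
    {S : Matrix (Fin m) (Fin m) F}
    (h : ∀ j, θ (u j) + b * u j + c j = c' j + Matrix.vecMul u S j) :
    IsGauge θ (blk b c S) (blk 1 u 1) (blk b c' S) := by
  unfold IsGauge
  rw [blk_map, blk_mul, blk_mul, blk_add, θ.map_one, θ.map_matrix_one]
  congr 1
  · ring
  · ext j
    simpa [add_assoc] using h j
  · simp

/-- A nonzero vector is the first column of an invertible matrix. -/
theorem exists_invertible_first_column {F : Type*} [Field F] (h : Fin (m + 1) → F) (h0 : h ≠ 0) :
    ∃ H H' : Matrix (Fin (m + 1)) (Fin (m + 1)) F, H * H' = 1 ∧ H' * H = 1 ∧ ∀ i, H i 0 = h i := by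
  obtain ⟨j₀, hj₀⟩ := Function.ne_iff.1 h0
  set H := ((1 : Matrix (Fin (m + 1)) (Fin (m + 1)) F).updateCol j₀ h).submatrix id
    (Equiv.swap 0 j₀) with hH
  have hdet : IsUnit H.det := by
    rw [hH, Matrix.det_permute', ← Matrix.cramer_apply, Matrix.cramer_one]
    refine IsUnit.mul ?_ (isUnit_iff_ne_zero.2 hj₀)
    exact ((Equiv.Perm.sign (Equiv.swap 0 j₀)).isUnit).map (Int.castRingHom F)
  refine ⟨H, H⁻¹, Matrix.mul_nonsing_inv H hdet, Matrix.nonsing_inv_mul H hdet, fun i => ?_⟩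
  simp [hH]

end Block

/-! ### The normal form of a connection -/

section NormalForm

variable {K : Type*} [Field K] {R₀ : Set K}

/-- A Laurent series without terms of positive degree. -/
def NoPos (f : Tame R₀) : Prop := ∀ k > 0, f.1.coeff k = 0

theorem NoPos.sub {f g : Tame R₀} (hf : NoPos f) (hg : NoPos g) : NoPos (f - g) := fun k hk => by
  change (f.1 - g.1).coeff k = 0
  rw [HahnSeries.coeff_sub, hf k hk, hg k hk, sub_zero]

/-- The equation `θ u + e u = f` is solvable up to a constant, which is needed only if `e = 0`. -/
theorem exists_solution_scalar [CharZero K] (e : Tame R₀) (he : NoPos e)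
    (hint : ∀ n : ℤ, e = tameC R₀ n → e = 0) (f : Tame R₀) :
    ∃ (u : Tame R₀) (c : K), tameEuler R₀ u + e * u = f + tameC R₀ c ∧ (c ≠ 0 → e = 0) := by
  by_cases hord : e.1.order < 0
  · obtain ⟨u, hu⟩ := exists_solution_pole e hord f
    exact ⟨u, 0, by rw [hu, map_zero, add_zero], fun h => absurd rfl h⟩
  have heC : e = tameC R₀ (e.1.coeff 0) := by
    refine Subtype.ext ?_
    ext k
    rw [coe_tameC, HahnSeries.C_apply]
    rcases lt_trichotomy k 0 with hk | rfl | hk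
    · rw [HahnSeries.coeff_single_of_ne hk.ne]
      exact HahnSeries.coeff_eq_zero_of_lt_order (by omega)
    · rw [HahnSeries.coeff_single_same]
    · rw [HahnSeries.coeff_single_of_ne hk.ne', he k hk]
  by_cases he0 : e = 0
  · obtain ⟨u, c, hu⟩ := exists_solution_zero f
    exact ⟨u, -c, by rw [hu, he0, zero_mul, add_zero, map_neg, sub_eq_add_neg], fun _ => he0⟩
  · obtain ⟨u, hu⟩ := exists_solution_const (e.1.coeff 0) (fun n hn => he0 (hint n (by rw [← hn, ← heC]))) f
    exact ⟨u, 0, by rw [heC, hu, map_zero, add_zero], fun h => absurd rfl h⟩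

/-- A triangular system of scalar equations is solvable up to constants. -/
theorem exists_solution_row [CharZero K] {m : ℕ} (e f : Fin m → Tame R₀) (he : ∀ j, NoPos (e j))
    (hint : ∀ j, ∀ n : ℤ, e j = tameC R₀ n → e j = 0) (N : Matrix (Fin m) (Fin m) K)
    (hN : ∀ i j, N i j ≠ 0 → i < j) :
    ∃ (u : Fin m → Tame R₀) (c : Fin m → K), (∀ j, tameEuler R₀ (u j) + e j * u j + f j =
      tameC R₀ (c j) + Matrix.vecMul u (N.map (tameC R₀)) j) ∧ ∀ j, c j ≠ 0 → e j = 0 := by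
  suffices h : ∀ k ≤ m, ∃ (u : Fin m → Tame R₀) (c : Fin m → K), ∀ j : Fin m, (j : ℕ) < k →
      (tameEuler R₀ (u j) + e j * u j + f j =
        tameC R₀ (c j) + Matrix.vecMul u (N.map (tameC R₀)) j) ∧ (c j ≠ 0 → e j = 0) by
    obtain ⟨u, c, h⟩ := h m le_rfl
    exact ⟨u, c, fun j => (h j j.2).1, fun j => (h j j.2).2⟩
  intro k
  induction k with
  | zero => exact fun _ => ⟨0, 0, fun j hj => absurd hj (Nat.not_lt_zero _)⟩
  | succ k ih =>
    intro hk
    obtain ⟨u, c, h⟩ := ih (by omega)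
    set j₀ : Fin m := ⟨k, hk⟩ with hj₀
    obtain ⟨x, y, hxy, hy⟩ := exists_solution_scalar (e j₀) (he j₀) (hint j₀)
      (Matrix.vecMul u (N.map (tameC R₀)) j₀ - f j₀)
    -- the equations up to `j₀` do not involve the unknowns from `j₀` on
    have hvec : ∀ j : Fin m, (j : ℕ) ≤ k → Matrix.vecMul (Function.update u j₀ x)
        (N.map (tameC R₀)) j = Matrix.vecMul u (N.map (tameC R₀)) j := by
      intro j hj
      simp only [Matrix.vecMul, dotProduct, Matrix.map_apply]
      refine Finset.sum_congr rfl fun i _ => ?_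
      by_cases hi : i = j₀
      · have : N i j = 0 := by
          by_contra hne
          have h1 : (i : ℕ) < j := hN i j hne
          rw [hi] at h1
          simp only [hj₀] at h1
          omega
        rw [this, map_zero, mul_zero, mul_zero]
      · rw [Function.update_of_ne hi]
    refine ⟨Function.update u j₀ x, Function.update c j₀ y, fun j hj => ?_⟩
    rw [hvec j (by omega)]
    by_cases hjj : j = j₀
    · subst hjj
      rw [Function.update_self, Function.update_self]
      exact ⟨by rw [hxy]; ring, hy⟩
    · rw [Function.update_of_ne hjj, Function.update_of_ne hjj]
      refine h j ?_
      have : (j : ℕ) ≠ k := fun h => hjj (Fin.ext h)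
      omega

theorem neg_part_mem_tame {f : LaurentSeries K} (hf : f ∈ Tame R₀) :
    ∃ g ∈ Tame R₀, (∀ k < 0, g.coeff k = f.coeff k) ∧ ∀ k ≥ 0, g.coeff k = 0 := by
  classical
  refine ⟨⟨fun k => if k < 0 then f.coeff k else 0, f.isPWO_support.mono fun k hk h0 => hk ?_⟩,
    ?_, ?_, ?_⟩
  · simp only [h0, ite_self]
  · rw [mem_tame] at *
    filter_upwards [hf] with R hR k
    change (if k < 0 then f.coeff k else 0) ∈ R
    split_ifs
    exacts [hR k, R.zero_mem]
  · intro k hk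
    exact if_pos hk
  · intro k hk
    exact if_neg (not_lt.2 hk)

/-- A scalar connection is equivalent to one without terms of positive degree; the constant term
can be shifted by any integer. -/
theorem exists_scalar_normal_form [IsAlgClosed K] [CharZero K] (b : Tame R₀) :
    ∃ b' : Tame R₀, NoPos b' ∧ ∀ n : ℤ, ∃ g : Tame R₀, g ≠ 0 ∧
      tameEuler R₀ g + b * g = (b' + tameC R₀ n) * g := by
  obtain ⟨r, hrT, hr, hr'⟩ := neg_part_mem_tame b.2
  set r' : Tame R₀ := ⟨r, hrT⟩ with hr'_def
  obtain ⟨β, G, G', hG', hG⟩ := exists_hasSub_of_integral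
    (M := (b - r') • (1 : Matrix Unit Unit (Tame R₀))) fun i j k hk => by
      have : ((b - r') • (1 : Matrix Unit Unit (Tame R₀))) i j = b - r' := by simp
      rw [this]
      change (b.1 - r).coeff k = 0
      rw [HahnSeries.coeff_sub, hr k hk, sub_self]
  set g := G () () with hg
  have hg0 : g ≠ 0 := by
    intro h0
    have := congrFun (congrFun hG' ()) ()
    simp only [Matrix.mul_apply, Finset.univ_unique, Finset.sum_singleton, Matrix.one_apply_eq] at this
    change G' () () * g = 1 at this
    rw [h0, mul_zero] at this
    exact zero_ne_one this
  have hgeq : tameEuler R₀ g + (b - r') * g = tameC R₀ β * g := by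
    have := congrFun (congrFun hG ()) ()
    simp only [Matrix.add_apply, Matrix.map_apply, Matrix.smul_mul, Matrix.mul_smul, Matrix.one_mul,
      Matrix.mul_one, Matrix.smul_apply, smul_eq_mul] at this
    exact this
  refine ⟨r' + tameC R₀ β, fun k hk => ?_, fun n => ⟨tameSingle R₀ n 1 * g, ?_, ?_⟩⟩
  · change (r + HahnSeries.C β).coeff k = 0
    rw [HahnSeries.coeff_add, hr' k hk.le, HahnSeries.C_apply, HahnSeries.coeff_single_of_ne hk.ne',
      add_zero]
  · refine mul_ne_zero (fun h => ?_) hg0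
    have := congrArg (fun x : Tame R₀ => x.1.coeff n) h
    simp at this
  · have hn : tameSingle R₀ n ((n : K) * 1) = tameC R₀ n * tameSingle R₀ n 1 := by
      rw [← tameSingle_zero_exp, tameSingle_mul, zero_add]
    rw [AddDer.leibniz, tameEuler_single, hn]
    linear_combination (tameSingle R₀ n 1) * hgeq

/-- The formal normal form: after ramification, every connection is equivalent to
`θ + Diag(d) + N` with Laurent polynomials `d i` in `w⁻¹` that do not differ by nonzero integers,
and a strictly upper triangular constant matrix `N` commuting with `Diag(d)`. -/
theorem exists_normal_form [IsAlgClosed K] [CharZero K] (m : ℕ)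
    (M : Matrix (Fin m) (Fin m) (Tame R₀)) :
    ∃ (μ : ℕ+) (H H' : Matrix (Fin m) (Fin m) (Tame R₀)) (d : Fin m → Tame R₀)
      (N : Matrix (Fin m) (Fin m) K), H * H' = 1 ∧ H' * H = 1 ∧
      IsGauge (tameEuler R₀) (ramMat μ M) H (Matrix.diagonal d + N.map (tameC R₀)) ∧
      (∀ i j, N i j ≠ 0 → i < j ∧ d i = d j) ∧
      (∀ i j, ∀ n : ℤ, d i - d j = tameC R₀ n → d i = d j) ∧ ∀ i, NoPos (d i) := by
  induction m with
  | zero => exact ⟨1, 1, 1, 0, 0, by simp, by simp, Matrix.ext fun i => i.elim0, fun i => i.elim0,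
      fun i => i.elim0, fun i => i.elim0⟩
  | succ m ih =>
    obtain ⟨μ₀, b₀, G, G', hG', hG⟩ := rankOne (m + 1) (Nat.succ_pos m) M
    set h : Fin (m + 1) → Tame R₀ := fun i => G i () with hh
    have hh0 : h ≠ 0 := by
      intro h0
      have h1 := congrFun (congrFun hG' ()) ()
      rw [Matrix.mul_apply, Finset.sum_eq_zero fun i _ => by
        rw [show G i () = 0 from congrFun h0 i, mul_zero]] at h1
      simp at h1
    -- a basis starting with a generator of the subconnection makes the first column zero below `b₀`
    obtain ⟨H₀, H₀', hHH, hHH', hcol⟩ := exists_invertible_first_column h hh0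
    set M₁ := H₀' * (H₀.map (tameEuler R₀) + ramMat μ₀ M * H₀) with hM₁
    have hg₀ : IsGauge (tameEuler R₀) (ramMat μ₀ M) H₀ M₁ := by
      unfold IsGauge
      rw [hM₁, ← Matrix.mul_assoc, hHH, Matrix.one_mul]
    have hM₁col : ∀ i, M₁ i 0 = if i = 0 then b₀ else 0 := by
      intro i
      have h1 : ∀ l, (H₀.map (tameEuler R₀) + ramMat μ₀ M * H₀) l 0 = b₀ * H₀ l 0 := by
        intro l
        have h2 := congrFun (congrFun hG l) ()
        rw [Matrix.mul_smul, Matrix.mul_one, Matrix.smul_apply, smul_eq_mul] at h2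
        rw [hcol, ← h2, Matrix.add_apply, Matrix.add_apply, Matrix.map_apply, Matrix.map_apply, hcol,
          Matrix.mul_apply, Matrix.mul_apply]
        congr 1
        exact Finset.sum_congr rfl fun x _ => by rw [hcol]
      have h3 : M₁ i 0 = b₀ * (H₀' * H₀) i 0 := by
        rw [hM₁, Matrix.mul_apply, Matrix.mul_apply, Finset.mul_sum]
        exact Finset.sum_congr rfl fun x _ => by rw [h1]; ring
      rw [h3, hHH', Matrix.one_apply, mul_ite, mul_one, mul_zero]
    obtain ⟨μ₁, H₁, H₁', d, N, hH₁, hH₁', hg₁, hN, hd, hdp⟩ := ih (M₁.submatrix Fin.succ Fin.succ)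
    set M₂ := ramMat μ₁ M₁ with hM₂
    have hM₂blk := eq_blk M₂ fun i => by
      rw [hM₂, ramMat, Matrix.smul_apply, Matrix.map_apply, hM₁col, if_neg (Fin.succ_ne_zero i),
        map_zero, smul_zero]
    have hM₂sub : M₂.submatrix Fin.succ Fin.succ = ramMat μ₁ (M₁.submatrix Fin.succ Fin.succ) := rfl
    rw [hM₂sub] at hM₂blk
    set b := M₂ 0 0 with hb
    set c : Fin m → Tame R₀ := fun j => M₂ 0 j.succ with hc
    obtain ⟨b₁, hb₁, hshift⟩ := exists_scalar_normal_form b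
    -- the integer shift making the new exponent compatible with the old ones
    obtain ⟨n, hn⟩ : ∃ n : ℤ, ∀ j, ∀ k : ℤ, b₁ + tameC R₀ n - d j = tameC R₀ k →
        b₁ + tameC R₀ n = d j := by
      by_cases hex : ∃ j, ∃ n : ℤ, b₁ - d j = tameC R₀ n
      · obtain ⟨j, n, hjn⟩ := hex
        refine ⟨-n, fun j' k hk => ?_⟩
        have h1 : b₁ + tameC R₀ ((-n : ℤ) : K) = d j := by
          push_cast
          rw [map_neg, ← hjn]
          ring
        rw [h1] at hk ⊢
        exact hd _ _ k hk
      · refine ⟨0, fun j k hk => absurd ⟨j, k, ?_⟩ hex⟩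
        rw [← hk]
        simp
    obtain ⟨g, hg0, hg⟩ := hshift n
    set b₂ := b₁ + tameC R₀ n with hb₂
    have hb₂p : NoPos b₂ := fun k hk => by
      change (b₁.1 + HahnSeries.C (n : K)).coeff k = 0
      rw [HahnSeries.coeff_add, hb₁ k hk, HahnSeries.C_apply, HahnSeries.coeff_single_of_ne hk.ne',
        add_zero]
    -- the connection is brought to normal form on the two diagonal blocks, then off the diagonal
    have hgauge₂ := isGauge_blk_diag hg (mul_inv_cancel₀ hg0) c hg₁
    set c₁ := g⁻¹ • Matrix.vecMul c H₁ with hc₁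
    obtain ⟨u, γ, hu, hγ⟩ := exists_solution_row (fun j => b₂ - d j) c₁ (fun j => hb₂p.sub (hdp j))
      (fun j k hk => sub_eq_zero.2 (hn j k hk)) N fun i j h => (hN i j h).1
    have hgauge₃ : IsGauge (tameEuler R₀) (blk b₂ c₁ (Matrix.diagonal d + N.map (tameC R₀)))
        (blk 1 u 1) (blk b₂ (fun j => tameC R₀ (γ j)) (Matrix.diagonal d + N.map (tameC R₀))) := by
      refine isGauge_blk_unipotent fun j => ?_
      rw [Matrix.vecMul_add, Pi.add_apply, Matrix.vecMul_diagonal]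
      linear_combination hu j
    have hgauge₁ := hg₀.ramify μ₁
    rw [ramMat_ramMat, ← hM₂, hM₂blk] at hgauge₁
    refine ⟨μ₁ * μ₀, H₀.map (tameRamify R₀ μ₁) * blk g 0 H₁ * blk 1 u 1,
      blk 1 (-u) 1 * (blk g⁻¹ 0 H₁' * H₀'.map (tameRamify R₀ μ₁)), Fin.cons b₂ d,
      blk 0 γ N, ?_, ?_, ?_, ?_, ?_, ?_⟩
    · have e₁ : blk 1 u 1 * blk 1 (-u) 1 = 1 := by
        rw [blk_mul, ← blk_one]; simp
      have e₂ : blk g 0 H₁ * blk g⁻¹ 0 H₁' = 1 := by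
        rw [blk_mul, mul_inv_cancel₀ hg0, hH₁, ← blk_one]; simp
      have e₃ : H₀.map (tameRamify R₀ μ₁) * H₀'.map (tameRamify R₀ μ₁) = 1 := by
        rw [← Matrix.map_mul, hHH, Matrix.map_one _ (map_zero _) (map_one _)]
      calc _ = H₀.map (tameRamify R₀ μ₁) * (blk g 0 H₁ * (blk 1 u 1 * blk 1 (-u) 1) *
              blk g⁻¹ 0 H₁') * H₀'.map (tameRamify R₀ μ₁) := by simp only [Matrix.mul_assoc]
        _ = 1 := by rw [e₁, Matrix.mul_one, e₂, Matrix.mul_one, e₃]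
    · have e₁ : blk 1 (-u) 1 * blk 1 u 1 = 1 := by
        rw [blk_mul, ← blk_one]; simp
      have e₂ : blk g⁻¹ 0 H₁' * blk g 0 H₁ = 1 := by
        rw [blk_mul, inv_mul_cancel₀ hg0, hH₁', ← blk_one]; simp
      have e₃ : H₀'.map (tameRamify R₀ μ₁) * H₀.map (tameRamify R₀ μ₁) = 1 := by
        rw [← Matrix.map_mul, hHH', Matrix.map_one _ (map_zero _) (map_one _)]
      calc _ = blk 1 (-u) 1 * (blk g⁻¹ 0 H₁' * (H₀'.map (tameRamify R₀ μ₁) *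
              H₀.map (tameRamify R₀ μ₁)) * blk g 0 H₁) * blk 1 u 1 := by
              simp only [Matrix.mul_assoc]
        _ = 1 := by rw [e₃, Matrix.mul_one, e₂, Matrix.mul_one, e₁]
    · have hfin : Matrix.diagonal (Fin.cons b₂ d : Fin (m + 1) → Tame R₀) +
          (blk 0 γ N).map (tameC R₀) =
          blk b₂ (fun j => tameC R₀ (γ j)) (Matrix.diagonal d + N.map (tameC R₀)) := by
        apply matrix_succ_ext
        · simp
        · intro j
          rw [Matrix.add_apply, Matrix.diagonal_apply_ne _ (Fin.succ_ne_zero j).symm]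
          simp
        · intro i
          rw [Matrix.add_apply, Matrix.diagonal_apply_ne _ (Fin.succ_ne_zero i)]
          simp
        · intro i j
          simp [Matrix.diagonal_apply]
      rw [hfin]
      exact (hgauge₁.mul hgauge₂).mul hgauge₃
    · intro i j
      refine Fin.cases ?_ (fun i => ?_) i <;> refine Fin.cases ?_ (fun j => ?_) j
      · intro h; simp at h
      · intro h
        simp only [blk_zero_succ] at h
        exact ⟨Fin.succ_pos j, sub_eq_zero.1 (hγ j h)⟩
      · intro h; simp at h
      · intro h
        simp only [blk_succ_succ] at h
        exact ⟨Fin.succ_lt_succ_iff.2 (hN i j h).1, (hN i j h).2⟩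
    · intro i j
      refine Fin.cases ?_ (fun i => ?_) i <;> refine Fin.cases ?_ (fun j => ?_) j
      · intro _ _; rfl
      · intro k hk
        exact hn j k hk
      · intro k hk
        refine (hn i (-k) ?_).symm
        have : b₂ - d i = -(d i - b₂) := by ring
        rw [this]
        push_cast
        rw [map_neg]
        exact congrArg Neg.neg hk
      · intro k hk
        exact hd i j k hk
    · intro i
      refine Fin.cases ?_ (fun i => ?_) i
      · exact hb₂p
      · exact hdp i

end NormalForm

/-! ### The field of meromorphic functions -/

section Generic

open TopologicalSpace (Opens)

/-- A property holds generically on `V` if and only if every non-empty open subset of `V` contains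
a non-empty open subset on which it holds everywhere. -/
theorem eventually_generic_iff {X : Type*} [TopologicalSpace X] {V : Opens X} {p : X → Prop} :
    (∀ᶠ t in generic V, p t) ↔ ∀ W : Opens X, W ≤ V → (W : Set X).Nonempty →
      ∃ W' : Opens X, W' ≤ W ∧ (W' : Set X).Nonempty ∧ ∀ t ∈ W', p t := by
  constructor
  · rintro ⟨D, hD, hVD, hDp⟩ W hW ⟨x, hx⟩
    obtain ⟨y, hyW, -, hyD⟩ := mem_closure_iff.1 (hVD (hW hx)) W W.isOpen hx
    exact ⟨W ⊓ ⟨D, hD⟩, inf_le_left, ⟨y, hyW, hyD⟩, fun t ht => hDp ht.2⟩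
  · intro h
    refine ⟨interior {t | p t}, isOpen_interior, fun x hx => ?_, interior_subset⟩
    rw [mem_closure_iff]
    intro N hN hxN
    obtain ⟨W', hW', ⟨y, hy⟩, hp⟩ := h (⟨N, hN⟩ ⊓ V) inf_le_right ⟨x, hxN, hx⟩
    exact ⟨y, (hW' hy).1, (hW' hy).2, interior_maximal (fun t ht => hp t ht) W'.isOpen hy⟩

theorem eventually_generic_of_forall {X : Type*} [TopologicalSpace X] {V : Opens X} {p : X → Prop}
    (h : ∀ t ∈ V, p t) : ∀ᶠ t in generic V, p t :=
  eventually_generic_iff.2 fun W hW hne => ⟨W, le_rfl, hne, fun t ht => h t (hW ht)⟩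

/-- A continuous function that vanishes generically vanishes. -/
theorem eq_zero_of_eventually_generic {X : Type*} [TopologicalSpace X] {V : Opens X} {g : X → ℂ}
    (hg : ContinuousOn g V) (h : ∀ᶠ t in generic V, g t = 0) : ∀ t ∈ V, g t = 0 := by
  intro t ht
  by_contra hne
  obtain ⟨W', hW', ⟨y, hy⟩, hp⟩ := eventually_generic_iff.1 h
    ⟨V ∩ g ⁻¹' {0}ᶜ, hg.isOpen_inter_preimage V.isOpen isClosed_singleton.isOpen_compl⟩
    (fun x hx => hx.1) ⟨t, ht, hne⟩
  exact (hW' hy).2 (hp y hy)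

variable {n : ℕ} {U V W : Opens (Param n)}

theorem exists_isPolydisc_le (hV : (V : Set (Param n)).Nonempty) :
    ∃ V' : Opens (Param n), V' ≤ V ∧ IsPolydisc V' := by
  obtain ⟨x, hx⟩ := hV
  obtain ⟨ε, hε, h⟩ := EMetric.isOpen_iff.1 V.isOpen x hx
  have key : ∀ δ : ENNReal, 0 < δ → δ < ε →
      (Set.univ.pi fun i => Metric.eball (x i) δ) ⊆ (V : Set (Param n)) := by
    intro δ _ hδ y hy
    refine h (lt_of_le_of_lt (edist_pi_le_iff.2 fun i => ?_) hδ)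
    exact (hy i trivial).le
  obtain ⟨δ, h0, hδ⟩ := exists_between hε
  exact ⟨⟨_, isOpen_set_pi Set.finite_univ fun i _ => Metric.isOpen_eball⟩, key δ h0 hδ,
    x, fun _ => δ, fun _ => h0, rfl⟩

theorem IsPolydisc.nonempty (hU : IsPolydisc U) : (U : Set (Param n)).Nonempty := by
  obtain ⟨c, r, hr, h⟩ := hU
  rw [h]
  exact ⟨c, fun i _ => Metric.mem_eball_self (hr i)⟩

theorem IsPolydisc.isPreconnected (hU : IsPolydisc U) : IsPreconnected (U : Set (Param n)) := by
  obtain ⟨c, r, hr, h⟩ := hU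
  rw [h]
  refine isPreconnected_univ_pi fun i => ?_
  rcases eq_or_ne (r i) ⊤ with h | h
  · rw [h, Metric.eball_top]
    exact isPreconnected_univ
  · lift r i to NNReal using h with ρ
    rw [Metric.eball_coe]
    exact (convex_ball _ _).isPreconnected

/-- The meromorphic function represented by `f`. -/
def Mer.mk (f : Param n → ℂ) (hf : LocallyQuotient U f) : Mer U := ⟨f, f, rfl, hf⟩

/-- The inclusion of meromorphic functions into germs of functions along the generic filter. -/
def Mer.toGerm (U : Opens (Param n)) : Mer U →+* Filter.Germ (generic U) ℂ :=
  (meromorphicSubring U).subtype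

theorem Mer.toGerm_injective : Function.Injective (Mer.toGerm U) := Subtype.val_injective

theorem Mer.exists_rep (c : Mer U) : ∃ f, ∃ hf : LocallyQuotient U f, c = Mer.mk f hf := by
  obtain ⟨_, f, rfl, hf⟩ := c
  exact ⟨f, hf, rfl⟩

theorem Mer.mk_eq_iff {f g : Param n → ℂ} {hf : LocallyQuotient U f} {hg : LocallyQuotient U g} :
    Mer.mk f hf = Mer.mk g hg ↔ ∀ᶠ t in generic U, f t = g t :=
  Subtype.ext_iff.trans Filter.Germ.coe_eq

theorem Mer.mk_mul {f g : Param n → ℂ} {hf : LocallyQuotient U f} {hg : LocallyQuotient U g} :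
    Mer.mk f hf * Mer.mk g hg = Mer.mk (f * g) (hf.mul hg) := rfl

theorem Mer.restrict_mk (hVU : V ≤ U) {f : Param n → ℂ} {hf : LocallyQuotient U f} :
    Mer.restrict hVU (Mer.mk f hf) = Mer.mk f (hf.mono hVU) := rfl

theorem Mer.restrict_restrict (hVU : V ≤ U) (hWV : W ≤ V) (c : Mer U) :
    Mer.restrict hWV (Mer.restrict hVU c) = Mer.restrict (hWV.trans hVU) c := by
  obtain ⟨f, hf, rfl⟩ := c.exists_rep
  rfl

theorem Mer.zero_eq_mk : (0 : Mer U) = Mer.mk 0 (.of_analytic analyticOnNhd_const) := rfl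

theorem Mer.one_eq_mk : (1 : Mer U) = Mer.mk 1 (.of_analytic analyticOnNhd_const) := rfl

theorem Mer.nontrivial (hU : (U : Set (Param n)).Nonempty) : Nontrivial (Mer U) := by
  refine ⟨⟨0, 1, fun h => ?_⟩⟩
  rw [Mer.zero_eq_mk, Mer.one_eq_mk, Mer.mk_eq_iff] at h
  obtain ⟨W, -, ⟨x, hx⟩, hW⟩ := eventually_generic_iff.1 h U le_rfl hU
  exact zero_ne_one (hW x hx)

/-- The identity theorem for meromorphic functions. -/
theorem Mer.eq_zero_of_restrict (hU : IsPreconnected (U : Set (Param n))) (hVU : V ≤ U)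
    (hV : (V : Set (Param n)).Nonempty) {c : Mer U} (hc : Mer.restrict hVU c = 0) : c = 0 := by
  obtain ⟨f, hf, rfl⟩ := c.exists_rep
  rw [Mer.restrict_mk, Mer.zero_eq_mk, Mer.mk_eq_iff] at hc
  -- the set of points near which `f` vanishes generically is open and relatively closed in `U`
  let Z : Opens (Param n) := sSup {N | N ≤ U ∧ ∀ᶠ t in generic N, f t = 0}
  have hZ : ∀ {x}, x ∈ Z ↔ ∃ N : Opens (Param n), (N ≤ U ∧ ∀ᶠ t in generic N, f t = 0) ∧ x ∈ N :=
    Opens.mem_sSup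
  have hsub : (U : Set (Param n)) ⊆ Z := by
    refine hU.subset_of_closure_inter_subset Z.isOpen ?_ ?_
    · obtain ⟨x, hx⟩ := hV
      exact ⟨x, hVU hx, hZ.2 ⟨V, ⟨hVU, hc⟩, hx⟩⟩
    · rintro p ⟨hpZ, hpU⟩
      obtain ⟨W, hpW, hWU, g, h, hg, hh, hfg⟩ := hf p hpU
      obtain ⟨ε, hε, hB⟩ := Metric.isOpen_iff.1 W.isOpen p hpW
      let B : Opens (Param n) := ⟨Metric.ball p ε, Metric.isOpen_ball⟩
      have hBW : B ≤ W := hB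
      have hfgB := generic_mono hBW hfg
      obtain ⟨y, hyB, hyZ⟩ := mem_closure_iff.1 hpZ B B.isOpen (Metric.mem_ball_self hε)
      obtain ⟨N, ⟨-, hN⟩, hyN⟩ := hZ.1 hyZ
      have hgN : ∀ᶠ t in generic (N ⊓ B), g t = 0 := by
        filter_upwards [generic_mono inf_le_left hN, generic_mono inf_le_right hfgB] with t h0 h1
        have h2 := h1.2
        rw [h0, eq_comm, div_eq_zero_iff] at h2
        exact h2.resolve_right h1.1
      have hg0 := eq_zero_of_eventually_generic (V := N ⊓ B)
        (hg.continuousOn.mono fun x hx => hBW hx.2) hgN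
      have hgB : Set.EqOn g 0 B :=
        (hg.mono hBW).eqOn_zero_of_preconnected_of_eventuallyEq_zero
          (convex_ball p ε).isPreconnected hyB
          (Filter.eventually_of_mem ((N ⊓ B).isOpen.mem_nhds ⟨hyN, hyB⟩) hg0)
      refine hZ.2 ⟨B, ⟨hBW.trans hWU, ?_⟩, Metric.mem_ball_self hε⟩
      filter_upwards [hfgB, eventually_generic_of_forall (V := B) hgB] with t h1 h2
      rw [h1.2, h2, Pi.zero_apply, zero_div]
  rw [Mer.zero_eq_mk, Mer.mk_eq_iff, eventually_generic_iff]
  rintro W hW ⟨x, hx⟩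
  obtain ⟨N, ⟨-, hN⟩, hxN⟩ := hZ.1 (hsub (hW hx))
  obtain ⟨W', hW', hne, h⟩ := eventually_generic_iff.1 hN (N ⊓ W) inf_le_left ⟨x, hxN, hx⟩
  exact ⟨W', hW'.trans inf_le_right, hne, h⟩

theorem Mer.isField (hne : (U : Set (Param n)).Nonempty)
    (hU : IsPreconnected (U : Set (Param n))) : IsField (Mer U) := by
  have := Mer.nontrivial hne
  refine ⟨exists_pair_ne _, mul_comm, fun {c} hc => ?_⟩
  obtain ⟨f, hf, rfl⟩ := c.exists_rep
  -- by the identity theorem, a numerator of `f` vanishes on no non-empty open set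
  have hnum : ∀ W : Opens (Param n), W ≤ U → ∀ g h : Param n → ℂ, AnalyticOnNhd ℂ g W →
      (∀ᶠ t in generic W, h t ≠ 0 ∧ f t = g t / h t) → ∀ᶠ t in generic W, g t ≠ 0 := by
    intro W hWU g h hg hfg
    refine eventually_generic_iff.2 fun W₁ hW₁ hne₁ => ?_
    by_cases hex : ∃ x ∈ W₁, g x ≠ 0
    · obtain ⟨x, hx, hgx⟩ := hex
      exact ⟨⟨W₁ ∩ g ⁻¹' {0}ᶜ, (hg.continuousOn.mono hW₁).isOpen_inter_preimage W₁.isOpen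
        isClosed_singleton.isOpen_compl⟩, fun _ h => h.1, ⟨x, hx, hgx⟩, fun _ h => h.2⟩
    · push Not at hex
      refine absurd (Mer.eq_zero_of_restrict hU (hW₁.trans hWU) hne₁ ?_) hc
      rw [Mer.restrict_mk, Mer.zero_eq_mk, Mer.mk_eq_iff]
      filter_upwards [generic_mono hW₁ hfg, eventually_generic_of_forall hex] with t h1 h2
      rw [h1.2, h2, zero_div, Pi.zero_apply]
  have hinv : LocallyQuotient U f⁻¹ := by
    intro p hp
    obtain ⟨W, hpW, hWU, g, h, hg, hh, hfg⟩ := hf p hp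
    refine ⟨W, hpW, hWU, h, g, hh, hg, ?_⟩
    filter_upwards [hfg, hnum W hWU g h hg hfg] with t h1 h2
    exact ⟨h2, by rw [Pi.inv_apply, h1.2, inv_div]⟩
  refine ⟨Mer.mk f⁻¹ hinv, ?_⟩
  rw [Mer.mk_mul, Mer.one_eq_mk, Mer.mk_eq_iff, eventually_generic_iff]
  rintro W₁ hW₁ ⟨p, hp⟩
  obtain ⟨W, hpW, hWU, g, h, hg, hh, hfg⟩ := hf p (hW₁ hp)
  obtain ⟨W', hW', hne', hfW'⟩ := eventually_generic_iff.1
    (hfg.and (hnum W hWU g h hg hfg)) (W ⊓ W₁) inf_le_left ⟨p, hpW, hp⟩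
  refine ⟨W', hW'.trans inf_le_right, hne', fun t ht => ?_⟩
  obtain ⟨⟨h1, h2⟩, h3⟩ := hfW' t ht
  rw [Pi.mul_apply, Pi.inv_apply, h2, Pi.one_apply, mul_inv_cancel₀ (div_ne_zero h3 h1)]

/-! ### Analytic representatives -/

theorem Mer.isAnalyticRep_iff {c : Mer U} {hVU : V ≤ U} {g : Param n → ℂ} :
    Mer.IsAnalyticRep c hVU g ↔
      ∃ hg : AnalyticOnNhd ℂ g V, Mer.restrict hVU c = Mer.mk g (.of_analytic hg) :=
  ⟨fun h => ⟨h.1, Subtype.ext h.2⟩, fun ⟨h, e⟩ => ⟨h, congrArg Subtype.val e⟩⟩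

theorem Mer.IsAnalyticRep.eq {c : Mer U} {hVU : V ≤ U} {g g' : Param n → ℂ}
    (h : Mer.IsAnalyticRep c hVU g) (h' : Mer.IsAnalyticRep c hVU g') :
    ∀ t ∈ V, g t = g' t := by
  intro t ht
  rw [← sub_eq_zero]
  refine eq_zero_of_eventually_generic (g := g - g') (h.1.sub h'.1).continuousOn ?_ t ht
  filter_upwards [Filter.Germ.coe_eq.1 (h.2.symm.trans h'.2)] with t ht
  rw [Pi.sub_apply, ht, sub_self]

theorem Mer.IsAnalyticRep.add {c c' : Mer U} {hVU : V ≤ U} {g g' : Param n → ℂ}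
    (h : Mer.IsAnalyticRep c hVU g) (h' : Mer.IsAnalyticRep c' hVU g') :
    Mer.IsAnalyticRep (c + c') hVU (g + g') := by
  refine ⟨h.1.add h'.1, ?_⟩
  rw [map_add]
  exact congrArg₂ (· + ·) h.2 h'.2

theorem Mer.IsAnalyticRep.mul {c c' : Mer U} {hVU : V ≤ U} {g g' : Param n → ℂ}
    (h : Mer.IsAnalyticRep c hVU g) (h' : Mer.IsAnalyticRep c' hVU g') :
    Mer.IsAnalyticRep (c * c') hVU (g * g') := by
  refine ⟨h.1.mul h'.1, ?_⟩
  rw [map_mul]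
  exact congrArg₂ (· * ·) h.2 h'.2

theorem Mer.IsAnalyticRep.neg {c : Mer U} {hVU : V ≤ U} {g : Param n → ℂ}
    (h : Mer.IsAnalyticRep c hVU g) : Mer.IsAnalyticRep (-c) hVU (-g) := by
  refine ⟨h.1.neg, ?_⟩
  rw [map_neg]
  exact congrArg Neg.neg h.2

theorem Mer.isAnalyticRep_const (hVU : V ≤ U) (a : ℂ) :
    Mer.IsAnalyticRep (Mer.const U a) hVU fun _ => a := ⟨analyticOnNhd_const, rfl⟩

theorem Mer.IsAnalyticRep.mono {c : Mer U} {hVU : V ≤ U} {g : Param n → ℂ}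
    (h : Mer.IsAnalyticRep c hVU g) (hWV : W ≤ V) : Mer.IsAnalyticRep c (hWV.trans hVU) g := by
  obtain ⟨hg, e⟩ := Mer.isAnalyticRep_iff.1 h
  refine Mer.isAnalyticRep_iff.2 ⟨hg.mono hWV, ?_⟩
  rw [← Mer.restrict_restrict hVU hWV, e, Mer.restrict_mk]

theorem Mer.IsAnalyticRep.restrict {c : Mer U} {hVU : V ≤ U} {g : Param n → ℂ} {hWV : W ≤ V}
    (h : Mer.IsAnalyticRep c (hWV.trans hVU) g) :
    Mer.IsAnalyticRep (Mer.restrict hVU c) hWV g := by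
  rwa [Mer.IsAnalyticRep, Mer.restrict_restrict]

/-- The subring of meromorphic functions on `U` that are analytic on `V`. -/
def analyticSubring (hVU : V ≤ U) : Subring (Mer U) where
  carrier := {c | Mer.IsAnalyticOn c hVU}
  mul_mem' := by
    rintro a b ⟨g, hg⟩ ⟨g', hg'⟩
    exact ⟨_, hg.mul hg'⟩
  one_mem' := ⟨_, by simpa using Mer.isAnalyticRep_const hVU 1⟩
  add_mem' := by
    rintro a b ⟨g, hg⟩ ⟨g', hg'⟩
    exact ⟨_, hg.add hg'⟩
  zero_mem' := ⟨_, by simpa using Mer.isAnalyticRep_const hVU 0⟩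
  neg_mem' := by
    rintro a ⟨g, hg⟩
    exact ⟨_, hg.neg⟩

/-- The value at a point of `V` of a meromorphic function that is analytic on `V`. The analytic
representative is unique on `V`, so the choice of one does not matter. -/
def evalAt (hVU : V ≤ U) (t : Param n) (ht : t ∈ V) : analyticSubring hVU →+* ℂ where
  toFun c := c.2.choose t
  map_one' := (1 : analyticSubring hVU).2.choose_spec.eq
    (by simpa using Mer.isAnalyticRep_const hVU 1) t ht
  map_mul' a b := (a * b).2.choose_spec.eq (a.2.choose_spec.mul b.2.choose_spec) t ht
  map_zero' := (0 : analyticSubring hVU).2.choose_spec.eq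
    (by simpa using Mer.isAnalyticRep_const hVU 0) t ht
  map_add' a b := (a + b).2.choose_spec.eq (a.2.choose_spec.add b.2.choose_spec) t ht

theorem evalAt_eq {hVU : V ≤ U} {t : Param n} (ht : t ∈ V) (c : analyticSubring hVU)
    {g : Param n → ℂ} (hg : Mer.IsAnalyticRep c.1 hVU g) : evalAt hVU t ht c = g t :=
  c.2.choose_spec.eq hg t ht

/-- A meromorphic function is analytic on some non-empty open subset. -/
theorem Mer.exists_isAnalyticOn (c : Mer U) (hVU : V ≤ U) (hV : (V : Set (Param n)).Nonempty) :
    ∃ (V' : Opens (Param n)) (hV' : V' ≤ V), (V' : Set (Param n)).Nonempty ∧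
      Mer.IsAnalyticOn c (hV'.trans hVU) := by
  obtain ⟨f, hf, rfl⟩ := c.exists_rep
  obtain ⟨p, hp⟩ := hV
  obtain ⟨W, hpW, hWU, g, h, hg, hh, hfg⟩ := hf p (hVU hp)
  obtain ⟨W', hW', hne, hW'p⟩ := eventually_generic_iff.1 hfg (W ⊓ V) inf_le_left ⟨p, hpW, hp⟩
  have l₁ : W' ≤ W := hW'.trans inf_le_left
  refine ⟨W', hW'.trans inf_le_right, hne, g / h, (hg.mono l₁).div (hh.mono l₁) fun t ht =>
    (hW'p t ht).1, ?_⟩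
  exact Filter.Germ.coe_eq.2 (eventually_generic_of_forall fun t ht => (hW'p t ht).2)

/-- Finitely many meromorphic functions are analytic on a common polydisc. -/
theorem Mer.exists_polydisc_forall_isAnalyticOn {S : Set (Mer U)} (hS : S.Finite) (hVU : V ≤ U)
    (hV : (V : Set (Param n)).Nonempty) :
    ∃ (V' : Opens (Param n)) (hV' : V' ≤ V), IsPolydisc V' ∧
      ∀ c ∈ S, Mer.IsAnalyticOn c (hV'.trans hVU) := by
  induction S, hS using Set.Finite.induction_on with
  | empty =>
    obtain ⟨V', h, h'⟩ := exists_isPolydisc_le hV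
    exact ⟨V', h, h', by simp⟩
  | @insert c S _ _ ih =>
    obtain ⟨V₁, h₁, hp₁, hS₁⟩ := ih
    obtain ⟨V₂, h₂, hne₂, g, hg⟩ := c.exists_isAnalyticOn (h₁.trans hVU) hp₁.nonempty
    obtain ⟨V', h, hp⟩ := exists_isPolydisc_le hne₂
    refine ⟨V', (h.trans h₂).trans h₁, hp, ?_⟩
    rintro x (rfl | hx)
    · exact ⟨g, hg.mono h⟩
    · obtain ⟨g', hg'⟩ := hS₁ x hx
      exact ⟨g', hg'.mono (h.trans h₂)⟩

end Generic

/-! ### Specialization of algebraic functions to meromorphic functions -/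

section Specialization

open TopologicalSpace (Opens)
open Polynomial

variable {n : ℕ} {U V W : Opens (Param n)}

/-- The analytic implicit function theorem for a simple root of a polynomial with analytic
coefficients. -/
theorem exists_analytic_root {k : ℕ} (g : ℕ → Param n → ℂ) (hg : ∀ i, AnalyticOnNhd ℂ (g i) V)
    {t₀ : Param n} (ht₀ : t₀ ∈ V) {x₀ : ℂ}
    (h0 : ∑ i ∈ Finset.range k, g i t₀ * x₀ ^ i = 0)
    (h1 : ∑ i ∈ Finset.range k, g i t₀ * (i * x₀ ^ (i - 1)) ≠ 0) :
    ∃ (V' : Opens (Param n)) (_ : V' ≤ V) (ψ : Param n → ℂ), (V' : Set (Param n)).Nonempty ∧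
      AnalyticOnNhd ℂ ψ V' ∧ ∀ t ∈ V', ∑ i ∈ Finset.range k, g i t * ψ t ^ i = 0 := by
  set f : Param n × ℂ → ℂ := fun u => ∑ i ∈ Finset.range k, g i u.1 * u.2 ^ i with hf
  have hfan : AnalyticAt ℂ f (t₀, x₀) := by
    refine Finset.analyticAt_fun_sum _ fun i _ => ?_
    have h2 : AnalyticAt ℂ (fun u : Param n × ℂ => g i u.1) (t₀, x₀) :=
      (hg i t₀ ht₀).comp_of_eq analyticAt_fst rfl
    exact h2.mul (analyticAt_snd.pow i)
  have hcd : ContDiffAt ℂ ⊤ f (t₀, x₀) := hfan.contDiffAt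
  have htop : (⊤ : WithTop ℕ∞) ≠ 0 := by simp
  have hder : HasDerivAt (fun x => f (t₀, x))
      (∑ i ∈ Finset.range k, g i t₀ * (i * x₀ ^ (i - 1))) x₀ := by
    simp only [hf]
    refine HasDerivAt.fun_sum fun i _ => ?_
    exact (hasDerivAt_pow i x₀).const_mul _
  have hcomp : HasFDerivAt (fun x => f (t₀, x))
      (fderiv ℂ f (t₀, x₀) ∘L .inr ℂ (Param n) ℂ) x₀ :=
    HasFDerivAt.comp x₀ hfan.differentiableAt.hasFDerivAt (hasFDerivAt_prodMk_right t₀ x₀)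
  have hinv : (fderiv ℂ f (t₀, x₀) ∘L .inr ℂ (Param n) ℂ).IsInvertible := by
    rw [hcomp.unique hder.hasFDerivAt]
    refine ⟨ContinuousLinearEquiv.unitsEquivAut ℂ (Units.mk0 _ h1), ?_⟩
    ext
    simp
  set ψ := hcd.implicitFunction htop hinv with hψ
  have hψan : AnalyticAt ℂ ψ t₀ := (hcd.contDiffAt_implicitFunction htop hinv).analyticAt
  have hψeq := hcd.eventually_apply_implicitFunction htop hinv
  have hf0 : f (t₀, x₀) = 0 := h0
  have hev : ∀ᶠ t in 𝓝 t₀, AnalyticAt ℂ ψ t ∧ f (t, ψ t) = 0 ∧ t ∈ V := by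
    filter_upwards [hψan.eventually_analyticAt, hψeq, V.isOpen.mem_nhds ht₀] with t h1 h2 h3
    exact ⟨h1, h2.trans hf0, h3⟩
  obtain ⟨N, hN, hNo, htN⟩ := eventually_nhds_iff.1 hev
  exact ⟨⟨N, hNo⟩, fun t ht => (hN t ht).2.2, ψ, ⟨t₀, htN⟩, fun t ht => (hN t ht).1,
    fun t ht => (hN t ht).2.1⟩

/-- A separable algebraic equation over the field of meromorphic functions has a meromorphic solution
on a smaller polydisc. -/
theorem exists_root_restrict (hU : (U : Set (Param n)).Nonempty) {p a b : (Mer U)[X]}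
    (hp : p.Monic) (hdeg : p.natDegree ≠ 0) (hab : a * p + b * derivative p = 1) :
    ∃ (V : Opens (Param n)) (hVU : V ≤ U), IsPolydisc V ∧ ∃ y : Mer V,
      p.eval₂ (Mer.restrict hVU) y = 0 := by
  obtain ⟨V, hVU, hV, hS⟩ := Mer.exists_polydisc_forall_isAnalyticOn
    (S := p.coeffs ∪ a.coeffs ∪ b.coeffs) (Set.toFinite _) le_rfl hU
  obtain ⟨t₀, ht₀⟩ := hV.nonempty
  have hlift : ∀ q : (Mer U)[X], (∀ c ∈ q.coeffs, Mer.IsAnalyticOn c hVU) →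
      ∃ q' : (analyticSubring hVU)[X], q'.map (analyticSubring hVU).subtype = q := by
    intro q hq
    refine ⟨q.toSubring _ fun c hc => hq c hc, Polynomial.map_toSubring _ _ _⟩
  obtain ⟨p', rfl⟩ := hlift p fun c hc => hS c (by simp [hc])
  obtain ⟨a', rfl⟩ := hlift a fun c hc => hS c (by simp [hc])
  obtain ⟨b', rfl⟩ := hlift b fun c hc => hS c (by simp [hc])
  have hinj : Function.Injective (analyticSubring hVU).subtype := Subtype.val_injective
  have hp' : p'.Monic := Polynomial.monic_of_injective hinj hp
  have hab' : a' * p' + b' * derivative p' = 1 := by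
    apply Polynomial.map_injective _ hinj
    simpa [Polynomial.derivative_map] using hab
  set ε := evalAt hVU t₀ ht₀ with hε
  have hdeg' : (p'.map ε).degree ≠ 0 := by
    rw [Polynomial.natDegree_map_eq_of_injective hinj] at hdeg
    intro h
    apply hdeg
    rw [← hp'.natDegree_map ε]
    exact Polynomial.natDegree_eq_of_degree_eq_some h
  obtain ⟨x₀, hx₀⟩ := IsAlgClosed.exists_root _ hdeg'
  -- evaluated at `t₀`, the Bézout relation shows that every root is simple
  have hsep : (derivative (p'.map ε)).eval x₀ ≠ 0 := by
    intro h
    have h2 := congrArg (fun q => (q.map ε).eval x₀) hab'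
    rw [Polynomial.derivative_map] at h
    simp only [Polynomial.map_add, Polynomial.map_mul, Polynomial.eval_add, Polynomial.eval_mul, h,
      hx₀.eq_zero, mul_zero, add_zero, Polynomial.map_one, Polynomial.eval_one] at h2
    exact zero_ne_one h2
  choose g hg using fun i => (p'.coeff i).2
  have hgt : ∀ i, (p'.map ε).coeff i = g i t₀ := fun i => by
    rw [Polynomial.coeff_map, hε, evalAt_eq ht₀ _ (hg i)]
  set k := p'.natDegree + 1 with hk
  have hlt : (p'.map ε).natDegree < k := Nat.lt_succ_of_le Polynomial.natDegree_map_le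
  obtain ⟨V', hV'V, ψ, hne, hψ, hroot⟩ := exists_analytic_root (k := k) g (fun i => (hg i).1) ht₀
    (x₀ := x₀) (by
      have := hx₀.eq_zero
      rw [Polynomial.eval_eq_sum_range' hlt] at this
      simpa only [hgt] using this) (by
      rw [Polynomial.derivative_eval, Polynomial.sum_over_range' _ _ k hlt] at hsep
      · simpa only [hgt, mul_assoc] using hsep
      · simp)
  obtain ⟨V'', hV'', hp''⟩ := exists_isPolydisc_le hne
  have hψ'' : AnalyticOnNhd ℂ ψ V'' := hψ.mono hV''
  refine ⟨V'', (hV''.trans hV'V).trans hVU, hp'', Mer.mk ψ (.of_analytic hψ''), ?_⟩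
  rw [Polynomial.eval₂_eq_sum_range' _ (n := k) (by
    rw [Polynomial.natDegree_map_eq_of_injective hinj]; exact Nat.lt_succ_self _)]
  apply Mer.toGerm_injective
  rw [map_sum, map_zero]
  have hterm : ∀ i, Mer.toGerm V'' (Mer.restrict ((hV''.trans hV'V).trans hVU)
      ((p'.map (analyticSubring hVU).subtype).coeff i) * Mer.mk ψ (.of_analytic hψ'') ^ i) =
      ((fun t => g i t * ψ t ^ i : Param n → ℂ) : Filter.Germ (generic V'') ℂ) := by
    intro i
    rw [map_mul, map_pow, Polynomial.coeff_map]
    have h2 : Mer.toGerm V'' (Mer.restrict ((hV''.trans hV'V).trans hVU) (p'.coeff i).1) =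
      ((g i : Param n → ℂ) : Filter.Germ (generic V'') ℂ) := ((hg i).mono (hV''.trans hV'V)).2
    exact congrArg (· * _) h2
  rw [Finset.sum_congr rfl fun i _ => hterm i]
  have hsum : ((∑ i ∈ Finset.range k, fun t => g i t * ψ t ^ i : Param n → ℂ) :
      Filter.Germ (generic V'') ℂ) =
      ∑ i ∈ Finset.range k, ((fun t => g i t * ψ t ^ i : Param n → ℂ) :
        Filter.Germ (generic V'') ℂ) := map_sum (Filter.Germ.coeRingHom _) _ _
  rw [← hsum]
  refine Filter.Germ.coe_eq.2 (eventually_generic_of_forall fun t ht => ?_)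
  rw [Finset.sum_apply]
  exact hroot t (hV'' ht)

/-- On some smaller open set, each integer translate of a continuous function vanishes identically or
nowhere: either the function takes a non-integer value, or it is locally constant. -/
theorem exists_forall_int (g : Param n → ℂ) (hg : ContinuousOn g V)
    (hV : (V : Set (Param n)).Nonempty) :
    ∃ V' : Opens (Param n), V' ≤ V ∧ (V' : Set (Param n)).Nonempty ∧
      ∀ k : ℤ, (∀ t ∈ V', g t + k ≠ 0) ∨ ∀ t ∈ V', g t + k = 0 := by
  by_cases h : ∃ t ∈ V, g t ∉ Set.range ((↑) : ℤ → ℂ)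
  · obtain ⟨t, ht, hgt⟩ := h
    refine ⟨⟨V ∩ g ⁻¹' (Set.range ((↑) : ℤ → ℂ))ᶜ, hg.isOpen_inter_preimage V.isOpen
      Complex.isClosed_range_intCast.isOpen_compl⟩, fun _ h => h.1, ⟨t, ht, hgt⟩,
      fun k => Or.inl fun x hx h0 => hx.2 ⟨-k, ?_⟩⟩
    push_cast
    linear_combination -h0
  · push Not at h
    obtain ⟨t, ht⟩ := hV
    obtain ⟨a, ha⟩ := h t ht
    refine ⟨⟨V ∩ g ⁻¹' (Metric.ball (a : ℂ) 1), hg.isOpen_inter_preimage V.isOpen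
      Metric.isOpen_ball⟩, fun _ h => h.1, ⟨t, ht, ?_⟩, fun k => ?_⟩
    · change g t ∈ Metric.ball (a : ℂ) 1
      rw [← ha]
      exact Metric.mem_ball_self one_pos
    have hconst : ∀ x, x ∈ V ∧ g x ∈ Metric.ball (a : ℂ) 1 → g x = a := by
      rintro x ⟨hxV, hx⟩
      obtain ⟨b, hb⟩ := h x hxV
      rw [← hb, Metric.mem_ball, Complex.dist_eq, ← Int.cast_sub, Complex.norm_intCast] at hx
      rw [← hb]
      have h1 : |b - a| < 1 := by exact_mod_cast hx
      rw [Int.abs_lt_one_iff, sub_eq_zero] at h1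
      rw [h1]
    by_cases hak : (a : ℂ) + k = 0
    · exact Or.inr fun x hx => by rw [hconst x hx, hak]
    · exact Or.inl fun x hx => by rwa [hconst x hx]

/-- On some smaller polydisc, finitely many meromorphic functions and all their integer translates
are analytic, and each translate vanishes identically or nowhere. -/
theorem exists_polydisc_shift {S : Set (Mer U)} (hS : S.Finite)
    (hU : (U : Set (Param n)).Nonempty) :
    ∃ (V : Opens (Param n)) (hVU : V ≤ U), IsPolydisc V ∧ ∀ c ∈ S, ∃ g : Param n → ℂ,
      Mer.IsAnalyticRep c hVU g ∧
      ∀ k : ℤ, (∀ t ∈ V, g t + k ≠ 0) ∨ ∀ t ∈ V, g t + k = 0 := by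
  induction S, hS using Set.Finite.induction_on with
  | empty =>
    obtain ⟨V, h, h'⟩ := exists_isPolydisc_le hU
    exact ⟨V, h, h', by simp⟩
  | @insert c S _ _ ih =>
    obtain ⟨V₁, h₁, hp₁, hS₁⟩ := ih
    obtain ⟨V₂, h₂, hne₂, g, hg⟩ := c.exists_isAnalyticOn h₁ hp₁.nonempty
    obtain ⟨V₃, h₃, hne₃, hk⟩ := exists_forall_int g hg.1.continuousOn hne₂
    obtain ⟨V, h, hp⟩ := exists_isPolydisc_le hne₃
    refine ⟨V, ((h.trans h₃).trans h₂).trans h₁, hp, ?_⟩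
    rintro x (rfl | hx)
    · exact ⟨g, hg.mono (h.trans h₃), fun k =>
        (hk k).imp (fun h' t ht => h' t (h ht)) fun h' t ht => h' t (h ht)⟩
    · obtain ⟨g', hg', hk'⟩ := hS₁ x hx
      exact ⟨g', hg'.mono ((h.trans h₃).trans h₂), fun k =>
        (hk' k).imp (fun h' t ht => h' t (h₂ (h₃ (h ht)))) fun h' t ht => h' t (h₂ (h₃ (h ht)))⟩

/-- Finitely many algebraic functions specialize to meromorphic functions on a smaller polydisc:
the subfield they generate over the meromorphic functions on `U` maps to the meromorphic
functions on the smaller polydisc. -/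
theorem exists_algebraic_specialization {K₀ : Type*} [Field K₀] [CharZero K₀] (e : K₀ ≃+* Mer U)
    (hU : (U : Set (Param n)).Nonempty) {K : Type*} [Field K] [Algebra K₀ K]
    [Algebra.IsAlgebraic K₀ K] {S : Set K} (hS : S.Finite) :
    ∃ (E : IntermediateField K₀ K) (V : Opens (Param n)) (hVU : V ≤ U) (σ : E →+* Mer V),
      S ⊆ E ∧ IsPolydisc V ∧ ∀ c, σ (algebraMap K₀ E c) = Mer.restrict hVU (e c) := by
  set E := IntermediateField.adjoin K₀ S with hE
  have := Mer.nontrivial hU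
  have := hS.to_subtype
  have : FiniteDimensional K₀ E := IntermediateField.finiteDimensional_adjoin
    fun x _ => Algebra.IsIntegral.isIntegral x
  obtain ⟨α, hα⟩ := Field.exists_primitive_element K₀ E
  have hint : IsIntegral K₀ α := Algebra.IsIntegral.isIntegral α
  set p := minpoly K₀ α with hp
  have hsep : p.Separable := (minpoly.irreducible hint).separable
  obtain ⟨a, b, hab⟩ := hsep
  obtain ⟨V, hVU, hV, y, hy⟩ := exists_root_restrict hU (p := p.map e.toRingHom)
    (a := a.map e.toRingHom) (b := b.map e.toRingHom) ((minpoly.monic hint).map _)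
    (by
      rw [(minpoly.monic hint).natDegree_map]
      exact (minpoly.natDegree_pos hint).ne')
    (by rw [Polynomial.derivative_map, ← Polynomial.map_mul, ← Polynomial.map_mul,
      ← Polynomial.map_add, hab, Polynomial.map_one])
  rw [Polynomial.eval₂_map] at hy
  let τ : AdjoinRoot p →+* Mer V := AdjoinRoot.lift ((Mer.restrict hVU).comp e.toRingHom) y hy
  let ι : AdjoinRoot p ≃ₐ[K₀] E :=
    (IntermediateField.adjoinRootEquivAdjoin K₀ hint).trans
      ((IntermediateField.equivOfEq hα).trans IntermediateField.topEquiv)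
  refine ⟨E, V, hVU, τ.comp ι.symm.toAlgHom.toRingHom, IntermediateField.subset_adjoin K₀ S, hV,
    fun c => ?_⟩
  have : ι.symm (algebraMap K₀ E c) = AdjoinRoot.of p c := ι.symm.commutes c
  change τ (ι.symm (algebraMap K₀ E c)) = _
  rw [this]
  exact AdjoinRoot.lift_of hy

/-- The specialization theorem: a shift closed ring of algebraic functions maps to the meromorphic
functions on a smaller polydisc, and a smaller shift closed ring maps to functions that are
analytic on a still smaller polydisc. -/
theorem exists_specialization {K₀ : Type*} [Field K₀] [CharZero K₀] (e : K₀ ≃+* Mer U)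
    (hU : (U : Set (Param n)).Nonempty) {K : Type*} [Field K] [Algebra K₀ K]
    [Algebra.IsAlgebraic K₀ K] {S : Set K} (hS : S.Finite) :
    ∃ (R : Subring K) (V : Opens (Param n)) (hVU : V ≤ U) (σ : R →+* Mer V), IsPolydisc V ∧
      ShiftClosed S R ∧ (∀ c, ∃ h : algebraMap K₀ K c ∈ R,
        σ ⟨_, h⟩ = Mer.restrict hVU (e c)) ∧
      ∃ (R' : Subring K) (W : Opens (Param n)) (hWV : W ≤ V), IsPolydisc W ∧
        ShiftClosed S R' ∧ (∀ c, Mer.IsAnalyticOn (e c) (le_refl U) → algebraMap K₀ K c ∈ R') ∧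
        ∀ x : R, x.1 ∈ R' → Mer.IsAnalyticOn (σ x) hWV := by
  obtain ⟨E, V, hVU, σ, hSE, hV, hσ⟩ := exists_algebraic_specialization e hU (K := K) hS
  have hShift : ShiftClosed S E.toSubfield.toSubring := fun s hs =>
    ⟨hSE hs, fun k => E.inv_mem (E.add_mem (hSE hs) (intCast_mem E k))⟩
  refine ⟨E.toSubfield.toSubring, V, hVU, σ, hV, hShift, fun c => ⟨E.algebraMap_mem c, hσ c⟩, ?_⟩
  obtain ⟨W, hWV, hW, hSW⟩ := exists_polydisc_shift
    (S := (fun x : E => σ x) '' ((fun x : E => (x : K)) ⁻¹' S))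
    ((hS.preimage Subtype.val_injective.injOn).image _) hV.nonempty
  have := Mer.nontrivial hW.nonempty
  -- the elements of `E` whose specializations are analytic on `W`
  refine ⟨((analyticSubring hWV).comap σ).map E.val.toRingHom, W, hWV, hW, ?_, ?_, ?_⟩
  · intro s hs
    obtain ⟨g, hg, hk⟩ := hSW _ ⟨⟨s, hSE hs⟩, hs, rfl⟩
    refine ⟨⟨⟨s, hSE hs⟩, ⟨g, hg⟩, rfl⟩, fun k => ⟨(⟨s, hSE hs⟩ + k)⁻¹, ?_, by simp⟩⟩
    set x : E := ⟨s, hSE hs⟩ + k with hx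
    change Mer.IsAnalyticOn (σ x⁻¹) hWV
    by_cases hx0 : x = 0
    · rw [hx0, inv_zero, map_zero]
      exact (analyticSubring hWV).zero_mem
    have hrep : Mer.IsAnalyticRep (σ x) hWV (g + fun _ => (k : ℂ)) := by
      rw [hx, map_add, map_intCast]
      exact hg.add (by simpa using Mer.isAnalyticRep_const hWV (k : ℂ))
    have hmul : Mer.restrict hWV (σ x) * Mer.restrict hWV (σ x⁻¹) = 1 := by
      rw [← map_mul, ← map_mul, mul_inv_cancel₀ hx0, map_one, map_one]
    obtain ⟨hgan, hgeq⟩ := Mer.isAnalyticRep_iff.1 hrep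
    -- `x` is invertible, so its specialization is not identically zero and hence has no zeros
    have hne : ∀ t ∈ W, g t + k ≠ 0 := by
      refine (hk k).resolve_right fun h0 => ?_
      have : Mer.restrict hWV (σ x) = 0 := by
        rw [hgeq, Mer.zero_eq_mk, Mer.mk_eq_iff]
        exact eventually_generic_of_forall h0
      rw [this, zero_mul] at hmul
      exact zero_ne_one hmul
    have hinv : AnalyticOnNhd ℂ (g + fun _ => (k : ℂ))⁻¹ W := hgan.inv hne
    refine ⟨_, Mer.isAnalyticRep_iff.2 ⟨hinv, ?_⟩⟩
    have h1 : Mer.restrict hWV (σ x) * Mer.mk _ (.of_analytic hinv) = 1 := by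
      rw [hgeq, Mer.mk_mul, Mer.one_eq_mk, Mer.mk_eq_iff]
      exact eventually_generic_of_forall fun t ht => mul_inv_cancel₀ (hne t ht)
    calc _ = Mer.restrict hWV (σ x) * Mer.mk _ (.of_analytic hinv) *
          Mer.restrict hWV (σ x⁻¹) := by rw [h1, one_mul]
      _ = _ := by rw [mul_right_comm, hmul, one_mul]
  · intro c hc
    refine ⟨algebraMap K₀ E c, ?_, rfl⟩
    obtain ⟨g, hg⟩ := hc
    change Mer.IsAnalyticOn (σ _) hWV
    rw [hσ]
    exact ⟨g, Mer.IsAnalyticRep.restrict (hg.mono (hWV.trans hVU))⟩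
  · rintro x ⟨y, hy, hyx⟩
    have : y = x := Subtype.ext hyx
    rw [← this]
    exact hy

end Specialization

/-! ### Ramified series as elements of the symbolic ring -/

section Sections

variable {R : Type*} [CommRing R]

/-- The series `∑ f_(νi+j) zⁱ`, the part of `f` in the residue class of `j` modulo `ν`. -/
def residuePart (ν : ℕ+) (j : ℤ) (f : LaurentSeries R) : LaurentSeries R :=
  HahnSeries.ofSuppBddBelow (fun i => f.coeff ((ν : ℕ) * i + j)) <| by
    refine ⟨min 0 (f.order - j), fun i hi => ?_⟩
    by_contra hlt
    rw [not_le, lt_min_iff] at hlt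
    refine hi (HahnSeries.coeff_eq_zero_of_lt_order ?_)
    have h1 : (1 : ℤ) ≤ (ν : ℕ) := by exact_mod_cast ν.pos
    nlinarith [hlt.1, hlt.2]

@[simp]
theorem coeff_residuePart (ν : ℕ+) (j : ℤ) (f : LaurentSeries R) (i : ℤ) :
    (residuePart ν j f).coeff i = f.coeff ((ν : ℕ) * i + j) := rfl

theorem residuePart_add (ν : ℕ+) (j : ℤ) (f g : LaurentSeries R) :
    residuePart ν j (f + g) = residuePart ν j f + residuePart ν j g := by
  ext i
  simp

theorem coeff_ramify_mul_single (ν : ℕ+) (g : LaurentSeries R) (k i : ℤ) :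
    (ramify R ν g * HahnSeries.single k 1).coeff i = (ramify R ν g).coeff (i - k) := by
  have h := HahnSeries.coeff_mul_single_add (r := (1 : R)) (x := ramify R ν g) (a := i - k) (b := k)
  rwa [sub_add_cancel, mul_one] at h

theorem residuePart_ramify_mul_single (ν : ℕ+) (g : LaurentSeries R) (j k : Fin ν) :
    residuePart ν j (ramify R ν g * HahnSeries.single (k : ℤ) 1) = if j = k then g else 0 := by
  ext i
  rw [coeff_residuePart, coeff_ramify_mul_single]
  split_ifs with h
  · rw [h, add_sub_cancel_right, ramify_coeff_mul]
  · rw [ramify_coeff_of_not_dvd, HahnSeries.coeff_zero]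
    rintro ⟨l, hl⟩
    have h1 : ((ν : ℕ) : ℤ) ∣ (j : ℤ) - k := ⟨l - i, by linear_combination hl⟩
    have h2 := Int.eq_zero_of_abs_lt_dvd h1 (by
      rw [abs_lt]
      constructor <;> omega)
    exact h (Fin.ext (by omega))

/-- Every Laurent series is the sum of its residue parts. -/
theorem sum_residuePart (ν : ℕ+) (f : LaurentSeries R) :
    f = ∑ k : Fin ν, ramify R ν (residuePart ν k f) * HahnSeries.single (k : ℤ) 1 := by
  have hν : (0 : ℤ) < (ν : ℕ) := by exact_mod_cast ν.pos
  ext i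
  rw [HahnSeries.coeff_sum]
  let j : Fin ν := ⟨(i % (ν : ℕ)).toNat, by
    have := Int.emod_lt_of_pos i hν
    have := Int.emod_nonneg i hν.ne'
    omega⟩
  have hj : ((j : ℕ) : ℤ) = i % (ν : ℕ) := Int.toNat_of_nonneg (Int.emod_nonneg i hν.ne')
  have hi : i - (j : ℕ) = (ν : ℕ) * (i / (ν : ℕ)) := by
    rw [hj]
    linear_combination -(Int.emod_add_mul_ediv i (ν : ℕ))
  rw [Finset.sum_eq_single j]
  · rw [coeff_ramify_mul_single, hi, ramify_coeff_mul, coeff_residuePart, ← hi, sub_add_cancel]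
  · intro k _ hk
    rw [coeff_ramify_mul_single, ramify_coeff_of_not_dvd]
    rintro ⟨l, hl⟩
    have h1 : ((ν : ℕ) : ℤ) ∣ (j : ℤ) - k := ⟨l - i / (ν : ℕ), by linear_combination hl - hi⟩
    have h2 := Int.eq_zero_of_abs_lt_dvd h1 (by
      rw [abs_lt]
      constructor <;> omega)
    exact hk (Fin.ext (by omega))
  · simp

end Sections

section Symbolic

variable {n : ℕ} {U : TopologicalSpace.Opens (Param n)}

theorem zrat_add (r s : ℚ) : zrat U (r + s) = zrat U r * zrat U s := by
  rw [zrat, zrat, zrat, ← zpow_add, Rat.cast_add, map_add]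

theorem zrat_int (k : ℤ) : zrat U (k : ℚ) = ofKHat U (HahnSeries.single k 1) := by
  rw [zrat, ← zpow_int, Rat.cast_intCast, map_intCast]

theorem zrat_zero : zrat U 0 = 1 := by
  have := zrat_int (U := U) 0
  rw [Int.cast_zero] at this
  rw [this]
  exact map_one _

theorem zrat_nat_mul (k : ℕ) (r : ℚ) : zrat U (k * r) = zrat U r ^ k := by
  induction k with
  | zero => simp [zrat_zero]
  | succ k ih => rw [pow_succ, ← ih, ← zrat_add]; push_cast; ring_nf

/-- The additive map sending `∑ f_i wⁱ` to `∑ f_i z^(i/ν)`. -/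
def toRamifiedAdd (U : TopologicalSpace.Opens (Param n)) (ν : ℕ+) :
    LaurentSeries (Mer U) →+ KBold U where
  toFun f := ∑ j : Fin ν, ofKHat U (residuePart ν j f) * zrat U ((j : ℕ) / (ν : ℕ))
  map_zero' := Finset.sum_eq_zero fun j _ => by
    rw [show residuePart ν j (0 : LaurentSeries (Mer U)) = 0 by ext; simp, map_zero, zero_mul]
  map_add' f g := by
    simp only [residuePart_add, map_add, add_mul, Finset.sum_add_distrib]

theorem toRamifiedAdd_apply (ν : ℕ+) (f : LaurentSeries (Mer U)) : toRamifiedAdd U ν f =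
    ∑ j : Fin ν, ofKHat U (residuePart ν j f) * zrat U ((j : ℕ) / (ν : ℕ)) := rfl

theorem toRamifiedAdd_fin (ν : ℕ+) (g : LaurentSeries (Mer U)) (k : Fin ν) :
    toRamifiedAdd U ν (ramify _ ν g * HahnSeries.single (k : ℤ) 1) =
      ofKHat U g * zrat U ((k : ℕ) / (ν : ℕ)) := by
  rw [toRamifiedAdd_apply, Finset.sum_eq_single k]
  · rw [residuePart_ramify_mul_single, if_pos rfl]
  · intro j _ hj
    rw [residuePart_ramify_mul_single, if_neg hj, map_zero, zero_mul]
  · simp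

theorem toRamifiedAdd_int (ν : ℕ+) (g : LaurentSeries (Mer U)) (k : ℤ) :
    toRamifiedAdd U ν (ramify _ ν g * HahnSeries.single k 1) =
      ofKHat U g * zrat U (k / (ν : ℕ)) := by
  have hν : (0 : ℤ) < (ν : ℕ) := by exact_mod_cast ν.pos
  have hν' : ((ν : ℕ) : ℚ) ≠ 0 := by exact_mod_cast ν.ne_zero
  let j : Fin ν := ⟨(k % (ν : ℕ)).toNat, by
    have := Int.emod_lt_of_pos k hν
    have := Int.emod_nonneg k hν.ne'
    omega⟩
  have hj : ((j : ℕ) : ℤ) = k % (ν : ℕ) := Int.toNat_of_nonneg (Int.emod_nonneg k hν.ne')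
  have hk : k = (ν : ℕ) * (k / (ν : ℕ)) + (j : ℕ) := by
    rw [hj]
    linear_combination -(Int.emod_add_mul_ediv k (ν : ℕ))
  set l := k / (ν : ℕ) with hl
  have h1 : ramify _ ν g * HahnSeries.single k (1 : Mer U) =
      ramify _ ν (g * HahnSeries.single l 1) * HahnSeries.single ((j : ℕ) : ℤ) 1 := by
    rw [map_mul, ramify_single, mul_assoc, HahnSeries.single_mul_single, one_mul, ← hk]
  rw [h1, toRamifiedAdd_fin, map_mul, mul_assoc, ← zrat_int, ← zrat_add]
  congr 2
  rw [hk]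
  push_cast
  field_simp

/-- The ring homomorphism sending `∑ f_i wⁱ` to `∑ f_i z^(i/ν)`. -/
def toRamified (U : TopologicalSpace.Opens (Param n)) (ν : ℕ+) :
    LaurentSeries (Mer U) →+* KBold U where
  __ := toRamifiedAdd U ν
  map_one' := by
    have := toRamifiedAdd_int (U := U) ν 1 0
    simp only [map_one, one_mul, Int.cast_zero, zero_div, zrat_zero] at this
    exact this
  map_mul' f g := by
    change toRamifiedAdd U ν (f * g) = toRamifiedAdd U ν f * toRamifiedAdd U ν g
    rw [toRamifiedAdd_apply ν f, toRamifiedAdd_apply ν g, Finset.sum_mul_sum]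
    conv_lhs => rw [sum_residuePart ν f, sum_residuePart ν g, Finset.sum_mul_sum]
    rw [map_sum]
    refine Finset.sum_congr rfl fun j _ => ?_
    rw [map_sum]
    refine Finset.sum_congr rfl fun k _ => ?_
    rw [mul_mul_mul_comm, ← map_mul, HahnSeries.single_mul_single, one_mul, toRamifiedAdd_int,
      map_mul, mul_mul_mul_comm, ← zrat_add]
    congr 2
    push_cast
    rw [add_div]

theorem toRamified_apply (ν : ℕ+) (f : LaurentSeries (Mer U)) : toRamified U ν f =
    ∑ j : Fin ν, ofKHat U (residuePart ν j f) * zrat U ((j : ℕ) / (ν : ℕ)) := rfl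

theorem toRamified_ramify_mul_single (ν : ℕ+) (g : LaurentSeries (Mer U)) (k : ℤ) :
    toRamified U ν (ramify _ ν g * HahnSeries.single k 1) =
      ofKHat U g * zrat U (k / (ν : ℕ)) := toRamifiedAdd_int ν g k

theorem toRamified_ramify (ν : ℕ+) (g : LaurentSeries (Mer U)) :
    toRamified U ν (ramify _ ν g) = ofKHat U g := by
  have := toRamified_ramify_mul_single (U := U) ν g 0
  rw [Int.cast_zero, zero_div, zrat_zero, mul_one] at this
  rw [← this]
  congr 1
  exact (mul_one _).symm

theorem toRamified_single (ν : ℕ+) (k : ℤ) (c : Mer U) :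
    toRamified U ν (HahnSeries.single k c) = ofMer U c * zrat U (k / (ν : ℕ)) := by
  have h := toRamified_ramify_mul_single ν (HahnSeries.C c) k
  rw [HahnSeries.C_apply, ramify_single, mul_zero, HahnSeries.single_mul_single, zero_add, mul_one] at h
  exact h

theorem toRamified_C (ν : ℕ+) (c : Mer U) : toRamified U ν (HahnSeries.C c) = ofMer U c := by
  rw [HahnSeries.C_apply, toRamified_single, Int.cast_zero, zero_div, zrat_zero, mul_one]

theorem toRamified_mem (ν : ℕ+) (f : LaurentSeries (Mer U)) :
    toRamified U ν f ∈ Ramified U ν := by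
  have h : zrat U (1 / (ν : ℕ)) ∈ Ramified U ν := Algebra.subset_adjoin (Set.mem_singleton _)
  rw [toRamified_apply]
  refine Subalgebra.sum_mem _ fun j _ => Subalgebra.mul_mem _ ?_ ?_
  · exact (Ramified U ν).algebraMap_mem (residuePart ν j f)
  · rw [div_eq_mul_one_div, zrat_nat_mul]
    exact Subalgebra.pow_mem _ h _

theorem hasAnalyticCoeffs_toRamified {V : TopologicalSpace.Opens (Param n)} (hVU : V ≤ U) (ν : ℕ+)
    {f : LaurentSeries (Mer U)} (hf : ∀ i, Mer.IsAnalyticOn (f.coeff i) hVU) :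
    HasAnalyticCoeffs hVU ν (toRamified U ν f) :=
  ⟨fun j => residuePart ν j f, toRamified_apply ν f, fun _ _ => hf _⟩

theorem dz_ofKHat' (f : KHat U) :
    dz U (ofKHat U f) = ofKHat U (HahnSeries.single (-1) 1) * ofKHat U (euler f) := by
  rw [dz_ofKHat, derivative_eq_euler, map_mul]

theorem dz_ofMer (c : Mer U) : dz U (ofMer U c) = 0 := by
  change dz U (ofKHat U (HahnSeries.C c)) = 0
  rw [dz_ofKHat', HahnSeries.C_apply, euler_single]
  simp

theorem dz_zpow' (a : Mer U) :
    dz U (zpow a) = ofKHat U (HahnSeries.single (-1) 1) * ofMer U a * zpow a := by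
  rw [dz_zpow, ofMer, RingHom.comp_apply, ← map_mul, HahnSeries.C_apply,
    HahnSeries.single_mul_single, add_zero, one_mul]

theorem dz_zrat (r : ℚ) : dz U (zrat U r) =
    ofKHat U (HahnSeries.single (-1) 1) * ofMer U (Mer.const U r) * zrat U r := dz_zpow' _

/-- The derivation `z ∂_z` acts on series in `w = z^(1/ν)` as `ν⁻¹ w ∂_w`. -/
theorem dz_toRamified (ν : ℕ+) (f : LaurentSeries (Mer U)) :
    ((ν : ℕ) : KBold U) * dz U (toRamified U ν f) =
      ofKHat U (HahnSeries.single (-1) 1) * toRamified U ν (euler f) := by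
  have hν' : ((ν : ℕ) : ℚ) ≠ 0 := by exact_mod_cast ν.ne_zero
  have key : ∀ (g : LaurentSeries (Mer U)) (k : Fin ν),
      ((ν : ℕ) : KBold U) * dz U (toRamified U ν (ramify _ ν g * HahnSeries.single (k : ℤ) 1)) =
      ofKHat U (HahnSeries.single (-1) 1) *
        toRamified U ν (euler (ramify _ ν g * HahnSeries.single (k : ℤ) 1)) := by
    intro g k
    have hcast : ((ν : ℕ) : KBold U) * ofMer U (Mer.const U (((k : ℕ) / (ν : ℕ) : ℚ) : ℂ)) =
        ((k : ℕ) : KBold U) := by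
      rw [← map_natCast (ofMer U), ← map_natCast (Mer.const U), ← map_mul, ← map_mul,
        ← Rat.cast_natCast, ← Rat.cast_mul, mul_div_cancel₀ _ hν', Rat.cast_natCast, map_natCast,
        map_natCast]
    have heul : toRamified U ν (euler (ramify _ ν g * HahnSeries.single (k : ℤ) 1)) =
        (((ν : ℕ) : KBold U) * ofKHat U (euler g) + ((k : ℕ) : KBold U) * ofKHat U g) *
          zrat U ((k : ℕ) / (ν : ℕ)) := by
      have h1 : HahnSeries.single (k : ℤ) (((k : ℤ) : Mer U) * 1) =
          ((k : ℕ) : LaurentSeries (Mer U)) * HahnSeries.single (k : ℤ) 1 := by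
        ext i
        rw [← nsmul_eq_mul, HahnSeries.coeff_smul]
        by_cases h : i = k
        · simp [h]
        · simp [HahnSeries.coeff_single_of_ne h]
      rw [euler_mul, euler_single, euler_ramify, h1, map_add,
        show ramify _ ν g * (((k : ℕ) : LaurentSeries (Mer U)) * HahnSeries.single (k : ℤ) 1) =
          ((k : ℕ) : LaurentSeries (Mer U)) * (ramify _ ν g * HahnSeries.single (k : ℤ) 1) by ring,
        show HahnSeries.single (k : ℤ) 1 *
          (((ν : ℕ) : LaurentSeries (Mer U)) * ramify _ ν (euler g)) =
          ((ν : ℕ) : LaurentSeries (Mer U)) *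
            (ramify _ ν (euler g) * HahnSeries.single (k : ℤ) 1) by ring,
        map_mul (toRamified U ν) ((k : ℕ) : LaurentSeries (Mer U)),
        map_mul (toRamified U ν) ((ν : ℕ) : LaurentSeries (Mer U)), map_natCast, map_natCast,
        toRamified_ramify_mul_single, toRamified_ramify_mul_single, Int.cast_natCast]
      ring
    rw [heul, toRamified_ramify_mul_single, Int.cast_natCast, Derivation.leibniz, dz_ofKHat',
      dz_zrat, smul_eq_mul, smul_eq_mul]
    linear_combination ofKHat U g * ofKHat U (HahnSeries.single (-1) 1) *
      zrat U ((k : ℕ) / (ν : ℕ)) * hcast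
  let φ : LaurentSeries (Mer U) →+ KBold U :=
    (AddMonoidHom.mulLeft ((ν : ℕ) : KBold U)).comp
      ((dz U).toLinearMap.toAddMonoidHom.comp (toRamified U ν).toAddMonoidHom)
  let χ : LaurentSeries (Mer U) →+ KBold U :=
    (AddMonoidHom.mulLeft (ofKHat U (HahnSeries.single (-1) 1))).comp
      ((toRamified U ν).toAddMonoidHom.comp (AddMonoidHom.mk' euler euler_add))
  change φ f = χ f
  rw [sum_residuePart ν f, map_sum, map_sum]
  exact Finset.sum_congr rfl fun k _ => key _ k

/-! ### The exponential parts -/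

/-- The exponential part `q = ∑ j⁻¹ d_(-j) z^(-j/ν)` belonging to a series `d` in `w = z^(1/ν)`; it
satisfies `ν z ∂_z q = - ∑_(j > 0) d_(-j) z^(-j/ν)`. -/
def expPart (ν : ℕ+) (d : LaurentSeries (Mer U)) : ExpPart U :=
  ∑ j ∈ Finset.range d.order.natAbs,
    Finsupp.single ⟨((j + 1 : ℕ) : ℚ) / (ν : ℕ), by have := ν.pos; positivity⟩
      (Mer.const U ((j + 1 : ℕ) : ℂ)⁻¹ * d.coeff (-(j + 1 : ℕ)))

theorem expDeriv_single (r : {r : ℚ // 0 < r}) (c : Mer U) :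
    expDeriv (Finsupp.single r c) =
      ofMer U (Mer.const U (-(r.1 : ℂ)) * c) * zrat U (-r.1 - 1) :=
  Finsupp.sum_single_index (by simp)

theorem eq_sum_single_add_C {R : Type*} [CommRing R] (d : LaurentSeries R)
    (hd : ∀ k > 0, d.coeff k = 0) :
    d = ∑ j ∈ Finset.range d.order.natAbs,
      HahnSeries.single (-(j + 1 : ℕ) : ℤ) (d.coeff (-(j + 1 : ℕ))) + HahnSeries.C (d.coeff 0) := by
  ext k
  rw [HahnSeries.coeff_add, HahnSeries.coeff_sum, HahnSeries.C_apply]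
  rcases lt_trichotomy k 0 with hk | rfl | hk
  · rw [HahnSeries.coeff_single_of_ne hk.ne, add_zero]
    by_cases hko : k < d.order
    · rw [HahnSeries.coeff_eq_zero_of_lt_order hko, Finset.sum_eq_zero]
      intro j _
      by_cases h : k = -(j + 1 : ℕ)
      · rw [← h, HahnSeries.coeff_single_same, HahnSeries.coeff_eq_zero_of_lt_order hko]
      · exact HahnSeries.coeff_single_of_ne h
    · rw [Finset.sum_eq_single (-k - 1).toNat]
      · have h : (-(((-k - 1).toNat + 1 : ℕ) : ℤ)) = k := by omega
        rw [h, HahnSeries.coeff_single_same]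
      · intro j _ hj
        exact HahnSeries.coeff_single_of_ne (by omega)
      · intro h
        rw [Finset.mem_range] at h
        omega
  · rw [HahnSeries.coeff_single_same, Finset.sum_eq_zero, zero_add]
    intro j _
    exact HahnSeries.coeff_single_of_ne (by omega)
  · rw [hd k hk, HahnSeries.coeff_single_of_ne hk.ne', add_zero, Finset.sum_eq_zero]
    intro j _
    exact HahnSeries.coeff_single_of_ne (by omega)

theorem expDeriv_expPart (ν : ℕ+) (d : LaurentSeries (Mer U)) (hd : ∀ k > 0, d.coeff k = 0) :
    ((ν : ℕ) : KBold U) * expDeriv (expPart ν d) =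
      - (ofKHat U (HahnSeries.single (-1) 1) * (toRamified U ν d - ofMer U (d.coeff 0))) := by
  have hν' : ((ν : ℕ) : ℂ) ≠ 0 := by exact_mod_cast ν.ne_zero
  have hsub : toRamified U ν d - ofMer U (d.coeff 0) = ∑ j ∈ Finset.range d.order.natAbs,
      toRamified U ν (HahnSeries.single (-(j + 1 : ℕ) : ℤ) (d.coeff (-(j + 1 : ℕ)))) := by
    conv_lhs => rw [eq_sum_single_add_C d hd]
    rw [map_add, toRamified_C, map_sum]
    rw [← eq_sum_single_add_C d hd]
    ring
  have hexp : expDeriv (expPart ν d) = ∑ j ∈ Finset.range d.order.natAbs, expDeriv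
      (Finsupp.single (⟨((j + 1 : ℕ) : ℚ) / (ν : ℕ), by have := ν.pos; positivity⟩ : {r : ℚ // 0 < r})
        (Mer.const U ((j + 1 : ℕ) : ℂ)⁻¹ * d.coeff (-(j + 1 : ℕ)))) :=
    map_sum (AddMonoidHom.mk' expDeriv expDeriv_add) _ _
  rw [hsub, hexp, Finset.mul_sum, Finset.mul_sum, ← Finset.sum_neg_distrib]
  refine Finset.sum_congr rfl fun j _ => ?_
  have hj : ((j + 1 : ℕ) : ℂ) ≠ 0 := by exact_mod_cast Nat.succ_ne_zero j
  have hc : ((ν : ℕ) : Mer U) * (Mer.const U (-((((j + 1 : ℕ) : ℚ) / (ν : ℕ) : ℚ) : ℂ)) *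
      Mer.const U ((j + 1 : ℕ) : ℂ)⁻¹) = -1 := by
    rw [← map_natCast (Mer.const U), ← map_mul, ← map_mul, ← map_one (Mer.const U), ← map_neg]
    congr 1
    rw [Rat.cast_div, Rat.cast_natCast, Rat.cast_natCast]
    field_simp
  have hz : zrat U (-(((j + 1 : ℕ) : ℚ) / (ν : ℕ)) - 1) =
      ofKHat U (HahnSeries.single (-1) 1) *
        zrat U (((-(j + 1 : ℕ) : ℤ) : ℚ) / (ν : ℕ)) := by
    rw [← zrat_int, ← zrat_add]
    congr 1
    push_cast
    ring
  have hcm : ((ν : ℕ) : KBold U) * ofMer U (Mer.const U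
      (-((((j + 1 : ℕ) : ℚ) / (ν : ℕ) : ℚ) : ℂ)) *
        (Mer.const U ((j + 1 : ℕ) : ℂ)⁻¹ * d.coeff (-(j + 1 : ℕ)))) =
      - ofMer U (d.coeff (-(j + 1 : ℕ))) := by
    rw [← map_natCast (ofMer U), ← map_mul, ← map_neg]
    congr 1
    linear_combination d.coeff (-(j + 1 : ℕ)) * hc
  rw [expDeriv_single, toRamified_single]
  dsimp only
  rw [hz, ← mul_assoc, hcm]
  ring

theorem dz_zexp_expPart (ν : ℕ+) (d : LaurentSeries (Mer U)) (hd : ∀ k > 0, d.coeff k = 0) :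
    ((ν : ℕ) : KBold U) * dz U (zexp (expPart ν d)) =
      - (ofKHat U (HahnSeries.single (-1) 1) * (toRamified U ν d - ofMer U (d.coeff 0)) *
        zexp (expPart ν d)) := by
  rw [dz_zexp, ← mul_assoc, expDeriv_expPart ν d hd, neg_mul]

theorem isUnit_zpow (a : Mer U) : IsUnit (zpow a) := by
  refine IsUnit.of_mul_eq_one (zpow (-a)) ?_
  rw [← zpow_add, add_neg_cancel, ← Int.cast_zero, zpow_int]
  exact map_one _

theorem isUnit_zexp (q : ExpPart U) : IsUnit (zexp q) :=
  IsUnit.of_mul_eq_one (zexp (-q)) (by rw [← zexp_add, add_neg_cancel, zexp_zero])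

end Symbolic

/-! ### The normal form over meromorphic functions -/

/-- The Euler derivation of Laurent series. -/
def eulerDer (R : Type*) [CommRing R] : AddDer (LaurentSeries R) where
  toFun := euler
  map_zero' := by ext; simp [coeff_euler]
  map_add' := euler_add
  leibniz' := euler_mul

theorem IsGauge.map {F F' : Type*} [CommRing F] [CommRing F'] {θ : AddDer F} {θ' : AddDer F'}
    {φ : F →+* F'} (hφ : ∀ x, φ (θ x) = θ' (φ x)) {m : Type*} [Fintype m] [DecidableEq m]
    {M G M' : Matrix m m F} (h : IsGauge θ M G M') :
    IsGauge θ' (M.map φ) (G.map φ) (M'.map φ) := by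
  have h1 := congrArg (fun X : Matrix m m F => X.map φ) h
  simp only [Matrix.map_mul] at h1
  rw [IsGauge, ← h1]
  ext i j
  simp [Matrix.mul_apply, hφ]

theorem IsGauge.of_map {F F' : Type*} [CommRing F] [CommRing F'] {θ : AddDer F} {θ' : AddDer F'}
    {φ : F →+* F'} (hφ : ∀ x, φ (θ x) = θ' (φ x)) (hinj : Function.Injective φ)
    {m : Type*} [Fintype m] [DecidableEq m] {M G M' : Matrix m m F}
    (h : IsGauge θ' (M.map φ) (G.map φ) (M'.map φ)) : IsGauge θ M G M' := by
  apply Matrix.map_injective hinj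
  beta_reduce
  rw [Matrix.map_mul, ← h]
  ext i j
  simp [Matrix.mul_apply, hφ]

theorem mapLaurent_injective {R S : Type*} [CommRing R] [CommRing S] {f : R →+* S}
    (hf : Function.Injective f) : Function.Injective (mapLaurent f) := fun x y h => by
  ext i
  exact hf (congrArg (fun z : LaurentSeries S => z.coeff i) h)

theorem mapLaurent_mapLaurent {R S T : Type*} [CommRing R] [CommRing S] [CommRing T]
    (f : R →+* S) (g : S →+* T) (x : LaurentSeries R) :
    mapLaurent g (mapLaurent f x) = mapLaurent (g.comp f) x := rfl

theorem mapLaurent_C {R S : Type*} [CommRing R] [CommRing S] (f : R →+* S) (a : R) :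
    mapLaurent f (HahnSeries.C a) = HahnSeries.C (f a) := mapLaurent_single f 0 a

/-- The matrix `-μ w^μ A(w^μ)`: in the variable `w = z^(1/μ)`, the system `∂_z Y = A Y` reads
`(w ∂_w + ramConn μ A) Y = 0`. -/
def ramConn {R : Type*} [CommRing R] {m : ℕ} (μ : ℕ+)
    (A : Matrix (Fin m) (Fin m) (LaurentSeries R)) : Matrix (Fin m) (Fin m) (LaurentSeries R) :=
  A.map fun a => ((μ : ℕ) : LaurentSeries R) * ramify R μ (-(HahnSeries.single 1 1 * a))

theorem ramConn_map {R S : Type*} [CommRing R] [CommRing S] {m : ℕ} (μ : ℕ+) (f : R →+* S)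
    (A : Matrix (Fin m) (Fin m) (LaurentSeries R)) :
    (ramConn μ A).map (mapLaurent f) = ramConn μ (A.map (mapLaurent f)) := by
  ext1 i j
  simp only [ramConn, Matrix.map_apply, map_mul, map_natCast, mapLaurent_ramify, map_neg,
    mapLaurent_single, map_one]

theorem diagonal_add_map_C_map {R S : Type*} [CommRing R] [CommRing S] {m : ℕ} (f : R →+* S)
    (d : Fin m → LaurentSeries R) (N : Matrix (Fin m) (Fin m) R) :
    (Matrix.diagonal d + N.map HahnSeries.C).map (mapLaurent f) =
      Matrix.diagonal (fun i => mapLaurent f (d i)) + (N.map f).map HahnSeries.C := by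
  ext1 i j
  rw [Matrix.map_apply, Matrix.add_apply, Matrix.add_apply, map_add, Matrix.map_apply,
    mapLaurent_C]
  by_cases h : i = j
  · subst h
    simp
  · rw [Matrix.diagonal_apply_ne _ h, Matrix.diagonal_apply_ne _ h, map_zero]
    rfl

/-- The formal normal form of a system with coefficients meromorphic in the parameters. -/
theorem exists_meromorphic_normal_form {n m : ℕ} {U : TopologicalSpace.Opens (Param n)}
    (hU : IsPolydisc U) (A : Matrix (Fin m) (Fin m) (KHat U)) :
    ∃ (V : TopologicalSpace.Opens (Param n)) (hVU : V ≤ U), IsPolydisc V ∧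
      ∃ (μ : ℕ+) (H H' : Matrix (Fin m) (Fin m) (KHat V)) (d : Fin m → KHat V)
        (N : Matrix (Fin m) (Fin m) (Mer V)), H * H' = 1 ∧ H' * H = 1 ∧
        IsGauge (eulerDer (Mer V)) (ramConn μ (A.map (KHat.restrict hVU))) H
          (Matrix.diagonal d + N.map HahnSeries.C) ∧
        (∀ i j, N i j ≠ 0 → i < j ∧ d i = d j) ∧ (∀ i, ∀ k > 0, (d i).coeff k = 0) ∧
        ((∀ i j k, Mer.IsAnalyticOn ((A i j).coeff k) (le_refl U)) →
          ∃ (W : TopologicalSpace.Opens (Param n)) (hWV : W ≤ V), IsPolydisc W ∧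
            ∀ i j k, Mer.IsAnalyticOn ((H i j).coeff k) hWV) := by
  have hfield := Mer.isField hU.nonempty hU.isPreconnected
  have := hfield.isDomain
  let e : FractionRing (Mer U) ≃+* Mer U := (RingEquiv.ofBijective
    (algebraMap (Mer U) (FractionRing (Mer U))) (IsField.localization_map_bijective
      (M := nonZeroDivisors (Mer U)) zero_notMem_nonZeroDivisors hfield)).symm
  have : CharZero (FractionRing (Mer U)) := charZero_of_injective_ringHom
    (f := e.symm.toRingHom.comp (Mer.const U)) (RingHom.injective _)
  have : CharZero (AlgebraicClosure (FractionRing (Mer U))) := charZero_of_injective_ringHom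
    (f := algebraMap (FractionRing (Mer U)) (AlgebraicClosure (FractionRing (Mer U))))
    (RingHom.injective _)
  set i₀ : Mer U →+* AlgebraicClosure (FractionRing (Mer U)) :=
    (algebraMap _ _).comp e.symm.toRingHom with hi₀
  set R₀ : Set (AlgebraicClosure (FractionRing (Mer U))) :=
    {x | ∃ a b k, x = i₀ ((A a b).coeff k)} with hR₀
  have hA : ∀ a b, -(HahnSeries.single 1 1 * mapLaurent i₀ (A a b)) ∈ Tame R₀ := fun a b =>
    (Tame R₀).neg_mem ((Tame R₀).mul_mem (single_mem_tame 1 1)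
      (mem_tame_of_coeff_mem fun k => ⟨a, b, k, rfl⟩))
  obtain ⟨μ, H, H', d, N, hHH, hHH', hG, hN, -, hd⟩ :=
    exists_normal_form m (Matrix.of fun a b => (⟨_, hA a b⟩ : Tame R₀))
  have hev : ∀ᶠ R in tameFilter R₀, (∀ i j, CoeffsIn R (H i j).1) ∧
      (∀ i j, CoeffsIn R (H' i j).1) ∧ (∀ i j, N i j ∈ R) ∧ ∀ i, CoeffsIn R (d i).1 := by
    simp only [Filter.eventually_and, Filter.eventually_all]
    exact ⟨fun i j => (H i j).2, fun i j => (H' i j).2, fun i j => eventually_mem _ _,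
      fun i => (d i).2⟩
  obtain ⟨S, hS, hSR⟩ := eventually_tameFilter.1 hev
  obtain ⟨R, V, hVU, σ, hV, hRS, hσ, R', W, hWV, hW, hRS', hR', hσ'⟩ :=
    exists_specialization e hU.nonempty hS
  have hi₀R : ∀ c, i₀ c ∈ R := fun c => (hσ (e.symm c)).1
  obtain ⟨hH, hH', hNR, hdR⟩ := hSR R (by
    rintro _ ⟨a, b, k, rfl⟩
    exact hi₀R _) hRS
  choose Hr hHr using fun i j => coeffsIn_iff.1 (hH i j)
  choose Hr' hHr' using fun i j => coeffsIn_iff.1 (hH' i j)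
  choose dr hdr using fun i => coeffsIn_iff.1 (hdR i)
  set Nr : Matrix (Fin m) (Fin m) R := Matrix.of fun i j => ⟨N i j, hNR i j⟩ with hNr
  set iR : Mer U →+* R := i₀.codRestrict R hi₀R with hiR
  have hinj : Function.Injective (mapLaurent R.subtype) :=
    mapLaurent_injective Subtype.val_injective
  have eH : (Matrix.of Hr).map (mapLaurent R.subtype) = H.map (Tame R₀).subtype :=
    Matrix.ext hHr
  have eH' : (Matrix.of Hr').map (mapLaurent R.subtype) = H'.map (Tame R₀).subtype :=
    Matrix.ext hHr'
  have hHHr : Matrix.of Hr * Matrix.of Hr' = 1 := by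
    apply Matrix.map_injective hinj
    beta_reduce
    rw [Matrix.map_mul, eH, eH', ← Matrix.map_mul, hHH, Matrix.map_one _ (map_zero _) (map_one _),
      Matrix.map_one _ (map_zero _) (map_one _)]
  have hHHr' : Matrix.of Hr' * Matrix.of Hr = 1 := by
    apply Matrix.map_injective hinj
    beta_reduce
    rw [Matrix.map_mul, eH, eH', ← Matrix.map_mul, hHH', Matrix.map_one _ (map_zero _) (map_one _),
      Matrix.map_one _ (map_zero _) (map_one _)]
  have hGr : IsGauge (eulerDer R) (ramConn μ (A.map (mapLaurent iR))) (Matrix.of Hr)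
      (Matrix.diagonal dr + Nr.map HahnSeries.C) := by
    refine IsGauge.of_map (θ' := eulerDer _) (mapLaurent_euler R.subtype) hinj ?_
    rw [ramConn_map, eH, diagonal_add_map_C_map]
    have h1 := hG.map (θ' := eulerDer _) (φ := (Tame R₀).subtype) fun _ => rfl
    convert h1 using 1
    · ext1 i j
      simp only [ramConn, ramMat, Matrix.map_apply, Matrix.smul_apply, smul_eq_mul, map_mul,
        map_natCast, Matrix.of_apply, mapLaurent_mapLaurent]
      rfl
    · ext1 i j
      rw [Matrix.map_apply, Matrix.add_apply, Matrix.add_apply, map_add]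
      congr 1
      by_cases h : i = j
      · subst h
        rw [Matrix.diagonal_apply_eq, Matrix.diagonal_apply_eq]
        exact hdr i
      · rw [Matrix.diagonal_apply_ne _ h, Matrix.diagonal_apply_ne _ h, map_zero]
  have hσi : σ.comp iR = Mer.restrict hVU := by
    ext1 c
    obtain ⟨h, h'⟩ := hσ (e.symm c)
    rw [RingEquiv.apply_symm_apply] at h'
    exact h'
  refine ⟨V, hVU, hV, μ, (Matrix.of Hr).map (mapLaurent σ), (Matrix.of Hr').map (mapLaurent σ),
    fun i => mapLaurent σ (dr i), Nr.map σ, ?_, ?_, ?_, ?_, ?_, ?_⟩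
  · rw [← Matrix.map_mul, hHHr, Matrix.map_one _ (map_zero _) (map_one _)]
  · rw [← Matrix.map_mul, hHHr', Matrix.map_one _ (map_zero _) (map_one _)]
  · have h1 := hGr.map (θ' := eulerDer _) (mapLaurent_euler σ)
    rw [ramConn_map, diagonal_add_map_C_map] at h1
    convert h1 using 2
    ext1 i j
    simp only [Matrix.map_apply, mapLaurent_mapLaurent, hσi]
    rfl
  · intro i j hij
    have hne : N i j ≠ 0 := fun h0 => hij (by
      have : Nr i j = 0 := Subtype.ext h0
      rw [Matrix.map_apply, this, map_zero])
    refine ⟨(hN i j hne).1, congrArg _ (hinj ?_)⟩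
    rw [hdr, hdr, (hN i j hne).2]
  · intro i k hk
    have : (dr i).coeff k = 0 := Subtype.ext (by
      have h1 := congrArg (fun x => HahnSeries.coeff x k) (hdr i)
      simp only [coeff_mapLaurent] at h1
      exact h1.trans (hd i k hk))
    rw [coeff_mapLaurent, this, map_zero]
  · intro hAn
    refine ⟨W, hWV, hW, fun i j k => hσ' _ ?_⟩
    have h1 := (hSR R' (by
      rintro _ ⟨a, b, k, rfl⟩
      refine hR' _ ?_
      rw [show e (e.symm.toRingHom ((A a b).coeff k)) = (A a b).coeff k from
        e.apply_symm_apply _]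
      exact hAn a b k) hRS').1 i j k
    rw [← hHr] at h1
    exact h1

/-! ### The fundamental solution -/

theorem diagonal_commute {R : Type*} [CommRing R] {m : ℕ} {v : Fin m → R}
    {N : Matrix (Fin m) (Fin m) R} (h : ∀ i j, N i j ≠ 0 → v i = v j) :
    Matrix.diagonal v * N = N * Matrix.diagonal v := by
  ext i j
  rw [Matrix.diagonal_mul, Matrix.mul_diagonal]
  by_cases hN : N i j = 0
  · rw [hN, mul_zero, zero_mul]
  · rw [h i j hN, mul_comm]

theorem pow_eq_zero_of_strictUpper {R : Type*} [CommRing R] {m : ℕ}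
    {N : Matrix (Fin m) (Fin m) R} (h : ∀ i j, N i j ≠ 0 → i < j) : N ^ m = 0 := by
  have key : ∀ (k : ℕ) (i j : Fin m), (N ^ k) i j ≠ 0 → (i : ℕ) + k ≤ j := by
    intro k
    induction k with
    | zero =>
      intro i j hij
      rw [pow_zero, Matrix.one_apply] at hij
      have : i = j := by
        by_contra hne
        exact hij (if_neg hne)
      rw [this, add_zero]
    | succ k ih =>
      intro i j hij
      rw [pow_succ, Matrix.mul_apply] at hij
      obtain ⟨l, -, hl⟩ := Finset.exists_ne_zero_of_sum_ne_zero hij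
      have h1 := ih i l (left_ne_zero_of_mul hl)
      have h2 : (l : ℕ) < j := h l j (right_ne_zero_of_mul hl)
      omega
  ext i j
  by_contra hne
  have := key m i j hne
  omega

section Solution

variable {n m : ℕ} {U : TopologicalSpace.Opens (Param n)}

/-- The derivation `∂_z` as an additive map with the product rule. -/
def dzDer (U : TopologicalSpace.Opens (Param n)) : AddDer (KBold U) where
  toFun := dz U
  map_zero' := map_zero _
  map_add' := map_add _
  leibniz' x y := by rw [Derivation.leibniz, smul_eq_mul, smul_eq_mul]

theorem dzDer_apply (x : KBold U) : dzDer U x = dz U x := rfl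

/-- The truncated exponential series `∑_(i < k) (log ^ i / i!) N ^ i`. -/
def logExp (N : Matrix (Fin m) (Fin m) (Mer U)) (k : ℕ) : Matrix (Fin m) (Fin m) (KBold U) :=
  ∑ i ∈ Finset.range k,
    (ofMer U (Mer.const U ((i.factorial : ℂ)⁻¹)) * zlog U ^ i) • (N ^ i).map (ofMer U)

theorem logExp_succ (N : Matrix (Fin m) (Fin m) (Mer U)) (k : ℕ) :
    logExp N (k + 1) = logExp N k +
      (ofMer U (Mer.const U ((k.factorial : ℂ)⁻¹)) * zlog U ^ k) • (N ^ k).map (ofMer U) :=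
  Finset.sum_range_succ _ _

theorem dz_zlog_pow (k : ℕ) : dz U (zlog U ^ (k + 1)) =
    ((k + 1 : ℕ) : KBold U) * zlog U ^ k * ofKHat U (HahnSeries.single (-1) 1) := by
  rw [Derivation.leibniz_pow, dz_zlog, Nat.add_sub_cancel, smul_eq_mul, nsmul_eq_mul, mul_assoc]

theorem map_dzDer_smul_ofMer (c : KBold U) (N : Matrix (Fin m) (Fin m) (Mer U)) :
    (c • N.map (ofMer U)).map (dzDer U) = dz U c • N.map (ofMer U) := by
  ext i j
  simp only [Matrix.map_apply, Matrix.smul_apply, smul_eq_mul, dzDer_apply]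
  rw [Derivation.leibniz, dz_ofMer, smul_zero, zero_add, smul_eq_mul, mul_comm]

theorem logExp_map_dz_succ (N : Matrix (Fin m) (Fin m) (Mer U)) (k : ℕ) :
    (logExp N (k + 1)).map (dzDer U) =
      ofKHat U (HahnSeries.single (-1) 1) • (N.map (ofMer U) * logExp N k) := by
  induction k with
  | zero =>
    rw [logExp_succ]
    simp only [logExp, Finset.range_zero, Finset.sum_empty, zero_add, Matrix.mul_zero, smul_zero]
    rw [map_dzDer_smul_ofMer]
    simp
  | succ k ih =>
    have hfac : Mer.const U (((k + 1).factorial : ℂ)⁻¹) * ((k + 1 : ℕ) : Mer U) =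
        Mer.const U ((k.factorial : ℂ)⁻¹) := by
      rw [← map_natCast (Mer.const U), ← map_mul]
      congr 1
      rw [Nat.factorial_succ]
      have h1 : ((k + 1 : ℕ) : ℂ) ≠ 0 := by exact_mod_cast Nat.succ_ne_zero k
      have h2 : (k.factorial : ℂ) ≠ 0 := by exact_mod_cast k.factorial_ne_zero
      rw [Nat.cast_mul]
      field_simp
    have hfac' := congrArg (ofMer U) hfac
    rw [map_mul, map_natCast] at hfac'
    have hd : dz U (ofMer U (Mer.const U (((k + 1).factorial : ℂ)⁻¹)) * zlog U ^ (k + 1)) =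
        ofKHat U (HahnSeries.single (-1) 1) *
          (ofMer U (Mer.const U ((k.factorial : ℂ)⁻¹)) * zlog U ^ k) := by
      rw [Derivation.leibniz, dz_ofMer, dz_zlog_pow, smul_zero, add_zero, smul_eq_mul]
      linear_combination zlog U ^ k * ofKHat U (HahnSeries.single (-1) 1) * hfac'
    rw [logExp_succ, Matrix.map_add _ (map_add _), ih, map_dzDer_smul_ofMer, hd, logExp_succ,
      Matrix.mul_add, smul_add, Matrix.mul_smul, ← Matrix.map_mul, ← pow_succ', smul_smul]

theorem logExp_map_dz {N : Matrix (Fin m) (Fin m) (Mer U)} (hN : N ^ m = 0) :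
    (logExp N m).map (dzDer U) =
      ofKHat U (HahnSeries.single (-1) 1) • (N.map (ofMer U) * logExp N m) := by
  cases m with
  | zero => exact Matrix.ext fun i => i.elim0
  | succ k =>
    rw [logExp_map_dz_succ, logExp_succ N k, Matrix.mul_add, Matrix.mul_smul, ← Matrix.map_mul,
      ← pow_succ', hN, Matrix.map_zero _ (map_zero _), smul_zero, add_zero]

theorem logExp_commute {B : Matrix (Fin m) (Fin m) (KBold U)}
    {N : Matrix (Fin m) (Fin m) (Mer U)} (h : B * N.map (ofMer U) = N.map (ofMer U) * B) (k : ℕ) :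
    B * logExp N k = logExp N k * B := by
  have hpow : ∀ i, B * (N ^ i).map (ofMer U) = (N ^ i).map (ofMer U) * B := by
    intro i
    have h1 : (N ^ i).map (ofMer U) = (N.map (ofMer U)) ^ i := map_pow (ofMer U).mapMatrix N i
    rw [h1]
    exact (show Commute B (N.map (ofMer U)) from h).pow_right i
  rw [logExp, Finset.mul_sum, Finset.sum_mul]
  exact Finset.sum_congr rfl fun i _ => by rw [Matrix.mul_smul, Matrix.smul_mul, hpow]

theorem isUnit_logExp {N : Matrix (Fin m) (Fin m) (Mer U)} (hN : N ^ m = 0) :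
    IsUnit (logExp N m) := by
  cases m with
  | zero => exact isUnit_of_subsingleton _
  | succ k =>
    set N' := N.map (ofMer U) with hN'
    have hpow : ∀ i, (N ^ i).map (ofMer U) = N' ^ i := fun i => map_pow (ofMer U).mapMatrix N i
    set B := ∑ i ∈ Finset.range k, (ofMer U (Mer.const U (((i + 1).factorial : ℂ)⁻¹)) *
      zlog U ^ (i + 1)) • N' ^ i with hB
    have hE : logExp N (k + 1) = 1 + N' * B := by
      rw [logExp, Finset.sum_range_succ', hB, Finset.mul_sum]
      refine (add_comm _ _).trans ?_
      congr 1
      · simp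
      · exact Finset.sum_congr rfl fun i _ => by rw [hpow, Matrix.mul_smul, pow_succ' N']
    have hcomm : Commute N' B := Commute.sum_right _ _ _ fun i _ =>
      ((Commute.refl N').pow_right i).smul_right _
    have hnil : IsNilpotent N' := ⟨k + 1, by
      rw [← hpow, hN, Matrix.map_zero _ (map_zero _)]⟩
    rw [hE]
    exact (hcomm.isNilpotent_mul_right hnil).isUnit_one_add

theorem isUnit_diagonal {R : Type*} [CommRing R] {v : Fin m → R} (h : ∀ i, IsUnit (v i)) :
    IsUnit (Matrix.diagonal v) := by
  rw [Matrix.isUnit_iff_isUnit_det, Matrix.det_diagonal]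
  exact IsUnit.prod_univ_iff.2 h

theorem map_dzDer_diagonal (v : Fin m → KBold U) :
    (Matrix.diagonal v).map (dzDer U) = Matrix.diagonal fun i => dz U (v i) :=
  Matrix.diagonal_map (map_zero _)

theorem ofKHat_single_neg_one_mul :
    ofKHat U (HahnSeries.single (-1) 1) * ofKHat U (HahnSeries.single 1 1) = 1 := by
  rw [← map_mul, HahnSeries.single_mul_single, mul_one]
  exact map_one _

theorem isUnit_natCast_KBold (ν : ℕ+) : IsUnit ((ν : ℕ) : KBold U) := by
  refine IsUnit.of_mul_eq_one (ofMer U (Mer.const U ((ν : ℕ) : ℂ)⁻¹)) ?_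
  rw [← map_natCast (ofMer U), ← map_natCast (Mer.const U), ← map_mul, ← map_mul,
    mul_inv_cancel₀ (by exact_mod_cast ν.ne_zero), map_one, map_one]

/-- The system `ν z ∂_z Y = -(Diag(d) + N) Y`, with series `d i` in `z^(1/ν)`, has the solution
`z^L e(Q)` with `L = -(Diag(d(0)) + N) / ν`. -/
theorem exists_solution_normal_form (ν : ℕ+) (d : Fin m → KHat U)
    (N : Matrix (Fin m) (Fin m) (Mer U)) (hN : ∀ i j, N i j ≠ 0 → i < j ∧ d i = d j)
    (hd : ∀ i, ∀ k > 0, (d i).coeff k = 0) :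
    ∃ (L : Matrix (Fin m) (Fin m) (Mer U)) (Z : Matrix (Fin m) (Fin m) (KBold U))
      (q : Fin m → ExpPart U), IsMatrixZPow L Z ∧ IsUnit Z ∧
      expDiag q * Z = Z * expDiag q ∧
      ((ν : ℕ) : KBold U) • (Z * expDiag q).map (dzDer U) =
        - (ofKHat U (HahnSeries.single (-1) 1) •
          ((Matrix.diagonal d + N.map HahnSeries.C).map (toRamified U ν) * (Z * expDiag q))) := by
  set c : Mer U := - Mer.const U ((ν : ℕ) : ℂ)⁻¹ with hc
  have hνc : ((ν : ℕ) : Mer U) * c = -1 := by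
    rw [hc, ← map_natCast (Mer.const U), mul_neg, ← map_mul,
      mul_inv_cancel₀ (by exact_mod_cast ν.ne_zero), map_one]
  have hνc' : ((ν : ℕ) : KBold U) * ofMer U c = -1 := by
    rw [← map_natCast (ofMer U), ← map_mul, hνc, map_neg, map_one]
  set l : Fin m → Mer U := fun i => c * (d i).coeff 0 with hl
  set N₁ : Matrix (Fin m) (Fin m) (Mer U) := c • N with hN₁
  have hNne : ∀ i j, N₁ i j ≠ 0 → N i j ≠ 0 := fun i j h h0 => h (by
    rw [hN₁, Matrix.smul_apply, h0, smul_zero])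
  set q : Fin m → ExpPart U := fun i => expPart ν (d i) with hq
  set ζ : KBold U := ofKHat U (HahnSeries.single (-1) 1) with hζ
  set Λ : Matrix (Fin m) (Fin m) (KBold U) := Matrix.diagonal fun i => zpow (l i) with hΛ
  set Z := Λ * logExp N₁ m with hZ
  have hpow : N₁ ^ m = 0 := pow_eq_zero_of_strictUpper fun i j h => (hN i j (hNne i j h)).1
  -- diagonal matrices depending only on `d i` commute with everything in sight
  have hcomm : ∀ g : KHat U → KBold U, (Matrix.diagonal fun i => g (d i)) * Z =
      Z * Matrix.diagonal fun i => g (d i) := by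
    intro g
    have h1 : (Matrix.diagonal fun i => g (d i)) * N₁.map (ofMer U) =
        N₁.map (ofMer U) * Matrix.diagonal fun i => g (d i) := diagonal_commute fun i j h => by
      have hne : N₁ i j ≠ 0 := fun h0 => h (by rw [Matrix.map_apply, h0, map_zero])
      rw [(hN i j (hNne i j hne)).2]
    rw [hZ, ← Matrix.mul_assoc, hΛ, Matrix.diagonal_mul_diagonal, Matrix.mul_assoc,
      ← logExp_commute h1, ← Matrix.mul_assoc, Matrix.diagonal_mul_diagonal]
    simp only [mul_comm]
  have hΛN : Λ * N₁.map (ofMer U) = N₁.map (ofMer U) * Λ := diagonal_commute fun i j h => by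
    have hne : N₁ i j ≠ 0 := fun h0 => h (by rw [Matrix.map_apply, h0, map_zero])
    simp only [hl, (hN i j (hNne i j hne)).2]
  have hdN : Matrix.diagonal l * N₁ = N₁ * Matrix.diagonal l := diagonal_commute fun i j h => by
    simp only [hl, (hN i j (hNne i j h)).2]
  have hQcomm : expDiag q * Z = Z * expDiag q := hcomm fun x => zexp (expPart ν x)
  set X₀ : Matrix (Fin m) (Fin m) (KBold U) := Matrix.diagonal fun i => ofMer U ((d i).coeff 0)
    with hX₀
  set X : Matrix (Fin m) (Fin m) (KBold U) := Matrix.diagonal fun i => toRamified U ν (d i) with hX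
  have hΛd : ((ν : ℕ) : KBold U) • Λ.map (dzDer U) = - (ζ • (X₀ * Λ)) := by
    rw [hΛ, map_dzDer_diagonal, hX₀, Matrix.diagonal_mul_diagonal, ← Matrix.diagonal_smul,
      ← Matrix.diagonal_smul, Matrix.diagonal_neg]
    congr 1
    ext i
    simp only [Pi.smul_apply, smul_eq_mul, dz_zpow', hl, map_mul]
    linear_combination ζ * ofMer U ((d i).coeff 0) * zpow (c * (d i).coeff 0) * hνc'
  have hN₁map : ((ν : ℕ) : KBold U) • N₁.map (ofMer U) = - N.map (ofMer U) := by
    ext i j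
    simp only [Matrix.smul_apply, Matrix.map_apply, Matrix.neg_apply, smul_eq_mul, hN₁, map_mul]
    linear_combination ofMer U (N i j) * hνc'
  have hZd : ((ν : ℕ) : KBold U) • Z.map (dzDer U) = - (ζ • ((X₀ + N.map (ofMer U)) * Z)) := by
    have h1 : Λ * (N₁.map (ofMer U) * logExp N₁ m) = N₁.map (ofMer U) * Z := by
      rw [← Matrix.mul_assoc, hΛN, Matrix.mul_assoc]
    have h2 : ((ν : ℕ) : KBold U) • (N₁.map (ofMer U) * Z) = - (N.map (ofMer U) * Z) := by
      rw [← Matrix.smul_mul, hN₁map, Matrix.neg_mul]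
    have h3 : ((ν : ℕ) : KBold U) • (Λ.map (dzDer U) * logExp N₁ m) = - (ζ • (X₀ * Z)) := by
      rw [← Matrix.smul_mul, hΛd, Matrix.neg_mul, Matrix.smul_mul, Matrix.mul_assoc]
    rw [hZ, AddDer.map_matrix_mul, logExp_map_dz hpow, Matrix.mul_smul, h1, smul_add,
      smul_comm _ ζ, h2, h3, ← hZ, Matrix.add_mul, smul_add, smul_neg]
    abel
  have hQd : ((ν : ℕ) : KBold U) • (expDiag q).map (dzDer U) =
      - (ζ • ((X - X₀) * expDiag q)) := by
    rw [expDiag, map_dzDer_diagonal, hX, hX₀, Matrix.diagonal_sub, Matrix.diagonal_mul_diagonal,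
      ← Matrix.diagonal_smul, ← Matrix.diagonal_smul, Matrix.diagonal_neg]
    congr 1
    ext i
    simp only [Pi.smul_apply, smul_eq_mul]
    rw [dz_zexp_expPart ν (d i) (hd i), mul_assoc]
  have hXmap : (Matrix.diagonal d + N.map HahnSeries.C).map (toRamified U ν) =
      X + N.map (ofMer U) := by
    ext i j
    rw [Matrix.map_apply, Matrix.add_apply, Matrix.add_apply, map_add, Matrix.map_apply,
      toRamified_C, Matrix.map_apply, hX]
    congr 1
    by_cases h : i = j
    · subst h
      rw [Matrix.diagonal_apply_eq, Matrix.diagonal_apply_eq]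
    · rw [Matrix.diagonal_apply_ne _ h, Matrix.diagonal_apply_ne _ h, map_zero]
  refine ⟨Matrix.diagonal l + N₁, Z, q, ⟨1, l, N₁, hpow, hdN, ?_, ?_⟩, ?_, hQcomm, ?_⟩
  · simp
  · simp only [Units.val_one, inv_one, Matrix.map_one _ (map_zero (ofMer U)) (map_one (ofMer U)),
      Matrix.one_mul, Matrix.mul_one]
    rfl
  · exact (isUnit_diagonal fun i => isUnit_zpow _).mul (isUnit_logExp hpow)
  · have hXX₀ : Z * (X - X₀) = (X - X₀) * Z := by
      rw [hX, hX₀, Matrix.mul_sub, Matrix.sub_mul, hcomm (toRamified U ν),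
        hcomm fun x => ofMer U (x.coeff 0)]
    have h1 : ((ν : ℕ) : KBold U) • (Z * (expDiag q).map (dzDer U)) =
        - (ζ • ((X - X₀) * (Z * expDiag q))) := by
      rw [← Matrix.mul_smul, hQd, Matrix.mul_neg, Matrix.mul_smul, ← Matrix.mul_assoc, hXX₀,
        Matrix.mul_assoc]
    have h2 : ((ν : ℕ) : KBold U) • (Z.map (dzDer U) * expDiag q) =
        - (ζ • ((X₀ + N.map (ofMer U)) * (Z * expDiag q))) := by
      rw [← Matrix.smul_mul, hZd, Matrix.neg_mul, Matrix.smul_mul, Matrix.mul_assoc]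
    rw [AddDer.map_matrix_mul, smul_add, h1, h2, hXmap, ← neg_add, ← smul_add, ← Matrix.add_mul]
    congr 3
    abel

/-- A gauge transformation to a system with known solution gives a solution. -/
theorem map_dz_of_isGauge (ν : ℕ+) {A H B : Matrix (Fin m) (Fin m) (KHat U)}
    {Y : Matrix (Fin m) (Fin m) (KBold U)} (hG : IsGauge (eulerDer (Mer U)) (ramConn ν A) H B)
    (hY : ((ν : ℕ) : KBold U) • Y.map (dzDer U) =
      - (ofKHat U (HahnSeries.single (-1) 1) • (B.map (toRamified U ν) * Y))) :
    (H.map (toRamified U ν) * Y).map (dzDer U) =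
      A.map (ofKHat U) * (H.map (toRamified U ν) * Y) := by
  set ζ : KBold U := ofKHat U (HahnSeries.single (-1) 1) with hζ
  set G := H.map (toRamified U ν) with hGdef
  have hram : ζ • (ramConn ν A).map (toRamified U ν) =
      - (((ν : ℕ) : KBold U) • A.map (ofKHat U)) := by
    ext i j
    simp only [ramConn, Matrix.smul_apply, Matrix.map_apply, Matrix.neg_apply, smul_eq_mul, map_mul,
      map_natCast, toRamified_ramify, map_neg]
    linear_combination -((ν : ℕ) : KBold U) * ofKHat U (A i j) *
      ofKHat_single_neg_one_mul (U := U)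
  have hHd : ((ν : ℕ) : KBold U) • G.map (dzDer U) =
      ζ • (H.map (eulerDer (Mer U))).map (toRamified U ν) := by
    ext i j
    exact dz_toRamified ν (H i j)
  have hgauge : (H.map (eulerDer (Mer U))).map (toRamified U ν) =
      G * B.map (toRamified U ν) - (ramConn ν A).map (toRamified U ν) * G := by
    rw [hGdef, ← Matrix.map_mul, ← Matrix.map_mul, ← hG, Matrix.map_add _ (map_add _),
      add_sub_cancel_right]
  have key : ((ν : ℕ) : KBold U) • (G * Y).map (dzDer U) =
      ((ν : ℕ) : KBold U) • (A.map (ofKHat U) * (G * Y)) := by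
    have h1 : ((ν : ℕ) : KBold U) • (G.map (dzDer U) * Y) =
        ζ • (G * (B.map (toRamified U ν) * Y)) +
          ((ν : ℕ) : KBold U) • (A.map (ofKHat U) * (G * Y)) := by
      have h0 : ζ • ((ramConn ν A).map (toRamified U ν) * G) =
          - (((ν : ℕ) : KBold U) • (A.map (ofKHat U) * G)) := by
        rw [← Matrix.smul_mul, hram, Matrix.neg_mul, Matrix.smul_mul]
      rw [← Matrix.smul_mul, hHd, hgauge, smul_sub, h0, sub_neg_eq_add, Matrix.add_mul,
        Matrix.smul_mul, Matrix.smul_mul, Matrix.mul_assoc, Matrix.mul_assoc]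
    have h2 : ((ν : ℕ) : KBold U) • (G * Y.map (dzDer U)) =
        - (ζ • (G * (B.map (toRamified U ν) * Y))) := by
      rw [← Matrix.mul_smul, hY, Matrix.mul_neg, Matrix.mul_smul]
    rw [AddDer.map_matrix_mul, smul_add, h1, h2]
    abel
  ext i j
  have := congrFun (congrFun key i) j
  rw [Matrix.smul_apply, Matrix.smul_apply, smul_eq_mul, smul_eq_mul] at this
  exact (isUnit_natCast_KBold ν).mul_left_cancel this

theorem IsConvergent.isAnalyticOn {f : KHat U} (hf : IsConvergent f) (k : ℤ) :
    Mer.IsAnalyticOn (f.coeff k) (le_refl U) := by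
  obtain ⟨φ, hφ, -⟩ := hf
  exact ⟨φ k, hφ k⟩

end Solution

end ParamHT

end

theorem proposition1p3 (n m : ℕ) (U : TopologicalSpace.Opens (ParamHT.Param n))
    (hU : ParamHT.IsPolydisc U) (A : Matrix (Fin m) (Fin m) (ParamHT.KHat U)) :
    ∃ (U' : TopologicalSpace.Opens (ParamHT.Param n)) (hU' : U' ≤ U), ParamHT.IsPolydisc U' ∧
      ∃ (ν : ℕ) (_ : 0 < ν) (F : GL (Fin m) (ParamHT.KBold U'))
        (H : GL (Fin m) (ParamHT.Ramified U' ν))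
        (L : Matrix (Fin m) (Fin m) (ParamHT.Mer U'))
        (Z : Matrix (Fin m) (Fin m) (ParamHT.KBold U'))
        (q : Fin m → ParamHT.ExpPart U'),
        -- `F` is a fundamental solution of `∂_z Y = A Y`
        F.1.map (ParamHT.dz U') =
          A.map (fun a => ParamHT.ofKHat U' (ParamHT.KHat.restrict hU' a)) * F.1 ∧
        -- `F = H z^L e(Q)`
        ParamHT.IsMatrixZPow L Z ∧
        F.1 = H.1.map (fun x => (x : ParamHT.KBold U')) * Z * ParamHT.expDiag q ∧
        ParamHT.expDiag q * Z = Z * ParamHT.expDiag q ∧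
        -- the convergent case
        ((∀ i j, ParamHT.IsConvergent (A i j)) →
          ∃ (U'' : TopologicalSpace.Opens (ParamHT.Param n)) (hU'' : U'' ≤ U'),
            ParamHT.IsPolydisc U'' ∧
            ∀ i j, ParamHT.HasAnalyticCoeffs hU'' ν (H.1 i j : ParamHT.KBold U')) := by
  open ParamHT in
  obtain ⟨V, hVU, hV, ν, H, H', d, N, hHH, hHH', hG, hN, hd, hAn⟩ :=
    exists_meromorphic_normal_form hU A
  obtain ⟨L, Z, q, hL, hZ, hcomm, hsol⟩ := exists_solution_normal_form ν d N hN hd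
  let ρ : KHat V →+* Ramified V ν :=
    (toRamified V ν).codRestrict (Ramified V ν) (toRamified_mem ν)
  let Hu : GL (Fin m) (Ramified V ν) := ⟨H.map ρ, H'.map ρ,
    by rw [← Matrix.map_mul, hHH, Matrix.map_one _ (map_zero _) (map_one _)],
    by rw [← Matrix.map_mul, hHH', Matrix.map_one _ (map_zero _) (map_one _)]⟩
  have hunit : IsUnit (H.map (toRamified V ν) * (Z * expDiag q)) := by
    refine IsUnit.mul ?_ (hZ.mul (isUnit_diagonal fun i => isUnit_zexp _))
    refine ⟨⟨H.map (toRamified V ν), H'.map (toRamified V ν), ?_, ?_⟩, rfl⟩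
    · rw [← Matrix.map_mul, hHH, Matrix.map_one _ (map_zero _) (map_one _)]
    · rw [← Matrix.map_mul, hHH', Matrix.map_one _ (map_zero _) (map_one _)]
  refine ⟨V, hVU, hV, ν, ν.pos, hunit.unit, Hu, L, Z, q, ?_, hL, ?_, hcomm, fun hA => ?_⟩
  · have h1 := map_dz_of_isGauge ν hG hsol
    rw [Matrix.map_map] at h1
    exact h1
  · rw [Matrix.mul_assoc]
    rfl
  · obtain ⟨W, hWV, hW, h⟩ := hAn fun i j k => (hA i j).isAnalyticOn k
    exact ⟨W, hWV, hW, fun i j => hasAnalyticCoeffs_toRamified hWV ν (h i j)⟩
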